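/- Let $n\ge 1$, let $\hat\nabla$ be the standard flat connection on $\mathbb{R}^{n+1}$ and let $\Psi$ be a $\hat\nabla$-parallel volume form on $\mathbb{R}^{n+1}$ (a nonzero constant multiple of $dx^1\wedge\dots\wedge dx^{n+1}$). Let $F$ be a $C^\infty$ function on an open set $D\subset\mathbb{R}^{n+1}$, and write $F_i$, $F_{ij}$ for the components of $dF$ and $\hat\nabla dF$. Define $H(F)$ by $\det F_{ij}=H(F)\Psi^2$; let $U^{ij}$ be the adjugate tensor of $F_{ij}$, normalized so that $U^{ip}F_{pj}=H(F)\delta_j{}^i$; put $N^i=U^{ip}F_p$ and $U(F)=N^iF_i$. Where $U(F)\ne0$ put $\Pi_{ij}=F_{ij}-U(F)^{-1}H(F)F_iF_j$; let $\Pi^{ij}=m^{ij}-q^{-1}U(F)^{-1}N^iN^j$, where $m^{ij}$ is the inverse of $m_{ij}=\Pi_{ij}+qU(F)^{-1}F_iF_j$ (this does not depend on the nonvanishing function $q$; take $q=1$); and put $$k^{ij}=|U(F)|^{1/(n+2)}\Pi^{ij},\qquad \mu=\tfrac1{n+2}\,d\log|U(F)|,$$ $$W^i=-|U(F)|^{1/(n+2)}U(F)^{-1}N^i-k^{ip}\mu_p,\qquad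 \rho_i=-|U(F)|^{-1/(n+2)}F_i .$$ A vector field $\xi$ transverse to a hypersurface $\Sigma$ determines a connection $\nabla$, a symmetric tensor $h$, a shape operator $S$ and a one-form $\tau$ on $\Sigma$ by $\hat\nabla_XY=\nabla_XY+h(X,Y)\xi$ and $\hat\nabla_X\xi=-S(X)+\tau(X)\xi$. If $h$ is nondegenerate, $\xi$ is an equiaffine normal if the volume densities $|\iota(\xi)\Psi|$ and $|\det h|^{1/2}$ coincide and are $\nabla$-parallel. The equiaffine mean curvature is $H_{\mathrm{aff}}=\frac1n\operatorname{tr}S$ for the equiaffine normal. A solution of the affine normal flow is a smooth map $\psi(t,x)$, defined on an open set of pairs $(t,x)\in\mathbb{R}\times\mathbb{R}^n$, such that each $\psi(t,\cdot)$ is an immersion and $\partial_t\psi(t,\cdot)$ is an equiaffine normal along it. A parametrization of a piece of a hypersurface is a smooth injective immersion into it of an open subset of $\mathbb{R}^n$. For $\Omega\subset\mathbb{R}^{n+1}$ write $\Sigma_r(\Omega)=\{x\in\Omega: F(x)=r\}$; level sets are co-oriented by $-\operatorname{sign}(U(F))N$. (1) Let $\Omega$ be a connected component of $\{x\in D:U(F)(x)\neq0\}$.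 Then $\rho_iW^i=1$ on $\Omega$. For every $r\in\mathbb{R}$, $\rho$ annihilates the tangent spaces of $\Sigma_r(\Omega)$, the restriction of $W$ is the unique co-oriented equiaffine normal of $\Sigma_r(\Omega)$, and along $\Sigma_r(\Omega)$ $$nH_{\mathrm{aff}}=\hat\nabla_p(k^{pq}\mu_q)+(n+2)|U(F)|^{1/(n+2)}U(F)^{-1}\bigl(H(F)-N^p\mu_p\bigr)$$ $$\phantom{nH_{\mathrm{aff}}}=\hat\nabla_p(k^{pq}\mu_q)+(-1)^{n+1}(n+2)\operatorname{sign}(U(F))\,(\det\hat\nabla\rho)/\Psi^2 .$$ (2) Let $\Omega\subset D$ be a connected open set on which $U(F)$ equals a nonzero constant $\kappa$. Then $W=-\operatorname{sign}(\kappa)|\kappa|^{-(n+1)/(n+2)}N$ on $\Omega$; for every $r$ this is the co-oriented equiaffine normal of $\Sigma_r(\Omega)$, and along $\Sigma_r(\Omega)$ $$nH_{\mathrm{aff}}=(n+2)\operatorname{sign}(\kappa)|\kappa|^{-(n+1)/(n+2)}H(F).$$ Let moreover $\Phi$ be the maximal flow of $W$ in $\Omega$, so $\frac{d}{dt}\Phi(t,p)=W_{\Phi(t,p)}$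 and $\Phi(0,p)=p$; let $\Delta\subset\mathbb{R}^n$ be open and let $\phi:\Delta\to\Sigma_{t_0}(\Omega)$ be a parametrization of a piece of $\Sigma_{t_0}(\Omega)$. Put $\psi(t,x)=\Phi(t,\phi(x))$ and $\varphi(t,x)=\psi(-|\kappa|^{-1/(n+2)}t,x)$, each on the set of all $(t,x)$, $x\in\Delta$, for which it is defined. Then $\psi$ is defined on an open set containing $\{0\}\times\Delta$ and solves the affine normal flow, with $\psi(0,\cdot)=\phi$, $\partial_t\psi(t,x)=W_{\psi(t,x)}$ and $F(\psi(t,x))=t_0-|\kappa|^{1/(n+2)}t$. Its time rescaling $\varphi$ satisfies $\partial_t\varphi(t,x)=-|\kappa|^{-1/(n+2)}W_{\varphi(t,x)}$ and $F(\varphi(t,x))=t+t_0$, and for each $t$ the set of $x\in\Delta$ at which $\varphi(t,\cdot)$ is defined is open and $\varphi(t,\cdot)$ is a parametrization, by this set, of a piece of $\Sigma_{t+t_0}(\Omega)$. -/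

import Mathlib

open Set
open scoped ContDiff Matrix Topology

noncomputable section

namespace LevelSet

/-- The coordinate space `ℝ^m`. -/
abbrev Vec (m : ℕ) : Type := Fin m → ℝ

/-- Partial derivative `∂g/∂x^i` of a (scalar or vector valued) function on `ℝ^m`. -/
def pd {m : ℕ} {V : Type*} [NormedAddCommGroup V] [NormedSpace ℝ V]
    (i : Fin m) (g : Vec m → V) (x : Vec m) : V :=
  fderiv ℝ g x (Pi.single i 1)

/-! ### Hypersurfaces and transversal fields in flat space

Hypersurfaces are described by local parametrizations `f : Δ → ℝ^{n+1}`, with `Δ ⊆ ℝ^n` open,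
and a field `ξ` along `f` assigns to `x ∈ Δ` a vector `ξ x` based at `f x`. -/

/-- The frame `(ξ, ∂₁f, …, ∂ₙf)` along a parametrized hypersurface. -/
def frame {n : ℕ} (f ξ : Vec n → Vec (n + 1)) (x : Vec n) : Fin (n + 1) → Vec (n + 1) :=
  Fin.cons (ξ x) fun i => pd i f x

/-- The components of `v` in the frame `(ξ, ∂₁f, …, ∂ₙf)` at `x`, so that (if this frame is a
basis) `v = coord 0 • ξ + ∑ k, coord k.succ • ∂ₖf`. -/
def coord {n : ℕ} (f ξ : Vec n → Vec (n + 1)) (x : Vec n) (v : Vec (n + 1)) :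
    Fin (n + 1) → ℝ :=
  ((Matrix.of (frame f ξ x))ᵀ)⁻¹ *ᵥ v

/-- The Christoffel symbols `Γ_{ij}^k` of the connection induced by the transversal `ξ`:
`∂ᵢ∂ⱼf = ∑ₖ Γ_{ij}^k ∂ₖf + h_{ij} ξ`. -/
def christoffel {n : ℕ} (f ξ : Vec n → Vec (n + 1)) (x : Vec n) (i j k : Fin n) : ℝ :=
  coord f ξ x (pd i (pd j f) x) k.succ

/-- The representative `h_{ij}` of the second fundamental form with respect to the transversal
`ξ`: `∂ᵢ∂ⱼf = ∑ₖ Γ_{ij}^k ∂ₖf + h_{ij} ξ`. -/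
def secondForm {n : ℕ} (f ξ : Vec n → Vec (n + 1)) (x : Vec n) : Matrix (Fin n) (Fin n) ℝ :=
  Matrix.of fun i j => coord f ξ x (pd i (pd j f) x) 0

/-- The shape operator `S_i^k` of the transversal `ξ`:
`∂ᵢξ = -∑ₖ S_i^k ∂ₖf + τ_i ξ`. -/
def shapeOperator {n : ℕ} (f ξ : Vec n → Vec (n + 1)) (x : Vec n) :
    Matrix (Fin n) (Fin n) ℝ :=
  Matrix.of fun i k => -coord f ξ x (pd i ξ x) k.succ

/-- The mean curvature `n⁻¹ tr S` with respect to the transversal `ξ`. -/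
def meanCurvature {n : ℕ} (f ξ : Vec n → Vec (n + 1)) (x : Vec n) : ℝ :=
  (n : ℝ)⁻¹ * (shapeOperator f ξ x).trace

/-- The component `Ψ(ξ, ∂₁f, …, ∂ₙf)` of the volume form `ι(ξ)Ψ` induced on the hypersurface. -/
def inducedVolume {n : ℕ} (Ψ : Vec (n + 1) [⋀^Fin (n + 1)]→ₗ[ℝ] ℝ)
    (f ξ : Vec n → Vec (n + 1)) (x : Vec n) : ℝ :=
  Ψ (frame f ξ x)

/-- `ξ` is an equiaffine normal along the parametrized hypersurface `f` on `Δ`: it is a smooth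
transversal, the second fundamental form is nondegenerate, the densities `|ι(ξ)Ψ|` and
`vol_h = |det h|^{1/2}` coincide, and they are parallel for the connection `∇` induced by `ξ`,
that is `∇ᵢ(ι(ξ)Ψ) = 0`. This determines `ξ` up to sign on connected pieces. -/
structure IsEquiaffineNormalAlong {n : ℕ} (Ψ : Vec (n + 1) [⋀^Fin (n + 1)]→ₗ[ℝ] ℝ)
    (Δ : Set (Vec n)) (f ξ : Vec n → Vec (n + 1)) : Prop where
  smooth : ContDiffOn ℝ ∞ ξ Δ
  transverse : ∀ x ∈ Δ, LinearIndependent ℝ (frame f ξ x)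
  nondegenerate : ∀ x ∈ Δ, (secondForm f ξ x).det ≠ 0
  volume_eq : ∀ x ∈ Δ, |inducedVolume Ψ f ξ x| = √|(secondForm f ξ x).det|
  parallel : ∀ x ∈ Δ, ∀ i : Fin n,
    pd i (inducedVolume Ψ f ξ) x = (∑ j, christoffel f ξ x i j j) * inducedVolume Ψ f ξ x

/-- `f` is a (regular, injective, smooth) parametrization by the open set `Δ ⊆ ℝ^n` of a piece of
the hypersurface `S`. -/
structure IsParam {n : ℕ} (S : Set (Vec (n + 1))) (Δ : Set (Vec n))
    (f : Vec n → Vec (n + 1)) : Prop where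
  isOpen : IsOpen Δ
  smooth : ContDiffOn ℝ ∞ f Δ
  injOn : InjOn f Δ
  immersion : ∀ x ∈ Δ, LinearIndependent ℝ fun i => pd i f x
  mapsTo : MapsTo f Δ S

/-- `S` is a smooth hypersurface: each `p ∈ S` has a relative neighborhood in `S` covered by a
parametrized piece of `S` through `p`. -/
def IsHypersurface {n : ℕ} (S : Set (Vec (n + 1))) : Prop :=
  ∀ p ∈ S, ∃ (Δ : Set (Vec n)) (f : Vec n → Vec (n + 1)),
    IsParam S Δ f ∧ p ∈ f '' Δ ∧ f '' Δ ∈ 𝓝[S] p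

/-- `ξ` is the equiaffine normal of the hypersurface `S` consistent with the co-orientation
determined by the transverse field `V`: it is an equiaffine normal along each parametrized piece
of `S`, and modulo tangent vectors it is a positive multiple of `V`. -/
def IsEquiaffineNormal {n : ℕ} (Ψ : Vec (n + 1) [⋀^Fin (n + 1)]→ₗ[ℝ] ℝ)
    (S : Set (Vec (n + 1))) (V ξ : Vec (n + 1) → Vec (n + 1)) : Prop :=
  IsHypersurface S ∧ ∀ (Δ : Set (Vec n)) (f : Vec n → Vec (n + 1)), IsParam S Δ f →
    IsEquiaffineNormalAlong Ψ Δ f (ξ ∘ f) ∧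
    ∀ x ∈ Δ, ∃ a : ℝ, 0 < a ∧
      ξ (f x) - a • V (f x) ∈ Submodule.span ℝ (range fun i => pd i f x)

/-- `H` is the mean curvature at `p ∈ S` of the hypersurface `S` with respect to the transversal
`ξ`, computed in any parametrization around `p`. -/
def IsMeanCurvatureAt {n : ℕ} (S : Set (Vec (n + 1))) (ξ : Vec (n + 1) → Vec (n + 1))
    (p : Vec (n + 1)) (H : ℝ) : Prop :=
  (∃ (Δ : Set (Vec n)) (f : Vec n → Vec (n + 1)), IsParam S Δ f ∧ p ∈ f '' Δ) ∧
  ∀ (Δ : Set (Vec n)) (f : Vec n → Vec (n + 1)), IsParam S Δ f →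
    ∀ x ∈ Δ, f x = p → meanCurvature f (ξ ∘ f) x = H

/-- `H` is the equiaffine mean curvature at `p` of the hypersurface `S` co-oriented by `V`: the
mean curvature with respect to the co-oriented equiaffine normal. -/
def IsEquiaffineMeanCurvatureAt {n : ℕ} (Ψ : Vec (n + 1) [⋀^Fin (n + 1)]→ₗ[ℝ] ℝ)
    (S : Set (Vec (n + 1))) (V : Vec (n + 1) → Vec (n + 1)) (p : Vec (n + 1)) (H : ℝ) : Prop :=
  ∃ ξ : Vec (n + 1) → Vec (n + 1), IsEquiaffineNormal Ψ S V ξ ∧ IsMeanCurvatureAt S ξ p H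

/-- `ψ` is a smooth solution, on the open set `𝒟` of pairs `(t, x)`, of the affine normal flow:
at each time `t`, `ψ(t, ·)` is an immersion and `∂ψ/∂t(t, ·)` is an equiaffine normal along it. -/
structure IsAffineNormalFlow {n : ℕ} (Ψ : Vec (n + 1) [⋀^Fin (n + 1)]→ₗ[ℝ] ℝ)
    (𝒟 : Set (ℝ × Vec n)) (ψ : ℝ → Vec n → Vec (n + 1)) : Prop where
  isOpen : IsOpen 𝒟
  smooth : ContDiffOn ℝ ∞ (fun q : ℝ × Vec n => ψ q.1 q.2) 𝒟
  normal : ∀ t : ℝ, IsEquiaffineNormalAlong Ψ {x | (t, x) ∈ 𝒟} (ψ t)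
    fun x => deriv (fun s => ψ s x) t

/-! ### Tensors derived from a function

All components are with respect to the standard coordinates of `ℝ^{n+1}`; densities are turned
into functions by means of the parallel volume form `Ψ`. -/

/-- The component `Ψ(∂₁, …, ∂_{n+1})`, so that `Ψ = volCoeff Ψ • dx¹ ∧ ⋯ ∧ dx^{n+1}`. -/
def volCoeff {m : ℕ} (Ψ : Vec m [⋀^Fin m]→ₗ[ℝ] ℝ) : ℝ :=
  Ψ fun i => Pi.single i 1

/-- The differential `F_i`. -/
def diff {m : ℕ} (F : Vec m → ℝ) (x : Vec m) : Vec m := fun i => pd i F x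

/-- The Hessian `F_{ij}`. -/
def hess {m : ℕ} (F : Vec m → ℝ) (x : Vec m) : Matrix (Fin m) (Fin m) ℝ :=
  Matrix.of fun i j => pd i (pd j F) x

/-- The quotient `det A / Ψ²` for a covariant two-tensor `A`. -/
def detRel {m : ℕ} (Ψ : Vec m [⋀^Fin m]→ₗ[ℝ] ℝ) (A : Matrix (Fin m) (Fin m) ℝ) : ℝ :=
  A.det / volCoeff Ψ ^ 2

/-- The Hessian determinant `H(F)`, `det Hess F = H(F) Ψ²`. -/
def hessDet {m : ℕ} (Ψ : Vec m [⋀^Fin m]→ₗ[ℝ] ℝ) (F : Vec m → ℝ) (x : Vec m) : ℝ :=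
  detRel Ψ (hess F x)

/-- The adjugate tensor `U^{ij}` of the Hessian, `U^{ip} F_{pj} = H(F) δ_j^i`. -/
def adjHess {m : ℕ} (Ψ : Vec m [⋀^Fin m]→ₗ[ℝ] ℝ) (F : Vec m → ℝ) (x : Vec m) :
    Matrix (Fin m) (Fin m) ℝ :=
  (volCoeff Ψ ^ 2)⁻¹ • (hess F x).adjugate

/-- The vector field `N^i = U^{ip} F_p`. -/
def fieldN {m : ℕ} (Ψ : Vec m [⋀^Fin m]→ₗ[ℝ] ℝ) (F : Vec m → ℝ) (x : Vec m) : Vec m :=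
  adjHess Ψ F x *ᵥ diff F x

/-- The function `U(F) = N^i F_i = U^{ij} F_i F_j`. -/
def opU {m : ℕ} (Ψ : Vec m [⋀^Fin m]→ₗ[ℝ] ℝ) (F : Vec m → ℝ) (x : Vec m) : ℝ :=
  fieldN Ψ F x ⬝ᵥ diff F x

/-- The tensor `Π_{ij} = F_{ij} - U(F)⁻¹ H(F) F_i F_j`. -/
def sff {m : ℕ} (Ψ : Vec m [⋀^Fin m]→ₗ[ℝ] ℝ) (F : Vec m → ℝ) (x : Vec m) :
    Matrix (Fin m) (Fin m) ℝ :=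
  hess F x - ((opU Ψ F x)⁻¹ * hessDet Ψ F x) • Matrix.vecMulVec (diff F x) (diff F x)

/-- The tensor `Π^{ij} = m^{ij} - q⁻¹ U(F)⁻¹ N^i N^j`, where `m^{ij}` is the inverse of
`m_{ij} = Π_{ij} + q U(F)⁻¹ F_i F_j`; it does not depend on the nonvanishing function `q`, which
is taken to be `1`. -/
def sffDual {m : ℕ} (Ψ : Vec m [⋀^Fin m]→ₗ[ℝ] ℝ) (F : Vec m → ℝ) (x : Vec m) :
    Matrix (Fin m) (Fin m) ℝ :=
  (sff Ψ F x + (opU Ψ F x)⁻¹ • Matrix.vecMulVec (diff F x) (diff F x))⁻¹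
    - (opU Ψ F x)⁻¹ • Matrix.vecMulVec (fieldN Ψ F x) (fieldN Ψ F x)

variable {n : ℕ} (Ψ : Vec (n + 1) [⋀^Fin (n + 1)]→ₗ[ℝ] ℝ) (F : Vec (n + 1) → ℝ)

/-- The tensor `k^{ij} = |U(F)|^{1/(n+2)} Π^{ij}`. -/
def kDual (x : Vec (n + 1)) : Matrix (Fin (n + 1)) (Fin (n + 1)) ℝ :=
  (|opU Ψ F x| ^ (1 / ((n : ℝ) + 2))) • sffDual Ψ F x

/-- The one-form `μ = (n+2)⁻¹ d log |U(F)|`. -/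
def muForm (x : Vec (n + 1)) : Vec (n + 1) :=
  ((n : ℝ) + 2)⁻¹ • diff (fun y => Real.log |opU Ψ F y|) x

/-- The equiaffine normal vector field associated with `F`,
`W^i = -|U(F)|^{1/(n+2)} U(F)⁻¹ N^i - k^{ip} μ_p`. -/
def fieldW (x : Vec (n + 1)) : Vec (n + 1) :=
  -((|opU Ψ F x| ^ (1 / ((n : ℝ) + 2)) * (opU Ψ F x)⁻¹) • fieldN Ψ F x)
    - kDual Ψ F x *ᵥ muForm Ψ F x

/-- The equiaffine conormal one-form `ρ_i = -|U(F)|^{-1/(n+2)} F_i`. -/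
def conormal (x : Vec (n + 1)) : Vec (n + 1) :=
  -((|opU Ψ F x| ^ (-1 / ((n : ℝ) + 2))) • diff F x)

/-- The two-tensor `∇_i ρ_j`. -/
def gradConormal (x : Vec (n + 1)) : Matrix (Fin (n + 1)) (Fin (n + 1)) ℝ :=
  Matrix.of fun i j => pd i (fun y => conormal Ψ F y j) x

/-- The field `-sign(U(F)) N^i`, that determines the co-orientation of the level sets. -/
def coorient (x : Vec (n + 1)) : Vec (n + 1) :=
  -(Real.sign (opU Ψ F x) • fieldN Ψ F x)

/-- The level set `{x ∈ Ω : F(x) = r}`. -/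
def level (r : ℝ) (Ω : Set (Vec (n + 1))) : Set (Vec (n + 1)) := {x ∈ Ω | F x = r}

end LevelSet

namespace LevelSet

/-- The divergence `∇_p X^p` of a vector field. -/
def divergence {m : ℕ} (X : Vec m → Vec m) (x : Vec m) : ℝ :=
  ∑ p, pd p (fun y => X y p) x

/-! ### The maximal flow of a vector field -/

/-- `γ` is an integral curve in `Ω` of `X`, defined on the open interval `J ∋ 0`, starting
at `p`. -/
structure IsIntegralCurveFrom {m : ℕ} (X : Vec m → Vec m) (Ω : Set (Vec m)) (p : Vec m)
    (J : Set ℝ) (γ : ℝ → Vec m) : Prop where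
  isOpen : IsOpen J
  ordConnected : J.OrdConnected
  zero_mem : (0 : ℝ) ∈ J
  initial : γ 0 = p
  mem : ∀ s ∈ J, γ s ∈ Ω
  hasDerivAt : ∀ s ∈ J, HasDerivAt γ (X (γ s)) s

/-- The domain of definition of the maximal flow of `X` in `Ω`: the pairs `(t, p)` such that some
integral curve in `Ω` starting at `p` is defined at time `t`. -/
def flowDomain {m : ℕ} (X : Vec m → Vec m) (Ω : Set (Vec m)) : Set (ℝ × Vec m) :=
  {q | ∃ (J : Set ℝ) (γ : ℝ → Vec m), IsIntegralCurveFrom X Ω q.2 J γ ∧ q.1 ∈ J}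

open Classical in
/-- The maximal flow `Φ(t, p)` of `X` in `Ω`: the value at time `t` of an integral curve in `Ω`
starting at `p` (for a smooth field on an open set all such curves agree at time `t`); outside
`flowDomain X Ω` the value is `p` and has no meaning. -/
def maximalFlow {m : ℕ} (X : Vec m → Vec m) (Ω : Set (Vec m)) (t : ℝ) (p : Vec m) : Vec m :=
  if h : (t, p) ∈ flowDomain X Ω then h.choose_spec.choose t else p

end LevelSet

end

namespace LevelSet

open Filter

/-! ### Matrix identities -/

/-! Write s = |U(F)|^{1/(n+2)}. Adding a suitable multiple of dF ⊗ dF to the Hessian gives a tensor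
m with det m = Ψ² and mN = dF. So m is invertible wherever U(F) ≠ 0, even if the Hessian is
degenerate. Consequently Π^{ij} annihilates dF and inverts the Hessian modulo dF. This gives dF(W) =
-s, that is ρ(W) = 1, and shows that (∇ρ)W is a multiple of dF (`conormalHess_mulVec_fieldW`).

Along a level set ρ kills tangent vectors, so h = -∇ρ restricted to them, and τ = -(∇ρ)W restricted
to them, which is zero. Since the induced volume has logarithmic derivative τ plus the trace of Γ
(`pd_inducedVolume`), it is parallel. Its square is |det h| by a determinant computation in the
frame (W, ∂f) (`inducedVolume_fieldW_sq`), where the exponent 1/(n+2) is exactly what is needed.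
Conversely, for a co-oriented equiaffine normal ξ with a = ρ(ξ) > 0, equality of the volumes gives
a^{n+2} = 1, and then τ = 0 makes the tangent vector ξ - W lie in the kernel of h
(`eq_fieldW_of_isEquiaffineNormalAlong`).

For the mean curvature, the trace of the Jacobian of W in the frame (W, ∂f) is div W = ρ(∂_W W) - tr
S (`meanCurvature_eq`). The divergence is computable because the adjugate of a Hessian is
divergence-free, so div N = (n+1)H(F).

If U(F) is constant, then μ = 0 and dF(W) is constant, so the flow of W carries level sets to level
sets at a known rate. What remains is smoothness of the maximal flow. Near time zero it follows from
the implicit function theorem for the integral equation in C([0,1], E)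
(`contDiffAt_of_integralCurves`), and the group law carries it along integral curves
(`flow_contDiffAt_nat`). -/

theorem eventually_det_add_smul_one_ne_zero {m : ℕ} (A : Matrix (Fin m) (Fin m) ℝ) :
    ∀ᶠ t in 𝓝[≠] (0 : ℝ), (A + t • (1 : Matrix (Fin m) (Fin m) ℝ)).det ≠ 0 := by
  -- As a function of t, det(A + t) is the characteristic polynomial of -A, so it has finitely many
  -- zeros.
  have hfin : {t : ℝ | (-A).charpoly.IsRoot t}.Finite :=
    Polynomial.finite_setOfPred_isRoot (-A).charpoly_monic.ne_zero
  have h1 : ({t : ℝ | (-A).charpoly.IsRoot t} \ {0})ᶜ ∈ 𝓝 (0 : ℝ) :=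
    (hfin.subset sdiff_subset).isClosed.isOpen_compl.mem_nhds (by simp)
  filter_upwards [nhdsWithin_le_nhds h1, self_mem_nhdsWithin] with t ht ht0 hdet
  refine ht ⟨?_, ht0⟩
  rw [mem_ofPred_eq, Polynomial.IsRoot, Matrix.eval_charpoly, sub_neg_eq_add, ← hdet, add_comm,
    Matrix.smul_one_eq_diagonal]
  rfl

/-- Identities between continuous functions of `A + t • 1` extend from invertible matrices. -/
theorem eq_of_forall_invertible {m : ℕ} (A : Matrix (Fin m) (Fin m) ℝ) {f g : ℝ → ℝ}
    (hf : Continuous f) (hg : Continuous g)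
    (h : ∀ t, (A + t • (1 : Matrix (Fin m) (Fin m) ℝ)).det ≠ 0 → f t = g t) : f 0 = g 0 := by
  have h1 : Tendsto f (𝓝[≠] 0) (𝓝 (f 0)) := hf.continuousAt.mono_left nhdsWithin_le_nhds
  have h2 : Tendsto g (𝓝[≠] 0) (𝓝 (g 0)) := hg.continuousAt.mono_left nhdsWithin_le_nhds
  refine tendsto_nhds_unique (h1.congr' ?_) h2
  filter_upwards [eventually_det_add_smul_one_ne_zero A] with t ht using h t ht

/-- The matrix determinant lemma in adjugate form. The adjugate is essential, since the Hessian may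
be singular; that case is a limit of invertible ones. -/
theorem det_add_vecMulVec {m : ℕ} (A : Matrix (Fin m) (Fin m) ℝ) (u v : Fin m → ℝ) :
    (A + Matrix.vecMulVec u v).det = A.det + v ⬝ᵥ (A.adjugate *ᵥ u) := by
  have key : ∀ B : Matrix (Fin m) (Fin m) ℝ, B.det ≠ 0 →
      (B + Matrix.vecMulVec u v).det = B.det + v ⬝ᵥ (B.adjugate *ᵥ u) := by
    intro B hB
    have h := Matrix.det_add_replicateCol_mul_replicateRow (ι := Unit)
      (isUnit_iff_ne_zero.2 hB) u v
    rw [← Matrix.vecMulVec_eq Unit] at h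
    rw [h]
    conv_lhs => enter [2]; rw [Matrix.det_unique]
    have hinv : B.det • B⁻¹ = B.adjugate := by
      rw [Matrix.inv_def, Ring.inverse_eq_inv', smul_smul, mul_inv_cancel₀ hB, one_smul]
    rw [← hinv, Matrix.smul_mulVec, dotProduct_smul, Matrix.dotProduct_mulVec]
    simp only [Matrix.add_apply, Matrix.one_apply_eq, Matrix.mul_apply, Matrix.replicateRow_apply,
      Matrix.replicateCol_apply, smul_eq_mul, dotProduct, Matrix.vecMul]
    ring
  have hc : Continuous fun t : ℝ => A + t • (1 : Matrix (Fin m) (Fin m) ℝ) := by fun_prop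
  have := eq_of_forall_invertible A
    (f := fun t => (A + t • (1 : Matrix (Fin m) (Fin m) ℝ) + Matrix.vecMulVec u v).det)
    (g := fun t => (A + t • (1 : Matrix (Fin m) (Fin m) ℝ)).det +
      v ⬝ᵥ ((A + t • (1 : Matrix (Fin m) (Fin m) ℝ)).adjugate *ᵥ u))
    (hc.add continuous_const).matrix_det
    (hc.matrix_det.add (continuous_const.dotProduct
      (hc.matrix_adjugate.matrix_mulVec continuous_const)))
    (fun t ht => key _ ht)
  simpa using this

/-! ### Pointwise algebra of the tensors derived from a function -/

theorem volCoeff_ne_zero {m : ℕ} {Ψ : Vec m [⋀^Fin m]→ₗ[ℝ] ℝ} (hΨ : Ψ ≠ 0) : volCoeff Ψ ≠ 0 := by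
  have h := (AlternatingMap.map_basis_ne_zero_iff (Pi.basisFun ℝ (Fin m)) Ψ).2 hΨ
  have e : (⇑(Pi.basisFun ℝ (Fin m)) : Fin m → Vec m) = fun i => Pi.single i 1 := by
    ext i; simp
  rwa [e] at h

theorem volume_eq_det {m : ℕ} (Ψ : Vec m [⋀^Fin m]→ₗ[ℝ] ℝ) (v : Fin m → Vec m) :
    Ψ v = volCoeff Ψ * (Matrix.of v).det := by
  have h := AlternatingMap.eq_smul_basis_det (Pi.basisFun ℝ (Fin m)) Ψ
  have e : (⇑(Pi.basisFun ℝ (Fin m)) : Fin m → Vec m) = fun i => Pi.single i 1 := by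
    ext i; simp
  conv_lhs => rw [h]
  rw [AlternatingMap.smul_apply, Pi.basisFun_det_apply, e, smul_eq_mul]
  rfl

section Pointwise

variable {m : ℕ} {Ψ : Vec m [⋀^Fin m]→ₗ[ℝ] ℝ} {F : Vec m → ℝ} {x : Vec m}

theorem hess_mulVec_fieldN : hess F x *ᵥ fieldN Ψ F x = hessDet Ψ F x • diff F x := by
  simp only [fieldN, adjHess, hessDet, detRel]
  rw [Matrix.smul_mulVec, Matrix.mulVec_smul, Matrix.mulVec_mulVec, Matrix.mul_adjugate,
    Matrix.smul_mulVec, Matrix.one_mulVec, smul_smul, div_eq_inv_mul]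

theorem dotProduct_adjugate_mulVec (hΨ : Ψ ≠ 0) (hs : (hess F x)ᵀ = hess F x) (v : Vec m) :
    diff F x ⬝ᵥ ((hess F x).adjugate *ᵥ v) = volCoeff Ψ ^ 2 * (fieldN Ψ F x ⬝ᵥ v) := by
  have hc := volCoeff_ne_zero hΨ
  rw [Matrix.dotProduct_mulVec, ← Matrix.mulVec_transpose, Matrix.adjugate_transpose, hs]
  simp only [fieldN, adjHess]
  rw [Matrix.smul_mulVec, smul_dotProduct, smul_eq_mul]
  field_simp

theorem det_hess (hΨ : Ψ ≠ 0) : (hess F x).det = volCoeff Ψ ^ 2 * hessDet Ψ F x := by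
  have hc := volCoeff_ne_zero hΨ
  simp only [hessDet, detRel]
  field_simp

theorem diff_dotProduct_fieldN : diff F x ⬝ᵥ fieldN Ψ F x = opU Ψ F x := by
  rw [opU, dotProduct_comm]

/-- The tensor `m_{ij}` of which `Π^{ij}` is derived. -/
noncomputable abbrev sffAug (Ψ : Vec m [⋀^Fin m]→ₗ[ℝ] ℝ) (F : Vec m → ℝ) (x : Vec m) :
    Matrix (Fin m) (Fin m) ℝ :=
  sff Ψ F x + (opU Ψ F x)⁻¹ • Matrix.vecMulVec (diff F x) (diff F x)

theorem sffAug_eq : sffAug Ψ F x = hess F x + Matrix.vecMulVec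
    (((opU Ψ F x)⁻¹ * (1 - hessDet Ψ F x)) • diff F x) (diff F x) := by
  rw [sffAug, sff, Matrix.smul_vecMulVec]
  module

/-- By the determinant lemma the rank-one term adds U⁻¹(1 - H)·U to H, for a total of 1 in units of
Ψ². Hence m is invertible whatever the rank of the Hessian. -/
theorem det_sffAug (hΨ : Ψ ≠ 0) (hs : (hess F x)ᵀ = hess F x) (hU : opU Ψ F x ≠ 0) :
    (sffAug Ψ F x).det = volCoeff Ψ ^ 2 := by
  rw [sffAug_eq, det_add_vecMulVec, dotProduct_adjugate_mulVec hΨ hs, dotProduct_smul, smul_eq_mul,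
    det_hess hΨ]
  change _ + _ * (_ * opU Ψ F x) = _
  field_simp
  ring

theorem isUnit_det_sffAug (hΨ : Ψ ≠ 0) (hs : (hess F x)ᵀ = hess F x) (hU : opU Ψ F x ≠ 0) :
    IsUnit (sffAug Ψ F x).det := by
  rw [det_sffAug hΨ hs hU, isUnit_iff_ne_zero]
  exact pow_ne_zero _ (volCoeff_ne_zero hΨ)

theorem sffAug_mulVec_fieldN (hU : opU Ψ F x ≠ 0) :
    sffAug Ψ F x *ᵥ fieldN Ψ F x = diff F x := by
  rw [sffAug_eq, Matrix.add_mulVec, hess_mulVec_fieldN, Matrix.vecMulVec_mulVec,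
    diff_dotProduct_fieldN]
  ext i
  simp
  field_simp
  ring

theorem sffAug_inv_mulVec (hΨ : Ψ ≠ 0) (hs : (hess F x)ᵀ = hess F x) (hU : opU Ψ F x ≠ 0) :
    (sffAug Ψ F x)⁻¹ *ᵥ diff F x = fieldN Ψ F x := by
  conv_lhs => rw [← sffAug_mulVec_fieldN hU]
  rw [Matrix.mulVec_mulVec, Matrix.nonsing_inv_mul _ (isUnit_det_sffAug hΨ hs hU),
    Matrix.one_mulVec]

theorem sffDual_eq : sffDual Ψ F x = (sffAug Ψ F x)⁻¹
    - (opU Ψ F x)⁻¹ • Matrix.vecMulVec (fieldN Ψ F x) (fieldN Ψ F x) := rfl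

/-- The Hessian is m minus a multiple of dF ⊗ dF, and m⁻¹ dF = N. The terms containing H(F) cancel,
which leaves Π^{ij} as an inverse of the Hessian modulo dF. -/
theorem hess_mul_sffDual (hΨ : Ψ ≠ 0) (hs : (hess F x)ᵀ = hess F x) (hU : opU Ψ F x ≠ 0)
    (v : Vec m) : hess F x *ᵥ (sffDual Ψ F x *ᵥ v) =
      v - ((opU Ψ F x)⁻¹ * (fieldN Ψ F x ⬝ᵥ v)) • diff F x := by
  have h1 : hess F x = sffAug Ψ F x - Matrix.vecMulVec
    (((opU Ψ F x)⁻¹ * (1 - hessDet Ψ F x)) • diff F x) (diff F x) := by rw [sffAug_eq]; abel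
  have hms : (sffAug Ψ F x)ᵀ = sffAug Ψ F x := by
    rw [sffAug_eq, Matrix.transpose_add, hs, Matrix.transpose_vecMulVec, Matrix.smul_vecMulVec,
      Matrix.vecMulVec_smul]
  have h2 : diff F x ⬝ᵥ ((sffAug Ψ F x)⁻¹ *ᵥ v) = fieldN Ψ F x ⬝ᵥ v := by
    rw [Matrix.dotProduct_mulVec, ← Matrix.mulVec_transpose, Matrix.transpose_nonsing_inv, hms,
      sffAug_inv_mulVec hΨ hs hU]
  rw [sffDual_eq, Matrix.sub_mulVec, Matrix.mulVec_sub, Matrix.smul_mulVec,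
    Matrix.vecMulVec_mulVec, Matrix.mulVec_smul, Matrix.mulVec_smul, hess_mulVec_fieldN]
  conv_lhs => enter [1]; rw [h1]
  rw [Matrix.sub_mulVec, Matrix.vecMulVec_mulVec, h2, Matrix.mulVec_mulVec,
    Matrix.mul_nonsing_inv _ (isUnit_det_sffAug hΨ hs hU), Matrix.one_mulVec]
  ext i
  simp
  ring

theorem diff_dotProduct_sffDual_mulVec (hΨ : Ψ ≠ 0) (hs : (hess F x)ᵀ = hess F x)
    (hU : opU Ψ F x ≠ 0) (v : Vec m) : diff F x ⬝ᵥ (sffDual Ψ F x *ᵥ v) = 0 := by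
  have hms : (sffAug Ψ F x)ᵀ = sffAug Ψ F x := by
    rw [sffAug_eq, Matrix.transpose_add, hs, Matrix.transpose_vecMulVec, Matrix.smul_vecMulVec,
      Matrix.vecMulVec_smul]
  rw [sffDual_eq, Matrix.sub_mulVec, Matrix.smul_mulVec, Matrix.vecMulVec_mulVec, dotProduct_sub,
    Matrix.dotProduct_mulVec, ← Matrix.mulVec_transpose, Matrix.transpose_nonsing_inv, hms,
    sffAug_inv_mulVec hΨ hs hU]
  simp [diff_dotProduct_fieldN]
  field_simp
  ring

end Pointwise

/-! ### Pointwise algebra of `W` and `ρ` -/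

section Normal

variable {n : ℕ} {Ψ : Vec (n + 1) [⋀^Fin (n + 1)]→ₗ[ℝ] ℝ} {F : Vec (n + 1) → ℝ}
  {x : Vec (n + 1)}

/-- The density `|U(F)|^{1/(n+2)}`. -/
noncomputable abbrev scale (Ψ : Vec (n + 1) [⋀^Fin (n + 1)]→ₗ[ℝ] ℝ) (F : Vec (n + 1) → ℝ)
    (x : Vec (n + 1)) : ℝ := |opU Ψ F x| ^ (1 / ((n : ℝ) + 2))

theorem scale_pos (hU : opU Ψ F x ≠ 0) : 0 < scale Ψ F x :=
  Real.rpow_pos_of_pos (abs_pos.2 hU) _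

theorem rpow_neg_one_div (a : ℝ) : |a| ^ (-1 / ((n : ℝ) + 2)) = (|a| ^ (1 / ((n : ℝ) + 2)))⁻¹ := by
  rw [← Real.rpow_neg (abs_nonneg _)]
  congr 1
  ring

theorem rpow_one_div_pow (a : ℝ) : (|a| ^ (1 / ((n : ℝ) + 2))) ^ (n + 2) = |a| := by
  rw [← Real.rpow_natCast, ← Real.rpow_mul (abs_nonneg _)]
  push_cast
  rw [one_div_mul_cancel (by positivity), Real.rpow_one]

theorem conormal_eq : conormal Ψ F x = -((scale Ψ F x)⁻¹ • diff F x) := by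
  rw [conormal, rpow_neg_one_div]

theorem fieldW_eq : fieldW Ψ F x = -((scale Ψ F x * (opU Ψ F x)⁻¹) • fieldN Ψ F x)
    - kDual Ψ F x *ᵥ muForm Ψ F x := rfl

theorem kDual_mulVec (v : Vec (n + 1)) :
    kDual Ψ F x *ᵥ v = scale Ψ F x • (sffDual Ψ F x *ᵥ v) := by
  rw [kDual, Matrix.smul_mulVec]

theorem diff_dotProduct_kDual (hΨ : Ψ ≠ 0) (hs : (hess F x)ᵀ = hess F x) (hU : opU Ψ F x ≠ 0)
    (v : Vec (n + 1)) : diff F x ⬝ᵥ (kDual Ψ F x *ᵥ v) = 0 := by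
  rw [kDual_mulVec, dotProduct_smul, diff_dotProduct_sffDual_mulVec hΨ hs hU, smul_zero]

theorem diff_dotProduct_fieldW (hΨ : Ψ ≠ 0) (hs : (hess F x)ᵀ = hess F x) (hU : opU Ψ F x ≠ 0) :
    diff F x ⬝ᵥ fieldW Ψ F x = -scale Ψ F x := by
  rw [fieldW_eq, dotProduct_sub, diff_dotProduct_kDual hΨ hs hU, dotProduct_neg, dotProduct_smul,
    diff_dotProduct_fieldN, smul_eq_mul, inv_mul_cancel_right₀ hU, sub_zero]

theorem conormal_dotProduct_fieldW (hΨ : Ψ ≠ 0) (hs : (hess F x)ᵀ = hess F x)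
    (hU : opU Ψ F x ≠ 0) : conormal Ψ F x ⬝ᵥ fieldW Ψ F x = 1 := by
  have := (scale_pos hU).ne'
  rw [conormal_eq, neg_dotProduct, smul_dotProduct, diff_dotProduct_fieldW hΨ hs hU, smul_eq_mul]
  field_simp

theorem hess_mulVec_fieldW (hΨ : Ψ ≠ 0) (hs : (hess F x)ᵀ = hess F x) (hU : opU Ψ F x ≠ 0) :
    hess F x *ᵥ fieldW Ψ F x = -((scale Ψ F x * (opU Ψ F x)⁻¹ *
      (hessDet Ψ F x - fieldN Ψ F x ⬝ᵥ muForm Ψ F x)) • diff F x)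
      - scale Ψ F x • muForm Ψ F x := by
  rw [fieldW_eq, Matrix.mulVec_sub, Matrix.mulVec_neg, Matrix.mulVec_smul, hess_mulVec_fieldN,
    kDual_mulVec, Matrix.mulVec_smul, hess_mul_sffDual hΨ hs hU]
  module

/-- The algebraic expression of `∇ρ`. -/
noncomputable abbrev conormalHess (Ψ : Vec (n + 1) [⋀^Fin (n + 1)]→ₗ[ℝ] ℝ) (F : Vec (n + 1) → ℝ)
    (x : Vec (n + 1)) : Matrix (Fin (n + 1)) (Fin (n + 1)) ℝ :=
  -((scale Ψ F x)⁻¹ • (hess F x + Matrix.vecMulVec (-muForm Ψ F x) (diff F x)))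

/-- The term -kμ of W is there for this identity: modulo dF the Hessian sends W to -sμ, and this
cancels the contribution of -μ ⊗ dF, because dF(W) = -s. Only a multiple of dF survives, and it
vanishes on tangent vectors. -/
theorem conormalHess_mulVec_fieldW (hΨ : Ψ ≠ 0) (hs : (hess F x)ᵀ = hess F x)
    (hU : opU Ψ F x ≠ 0) : conormalHess Ψ F x *ᵥ fieldW Ψ F x =
      ((opU Ψ F x)⁻¹ * (hessDet Ψ F x - fieldN Ψ F x ⬝ᵥ muForm Ψ F x)) • diff F x := by
  have := (scale_pos hU).ne'
  rw [conormalHess, Matrix.neg_mulVec, Matrix.smul_mulVec, Matrix.add_mulVec,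
    hess_mulVec_fieldW hΨ hs hU, Matrix.vecMulVec_mulVec, diff_dotProduct_fieldW hΨ hs hU]
  ext i
  simp
  field_simp

theorem det_conormalHess (hΨ : Ψ ≠ 0) (hs : (hess F x)ᵀ = hess F x) :
    (conormalHess Ψ F x).det = (-1) ^ (n + 1) * (scale Ψ F x)⁻¹ ^ (n + 1) *
      (volCoeff Ψ ^ 2 * (hessDet Ψ F x - fieldN Ψ F x ⬝ᵥ muForm Ψ F x)) := by
  rw [conormalHess, Matrix.det_neg, Matrix.det_smul, det_add_vecMulVec, Matrix.mulVec_neg,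
    dotProduct_neg, dotProduct_adjugate_mulVec hΨ hs, det_hess hΨ, Fintype.card_fin]
  ring

/-- Both corrections to the Hessian have dF as second factor, so together they form a single
rank-one perturbation. -/
theorem det_conormalHess_sub (hΨ : Ψ ≠ 0) (hs : (hess F x)ᵀ = hess F x) (t : ℝ) :
    (-conormalHess Ψ F x + Matrix.vecMulVec (t • conormal Ψ F x) (conormal Ψ F x)).det =
      (scale Ψ F x)⁻¹ ^ (n + 1) * (volCoeff Ψ ^ 2 * (hessDet Ψ F x
        - fieldN Ψ F x ⬝ᵥ muForm Ψ F x + t * (scale Ψ F x)⁻¹ * opU Ψ F x)) := by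
  have e : -conormalHess Ψ F x + Matrix.vecMulVec (t • conormal Ψ F x) (conormal Ψ F x) =
      (scale Ψ F x)⁻¹ • (hess F x + Matrix.vecMulVec
        ((t * (scale Ψ F x)⁻¹) • diff F x - muForm Ψ F x) (diff F x)) := by
    rw [conormal_eq, conormalHess]
    ext i j
    simp [Matrix.vecMulVec_apply]
    ring
  rw [e, Matrix.det_smul, det_add_vecMulVec, dotProduct_adjugate_mulVec hΨ hs, det_hess hΨ,
    Fintype.card_fin, dotProduct_sub, dotProduct_smul]
  change _ * (_ + _ * (_ * opU Ψ F x - _)) = _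
  ring

end Normal

/-! ### Partial derivatives -/

section PartialDerivatives

variable {m k : ℕ} {V : Type*} [NormedAddCommGroup V] [NormedSpace ℝ V]

theorem clm_apply_eq_sum (L : Vec m →L[ℝ] V) (v : Vec m) :
    L v = ∑ p, v p • L (Pi.single p 1) := by
  conv_lhs => rw [pi_eq_sum_univ' v]
  simp only [map_sum, map_smul]

theorem fderiv_eq_sum_pd (g : Vec m → V) (y v : Vec m) :
    fderiv ℝ g y v = ∑ p, v p • pd p g y := clm_apply_eq_sum _ _

theorem pd_comp {g : Vec m → V} {f : Vec k → Vec m} {x : Vec k} (i : Fin k)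
    (hg : DifferentiableAt ℝ g (f x)) (hf : DifferentiableAt ℝ f x) :
    pd i (fun y => g (f y)) x = ∑ p, pd i f x p • pd p g (f x) := by
  rw [← fderiv_eq_sum_pd, pd, fderiv_fun_comp x hg hf]
  rfl

theorem pd_apply {f : Vec k → Vec m} {x : Vec k} (i : Fin k) (p : Fin m)
    (hf : DifferentiableAt ℝ f x) : pd i (fun y => f y p) x = pd i f x p := by
  rw [pd, (hasFDerivAt_pi'.1 hf.hasFDerivAt p).fderiv]
  rfl

theorem pd_congr {f g : Vec m → V} {x : Vec m} (i : Fin m) (h : f =ᶠ[𝓝 x] g) :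
    pd i f x = pd i g x := by
  rw [pd, pd, h.fderiv_eq]

theorem pd_mul {f g : Vec m → ℝ} {x : Vec m} (i : Fin m) (hf : DifferentiableAt ℝ f x)
    (hg : DifferentiableAt ℝ g x) :
    pd i (fun y => f y * g y) x = f x * pd i g x + g x * pd i f x := by
  simp [pd, fderiv_fun_mul hf hg]

theorem pd_sum {ι : Type*} {s : Finset ι} {f : ι → Vec m → V} {x : Vec m} (i : Fin m)
    (hf : ∀ a ∈ s, DifferentiableAt ℝ (f a) x) :
    pd i (fun y => ∑ a ∈ s, f a y) x = ∑ a ∈ s, pd i (f a) x := by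
  simp [pd, fderiv_fun_sum hf]

theorem pd_const (i : Fin m) (c : V) (x : Vec m) : pd i (fun _ => c) x = 0 := by
  simp [pd]

theorem _root_.ContDiffAt.pd {g : Vec m → V} {x : Vec m} (hg : ContDiffAt ℝ ∞ g x) (i : Fin m) :
    ContDiffAt ℝ ∞ (pd i g) x :=
  (hg.fderiv_right (m := ∞) (by simp)).clm_apply contDiffAt_const

theorem differentiableAt_of_smooth {g : Vec m → V} {x : Vec m} (hg : ContDiffAt ℝ ∞ g x) :
    DifferentiableAt ℝ g x := hg.differentiableAt (by simp)

theorem two_le_infty : (2 : WithTop ℕ∞) ≤ ∞ := by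
  exact WithTop.coe_le_coe.2 (le_top : (2 : ℕ∞) ≤ ⊤)

theorem pd_comm {g : Vec m → V} {x : Vec m} (hg : ContDiffAt ℝ 2 g x) (i j : Fin m) :
    pd i (pd j g) x = pd j (pd i g) x := by
  have hd : DifferentiableAt ℝ (fderiv ℝ g) x :=
    (hg.fderiv_right (m := 1) (by norm_num)).differentiableAt (by simp)
  have h : ∀ a b : Fin m, pd a (pd b g) x =
      fderiv ℝ (fderiv ℝ g) x (Pi.single a 1) (Pi.single b 1) := by
    intro a b
    have e : pd b g = fun y => fderiv ℝ g y (Pi.single b 1) := rfl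
    rw [pd, e, fderiv_clm_apply hd (by fun_prop)]
    simp
  rw [h, h]
  exact (hg.isSymmSndFDerivAt (by simp)).eq _ _

end PartialDerivatives

/-! ### Determinants and adjugates of matrix valued functions -/

section MatrixFunctions

variable {m k : ℕ}

theorem contDiffAt_det {r : WithTop ℕ∞} {E : Type*} [NormedAddCommGroup E] [NormedSpace ℝ E]
    {A : E → Matrix (Fin m) (Fin m) ℝ} {x : E} (hA : ∀ i j, ContDiffAt ℝ r (fun y => A y i j) x) :
    ContDiffAt ℝ r (fun y => (A y).det) x := by
  simp only [Matrix.det_apply]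
  refine ContDiffAt.sum fun σ _ => ContDiffAt.const_smul _ ?_
  exact contDiffAt_prod fun i _ => hA _ _

theorem contDiffAt_adjugate {r : WithTop ℕ∞} {E : Type*} [NormedAddCommGroup E] [NormedSpace ℝ E]
    {A : E → Matrix (Fin m) (Fin m) ℝ} {x : E} (hA : ∀ i j, ContDiffAt ℝ r (fun y => A y i j) x)
    (i j : Fin m) : ContDiffAt ℝ r (fun y => (A y).adjugate i j) x := by
  simp only [Matrix.adjugate_apply]
  refine contDiffAt_det fun a b => ?_
  simp only [Matrix.updateRow_apply]
  split_ifs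
  · exact contDiffAt_const
  · exact hA a b

theorem contDiffAt_matrix_inv {r : WithTop ℕ∞} {E : Type*} [NormedAddCommGroup E]
    [NormedSpace ℝ E] {A : E → Matrix (Fin m) (Fin m) ℝ} {x : E}
    (hA : ∀ i j, ContDiffAt ℝ r (fun y => A y i j) x) (hx : (A x).det ≠ 0) (i j : Fin m) :
    ContDiffAt ℝ r (fun y => (A y)⁻¹ i j) x := by
  simp only [Matrix.inv_def, Ring.inverse_eq_inv', Matrix.smul_apply, smul_eq_mul]
  exact ((contDiffAt_det hA).inv hx).mul (contDiffAt_adjugate hA i j)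

theorem det_updateRow_eq_sum (A : Matrix (Fin m) (Fin m) ℝ) (a : Fin m) (w : Vec m) :
    (A.updateRow a w).det = ∑ p, A.adjugate p a * w p := by
  rw [← Matrix.cramer_transpose_apply, Matrix.cramer_eq_adjugate_mulVec, ← Matrix.adjugate_transpose]
  rfl

/-- Jacobi's formula. -/
theorem pd_det {A : Vec k → Matrix (Fin m) (Fin m) ℝ} {x : Vec k}
    (hA : ∀ a b, DifferentiableAt ℝ (fun y => A y a b) x) (i : Fin k) :
    pd i (fun y => (A y).det) x = ∑ a, ∑ p, (A x).adjugate p a * pd i (fun y => A y a p) x := by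
  -- The determinant as a continuous multilinear map of the rows: its derivative replaces one row at
  -- a time, and Cramer's rule expands each term.
  let D : ContinuousMultilinearMap ℝ (fun _ : Fin m => Vec m) ℝ :=
    { (Matrix.detRowAlternating (n := Fin m) (R := ℝ)).toMultilinearMap with
      cont := Continuous.matrix_det continuous_id }
  have hrow : ∀ a, DifferentiableAt ℝ (fun y => A y a) x := fun a =>
    differentiableAt_pi.2 (hA a)
  have h := HasFDerivAt.multilinear_comp D (g := fun a y => A y a) (x := x)
    fun a => (hrow a).hasFDerivAt
  have h2 : pd i (fun y => (A y).det) x =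
      ∑ a, ((A x).updateRow a (fderiv ℝ (fun y => A y a) x (Pi.single i 1))).det := by
    rw [pd]
    erw [h.fderiv]
    simp only [sum_apply]
    rfl
  rw [h2]
  refine Finset.sum_congr rfl fun a _ => ?_
  rw [det_updateRow_eq_sum]
  refine Finset.sum_congr rfl fun p _ => ?_
  rw [pd_apply (f := fun y => A y a) i p (hrow a)]
  rfl

/-- The cofactor matrix of a matrix function with curl-free rows is divergence-free. -/
theorem sum_pd_adjugate_eq_zero {A : Vec m → Matrix (Fin m) (Fin m) ℝ} {x : Vec m}
    (hA : ∀ a b, ContDiffAt ℝ 1 (fun y => A y a b) x)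
    (hcurl : ∀ i j p, pd i (fun y => A y p j) x = pd j (fun y => A y p i) x) (p : Fin m) :
    ∑ i, pd i (fun y => (A y).adjugate i p) x = 0 := by
  -- For invertible B, take the divergence of adj(B)·B = det(B)·1. By the curl condition and
  -- Jacobi's formula, the terms with derivatives of B equal the right-hand side, so the divergence
  -- v of adj(B) satisfies vB = 0.
  have inv_case : ∀ B : Vec m → Matrix (Fin m) (Fin m) ℝ,
      (∀ a b, ContDiffAt ℝ 1 (fun y => B y a b) x) →
      (∀ i j p, pd i (fun y => B y p j) x = pd j (fun y => B y p i) x) → (B x).det ≠ 0 →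
      ∀ p, ∑ i, pd i (fun y => (B y).adjugate i p) x = 0 := by
    intro B hB hc hdet
    have hBd : ∀ a b, DifferentiableAt ℝ (fun y => B y a b) x := fun a b =>
      (hB a b).differentiableAt (by simp)
    have hadj : ∀ a b, DifferentiableAt ℝ (fun y => (B y).adjugate a b) x := fun a b =>
      (contDiffAt_adjugate hB a b).differentiableAt (by simp)
    set v : Vec m := fun p => ∑ i, pd i (fun y => (B y).adjugate i p) x with hv
    have hzero : v ᵥ* B x = 0 := by
      ext j
      have e1 : ∀ i, pd i (fun y => ∑ p, (B y).adjugate i p * B y p j) x =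
          pd i (fun y => (B y).det * (1 : Matrix (Fin m) (Fin m) ℝ) i j) x := by
        intro i
        congr 1
        ext y
        have := congrFun (congrFun (Matrix.adjugate_mul (B y)) i) j
        simpa [Matrix.mul_apply] using this
      have e2 : ∀ i, pd i (fun y => ∑ p, (B y).adjugate i p * B y p j) x =
          ∑ p, ((B x).adjugate i p * pd i (fun y => B y p j) x +
            B x p j * pd i (fun y => (B y).adjugate i p) x) := by
        intro i
        rw [pd_sum (f := fun p y => (B y).adjugate i p * B y p j) i
          fun a _ => (hadj i a).fun_mul (hBd a j)]
        exact Finset.sum_congr rfl fun p _ => pd_mul i (hadj i p) (hBd p j)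
      have e3 : ∑ i, pd i (fun y => (B y).det * (1 : Matrix (Fin m) (Fin m) ℝ) i j) x =
          pd j (fun y => (B y).det) x := by
        rw [Finset.sum_eq_single j]
        · simp
        · intro i _ hij
          simp [Matrix.one_apply_ne hij, pd_const]
        · simp
      have e4 : ∑ i, ∑ p, ((B x).adjugate i p * pd i (fun y => B y p j) x +
            B x p j * pd i (fun y => (B y).adjugate i p) x) = pd j (fun y => (B y).det) x := by
        rw [← e3]
        exact Finset.sum_congr rfl fun i _ => by rw [← e2, e1]
      simp only [Finset.sum_add_distrib] at e4
      rw [pd_det hBd, Finset.sum_comm (f := fun i p => (B x).adjugate i p * _)] at e4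
      have e5 : ∑ p, ∑ i, (B x).adjugate i p * pd i (fun y => B y p j) x =
          ∑ p, ∑ i, (B x).adjugate i p * pd j (fun y => B y p i) x :=
        Finset.sum_congr rfl fun p _ => Finset.sum_congr rfl fun i _ => by rw [hc i j p]
      rw [e5] at e4
      have e6 := add_eq_left.1 e4
      rw [Finset.sum_comm] at e6
      simp only [Matrix.vecMul, dotProduct, hv, Pi.zero_apply]
      rw [← e6]
      exact Finset.sum_congr rfl fun p _ => by rw [Finset.sum_mul]; simp only [mul_comm]
    have : v = 0 := by
      have h := congrArg (fun w => w ᵥ* (B x)⁻¹) hzero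
      simpa [Matrix.vecMul_vecMul, Matrix.mul_nonsing_inv _ (isUnit_iff_ne_zero.2 hdet)] using h
    intro p
    exact congrFun this p
  have hAd : ∀ a b, DifferentiableAt ℝ (fun y => A y a b) x := fun a b =>
    (hA a b).differentiableAt (by simp)
  have shift_pd : ∀ (t : ℝ) i a b,
      pd i (fun y => (A y + t • (1 : Matrix (Fin m) (Fin m) ℝ)) a b) x =
        pd i (fun y => A y a b) x := by
    intro t i a b
    simp [pd]
  have shift_smooth : ∀ (t : ℝ) a b,
      ContDiffAt ℝ 1 (fun y => (A y + t • (1 : Matrix (Fin m) (Fin m) ℝ)) a b) x := by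
    intro t a b
    exact (hA a b).add contDiffAt_const
  -- A constant shift by t leaves the derivatives of the entries unchanged, so the divergence
  -- depends on t only through an adjugate at x. It is therefore continuous in t, and the invertible
  -- case passes to the limit t = 0.
  have formula : ∀ (t : ℝ) i,
      pd i (fun y => (A y + t • (1 : Matrix (Fin m) (Fin m) ℝ)).adjugate i p) x =
      ∑ a, ∑ q, (((A x + t • (1 : Matrix (Fin m) (Fin m) ℝ)).updateRow p
        (Pi.single i 1)).adjugate q a) * (if a = p then 0 else pd i (fun y => A y a q) x) := by
    intro t i
    simp only [Matrix.adjugate_apply (_ + _)]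
    rw [pd_det]
    · refine Finset.sum_congr rfl fun a _ => Finset.sum_congr rfl fun q _ => ?_
      congr 1
      simp only [Matrix.updateRow_apply]
      split_ifs
      · exact pd_const _ _ _
      · exact shift_pd t i a q
    · intro a b
      simp only [Matrix.updateRow_apply]
      split_ifs
      · exact differentiableAt_const _
      · exact (shift_smooth t a b).differentiableAt (by simp)
  have hc : Continuous fun t : ℝ => A x + t • (1 : Matrix (Fin m) (Fin m) ℝ) := by fun_prop
  have hcont : Continuous fun t : ℝ =>
      ∑ i, pd i (fun y => (A y + t • (1 : Matrix (Fin m) (Fin m) ℝ)).adjugate i p) x := by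
    simp only [formula]
    refine continuous_finsetSum _ fun i _ => continuous_finsetSum _ fun a _ =>
      continuous_finsetSum _ fun q _ => Continuous.mul ?_ continuous_const
    exact ((hc.matrix_updateRow p continuous_const).matrix_adjugate).matrix_elem q a
  have := eq_of_forall_invertible (A x) hcont continuous_const (g := fun _ => 0) fun t ht =>
    inv_case (fun y => A y + t • (1 : Matrix (Fin m) (Fin m) ℝ)) (shift_smooth t)
      (fun i j p => by rw [shift_pd, shift_pd, hcurl]) ht p
  simpa using this

end MatrixFunctions

/-! ### Regularity of the derived tensors -/

section Smooth

variable {m : ℕ} {Ψ : Vec m [⋀^Fin m]→ₗ[ℝ] ℝ} {F : Vec m → ℝ} {x : Vec m}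

theorem smooth_diff (hF : ContDiffAt ℝ ∞ F x) (i : Fin m) :
    ContDiffAt ℝ ∞ (fun y => diff F y i) x := hF.pd i

theorem smooth_hess (hF : ContDiffAt ℝ ∞ F x) (i j : Fin m) :
    ContDiffAt ℝ ∞ (fun y => hess F y i j) x := (hF.pd j).pd i

theorem smooth_mulVec {A : Vec m → Matrix (Fin m) (Fin m) ℝ} {v : Vec m → Vec m}
    (hA : ∀ i j, ContDiffAt ℝ ∞ (fun y => A y i j) x)
    (hv : ∀ j, ContDiffAt ℝ ∞ (fun y => v y j) x) (i : Fin m) :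
    ContDiffAt ℝ ∞ (fun y => (A y *ᵥ v y) i) x := by
  simp only [Matrix.mulVec, dotProduct]
  exact ContDiffAt.sum fun j _ => (hA i j).mul (hv j)

theorem smooth_dotProduct {v w : Vec m → Vec m} (hv : ∀ j, ContDiffAt ℝ ∞ (fun y => v y j) x)
    (hw : ∀ j, ContDiffAt ℝ ∞ (fun y => w y j) x) :
    ContDiffAt ℝ ∞ (fun y => v y ⬝ᵥ w y) x := by
  simp only [dotProduct]
  exact ContDiffAt.sum fun j _ => (hv j).mul (hw j)

theorem smooth_adjHess (hF : ContDiffAt ℝ ∞ F x) (i j : Fin m) :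
    ContDiffAt ℝ ∞ (fun y => adjHess Ψ F y i j) x := by
  simp only [adjHess, Matrix.smul_apply, smul_eq_mul]
  exact contDiffAt_const.mul (contDiffAt_adjugate (smooth_hess hF) i j)

theorem smooth_fieldN (hF : ContDiffAt ℝ ∞ F x) (i : Fin m) :
    ContDiffAt ℝ ∞ (fun y => fieldN Ψ F y i) x :=
  smooth_mulVec (smooth_adjHess hF) (smooth_diff hF) i

theorem smooth_opU (hF : ContDiffAt ℝ ∞ F x) : ContDiffAt ℝ ∞ (opU Ψ F) x :=
  smooth_dotProduct (smooth_fieldN hF) (smooth_diff hF)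

theorem smooth_hessDet (hF : ContDiffAt ℝ ∞ F x) : ContDiffAt ℝ ∞ (hessDet Ψ F) x :=
  (contDiffAt_det (smooth_hess hF)).div_const _

theorem transpose_hess (hF : ContDiffAt ℝ ∞ F x) : (hess F x)ᵀ = hess F x := by
  ext i j
  exact pd_comm (hF.of_le two_le_infty) j i

theorem smooth_sffDual (hΨ : Ψ ≠ 0) (hF : ContDiffAt ℝ ∞ F x) (hU : opU Ψ F x ≠ 0)
    (i j : Fin m) : ContDiffAt ℝ ∞ (fun y => sffDual Ψ F y i j) x := by
  have hUi : ContDiffAt ℝ ∞ (fun y => (opU Ψ F y)⁻¹) x := (smooth_opU hF).inv hU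
  have hvv : ∀ {v w : Vec m → Vec m}, (∀ j, ContDiffAt ℝ ∞ (fun y => v y j) x) →
      (∀ j, ContDiffAt ℝ ∞ (fun y => w y j) x) → ∀ i j,
      ContDiffAt ℝ ∞ (fun y => Matrix.vecMulVec (v y) (w y) i j) x :=
    fun hv hw i j => (hv i).mul (hw j)
  have haug : ∀ a b, ContDiffAt ℝ ∞ (fun y => sffAug Ψ F y a b) x := by
    intro a b
    refine ContDiffAt.add (ContDiffAt.sub (smooth_hess hF a b) ?_) ?_
    · exact (hUi.mul (smooth_hessDet hF)).mul (hvv (smooth_diff hF) (smooth_diff hF) a b)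
    · exact hUi.mul (hvv (smooth_diff hF) (smooth_diff hF) a b)
  refine ContDiffAt.sub (contDiffAt_matrix_inv haug
    (isUnit_det_sffAug hΨ (transpose_hess hF) hU).ne_zero i j) ?_
  exact hUi.mul (hvv (smooth_fieldN hF) (smooth_fieldN hF) i j)

end Smooth

/-! ### Regularity and derivatives of `W` and `ρ` -/

section Normal

variable {n : ℕ} {Ψ : Vec (n + 1) [⋀^Fin (n + 1)]→ₗ[ℝ] ℝ} {F : Vec (n + 1) → ℝ}
  {x : Vec (n + 1)}

theorem smooth_rpow (hF : ContDiffAt ℝ ∞ F x) (hU : opU Ψ F x ≠ 0) (a : ℝ) :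
    ContDiffAt ℝ ∞ (fun y => |opU Ψ F y| ^ a) x :=
  ((contDiffAt_abs hU).comp x (smooth_opU hF)).rpow_const_of_ne (abs_ne_zero.2 hU)

theorem smooth_log (hF : ContDiffAt ℝ ∞ F x) (hU : opU Ψ F x ≠ 0) :
    ContDiffAt ℝ ∞ (fun y => Real.log |opU Ψ F y|) x :=
  ((contDiffAt_abs hU).comp x (smooth_opU hF)).log (abs_ne_zero.2 hU)

theorem smooth_muForm (hF : ContDiffAt ℝ ∞ F x) (hU : opU Ψ F x ≠ 0) (i : Fin (n + 1)) :
    ContDiffAt ℝ ∞ (fun y => muForm Ψ F y i) x :=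
  contDiffAt_const.mul ((smooth_log hF hU).pd i)

theorem smooth_kDual_mulVec (hΨ : Ψ ≠ 0) (hF : ContDiffAt ℝ ∞ F x) (hU : opU Ψ F x ≠ 0)
    (i : Fin (n + 1)) : ContDiffAt ℝ ∞ (fun y => (kDual Ψ F y *ᵥ muForm Ψ F y) i) x :=
  smooth_mulVec (fun a b => (smooth_rpow hF hU _).mul (smooth_sffDual hΨ hF hU a b))
    (smooth_muForm hF hU) i

theorem smooth_fieldW_apply (hΨ : Ψ ≠ 0) (hF : ContDiffAt ℝ ∞ F x) (hU : opU Ψ F x ≠ 0)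
    (i : Fin (n + 1)) : ContDiffAt ℝ ∞ (fun y => fieldW Ψ F y i) x :=
  ((((smooth_rpow hF hU _).mul ((smooth_opU hF).inv hU)).mul (smooth_fieldN hF i)).neg).sub
    (smooth_kDual_mulVec hΨ hF hU i)

theorem smooth_fieldW (hΨ : Ψ ≠ 0) (hF : ContDiffAt ℝ ∞ F x) (hU : opU Ψ F x ≠ 0) :
    ContDiffAt ℝ ∞ (fieldW Ψ F) x := contDiffAt_pi.2 (smooth_fieldW_apply hΨ hF hU)

theorem smooth_conormal (hF : ContDiffAt ℝ ∞ F x) (hU : opU Ψ F x ≠ 0) (i : Fin (n + 1)) :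
    ContDiffAt ℝ ∞ (fun y => conormal Ψ F y i) x :=
  ((smooth_rpow hF hU _).mul (smooth_diff hF i)).neg

/-! ### Derivatives of the derived tensors -/

theorem eventually_opU_ne_zero (hF : ContDiffAt ℝ ∞ F x) (hU : opU Ψ F x ≠ 0) :
    ∀ᶠ y in 𝓝 x, opU Ψ F y ≠ 0 :=
  (smooth_opU hF).continuousAt.eventually_ne hU

theorem pd_log (i : Fin (n + 1)) :
    pd i (fun y => Real.log |opU Ψ F y|) x = ((n : ℝ) + 2) * muForm Ψ F x i := by
  have : (n : ℝ) + 2 ≠ 0 := by positivity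
  simp only [muForm, Pi.smul_apply, smul_eq_mul, diff]
  field_simp

theorem pd_opU (hF : ContDiffAt ℝ ∞ F x) (hU : opU Ψ F x ≠ 0) (i : Fin (n + 1)) :
    pd i (opU Ψ F) x = opU Ψ F x * (((n : ℝ) + 2) * muForm Ψ F x i) := by
  rw [← pd_log]
  have h := (((smooth_opU (Ψ := Ψ) hF).differentiableAt (by simp)).hasFDerivAt.log hU).fderiv
  simp only [Real.log_abs]
  simp only [pd]
  rw [h, smul_apply, smul_eq_mul, mul_inv_cancel_left₀ hU]

theorem pd_rpow (hF : ContDiffAt ℝ ∞ F x) (hU : opU Ψ F x ≠ 0) (a : ℝ) (i : Fin (n + 1)) :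
    pd i (fun y => |opU Ψ F y| ^ a) x =
      |opU Ψ F x| ^ a * (a * (((n : ℝ) + 2) * muForm Ψ F x i)) := by
  rw [← pd_log]
  have e : (fun y => |opU Ψ F y| ^ a) =ᶠ[𝓝 x] fun y => Real.exp (Real.log |opU Ψ F y| * a) := by
    filter_upwards [eventually_opU_ne_zero hF hU] with y hy
    exact Real.rpow_def_of_pos (abs_pos.2 hy) _
  rw [pd_congr i e, e.eq_of_nhds]
  have hd := ((smooth_log hF hU).differentiableAt (by simp)).hasFDerivAt
  simp only [pd]
  rw [(hd.mul_const a).exp.fderiv]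
  simp

theorem pd_scale (hF : ContDiffAt ℝ ∞ F x) (hU : opU Ψ F x ≠ 0) (i : Fin (n + 1)) :
    pd i (scale Ψ F) x = scale Ψ F x * muForm Ψ F x i := by
  have : (n : ℝ) + 2 ≠ 0 := by positivity
  rw [show scale Ψ F = fun y => |opU Ψ F y| ^ (1 / ((n : ℝ) + 2)) from rfl, pd_rpow hF hU]
  field_simp

/-- With the factor 1/(n+2) in μ, the logarithmic derivative of s⁻¹ is exactly -μ. -/
theorem gradConormal_eq (hF : ContDiffAt ℝ ∞ F x) (hU : opU Ψ F x ≠ 0) :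
    gradConormal Ψ F x = conormalHess Ψ F x := by
  have hn : (n : ℝ) + 2 ≠ 0 := by positivity
  ext i j
  have e : (fun y => conormal Ψ F y j) =
      fun y => (|opU Ψ F y| ^ (-1 / ((n : ℝ) + 2))) * (-diff F y j) := by
    ext y; simp [conormal]
  have h1 : pd i (fun y => -diff F y j) x = -hess F x i j := by
    simp only [pd, fderiv_fun_neg]
    rfl
  simp only [gradConormal, Matrix.of_apply]
  rw [e, pd_mul i (differentiableAt_of_smooth (smooth_rpow hF hU _))
    (differentiableAt_of_smooth (smooth_diff hF j).neg), pd_rpow hF hU, h1, rpow_neg_one_div]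
  simp [conormalHess, Matrix.vecMulVec_apply]
  field_simp
  ring

/-- The divergence of `N` is `(n + 1) H(F)`. -/
theorem sum_pd_fieldN (hF : ContDiffAt ℝ ∞ F x) :
    ∑ i, pd i (fun y => fieldN Ψ F y i) x = ((n : ℝ) + 1) * hessDet Ψ F x := by
  have hadj : ∀ i p, ContDiffAt ℝ ∞ (fun y => (hess F y).adjugate i p) x := fun i p =>
    contDiffAt_adjugate (smooth_hess hF) i p
  have e : ∀ i, (fun y => fieldN Ψ F y i) =
      fun y => ∑ p, (hess F y).adjugate i p * ((volCoeff Ψ ^ 2)⁻¹ * diff F y p) := by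
    intro i
    ext y
    simp only [fieldN, adjHess, Matrix.mulVec, dotProduct, Matrix.smul_apply, smul_eq_mul]
    exact Finset.sum_congr rfl fun p _ => by ring
  have h1 : ∀ i p, pd i (fun y => (volCoeff Ψ ^ 2)⁻¹ * diff F y p) x =
      (volCoeff Ψ ^ 2)⁻¹ * hess F x i p := by
    intro i p
    rw [pd_mul i (differentiableAt_const _) (differentiableAt_of_smooth (smooth_diff hF p)),
      pd_const, mul_zero, add_zero]
    rfl
  have h2 : ∀ i, pd i (fun y => fieldN Ψ F y i) x =
      ∑ p, ((hess F x).adjugate i p * ((volCoeff Ψ ^ 2)⁻¹ * hess F x i p) +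
        (volCoeff Ψ ^ 2)⁻¹ * diff F x p * pd i (fun y => (hess F y).adjugate i p) x) := by
    intro i
    rw [e, pd_sum (f := fun p y => (hess F y).adjugate i p * ((volCoeff Ψ ^ 2)⁻¹ * diff F y p)) i
      fun p _ => differentiableAt_of_smooth ((hadj i p).mul
        (contDiffAt_const.mul (smooth_diff hF p)))]
    refine Finset.sum_congr rfl fun p _ => ?_
    rw [pd_mul i (differentiableAt_of_smooth (hadj i p))
      (differentiableAt_of_smooth (contDiffAt_const.mul (smooth_diff hF p))), h1]
  -- Rows of the Hessian are gradients, so they are curl-free by symmetry of the third derivatives.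
  have hcurl : ∀ i j p, pd i (fun y => hess F y p j) x = pd j (fun y => hess F y p i) x := by
    intro i j p
    change pd i (pd p (pd j F)) x = pd j (pd p (pd i F)) x
    rw [pd_comm ((hF.pd j).of_le two_le_infty), pd_comm ((hF.pd i).of_le two_le_infty)]
    have : pd i (pd j F) =ᶠ[𝓝 x] pd j (pd i F) := by
      have h2 := (hF.of_le two_le_infty).eventually (by decide)
      filter_upwards [h2] with y hy
      exact pd_comm hy i j
    exact pd_congr p this
  have hdiv : ∀ p, ∑ i, pd i (fun y => (hess F y).adjugate i p) x = 0 :=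
    sum_pd_adjugate_eq_zero (fun a b => (smooth_hess hF a b).of_le (by simp)) hcurl
  simp only [h2, Finset.sum_add_distrib]
  rw [Finset.sum_comm (f := fun i p => (volCoeff Ψ ^ 2)⁻¹ * diff F x p * _)]
  simp only [← Finset.mul_sum, hdiv, mul_zero, Finset.sum_const_zero, add_zero]
  have h3 : ∀ i, ∑ p, (hess F x).adjugate i p * ((volCoeff Ψ ^ 2)⁻¹ * hess F x i p) =
      hessDet Ψ F x := by
    intro i
    have h := congrFun (congrFun (Matrix.adjugate_mul (hess F x)) i) i
    rw [Matrix.mul_apply, Matrix.smul_apply, Matrix.one_apply_eq] at h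
    rw [hessDet, detRel, div_eq_inv_mul, ← mul_one (Matrix.det _), ← smul_eq_mul (Matrix.det _), ← h,
      Finset.mul_sum]
    refine Finset.sum_congr rfl fun p _ => ?_
    rw [← transpose_hess hF, Matrix.transpose_apply, transpose_hess hF]
    ring
  simp [h3]

/-- The divergence of `W`. -/
theorem divergence_fieldW (hΨ : Ψ ≠ 0) (hF : ContDiffAt ℝ ∞ F x) (hU : opU Ψ F x ≠ 0) :
    divergence (fieldW Ψ F) x = -(scale Ψ F x * (opU Ψ F x)⁻¹ * ((n : ℝ) + 1) *
      (hessDet Ψ F x - fieldN Ψ F x ⬝ᵥ muForm Ψ F x))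
      - divergence (fun y => kDual Ψ F y *ᵥ muForm Ψ F y) x := by
  have hUi : ContDiffAt ℝ ∞ (fun y => (opU Ψ F y)⁻¹) x := (smooth_opU hF).inv hU
  have hs : ContDiffAt ℝ ∞ (scale Ψ F) x := smooth_rpow hF hU _
  have h1 : ∀ i, pd i (fun y => (opU Ψ F y)⁻¹) x =
      -((opU Ψ F x)⁻¹ * (((n : ℝ) + 2) * muForm Ψ F x i)) := by
    intro i
    have hd := (differentiableAt_of_smooth (smooth_opU (Ψ := Ψ) hF)).hasFDerivAt
    have h2 := pd_opU hF hU i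
    have h3 := ((hasDerivAt_inv hU).comp_hasFDerivAt x hd).fderiv
    simp only [pd] at h2 ⊢
    erw [h3]
    rw [smul_apply, h2, smul_eq_mul]
    field_simp
  -- The coefficient s/U has logarithmic derivative μ - (n+2)μ = -(n+1)μ. Its factor n+1 matches the
  -- one in div N.
  have h2 : ∀ i, pd i (fun y => fieldW Ψ F y i) x =
      -(scale Ψ F x * (opU Ψ F x)⁻¹ * pd i (fun y => fieldN Ψ F y i) x
        - scale Ψ F x * (opU Ψ F x)⁻¹ * ((n : ℝ) + 1) * (fieldN Ψ F x i * muForm Ψ F x i))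
      - pd i (fun y => (kDual Ψ F y *ᵥ muForm Ψ F y) i) x := by
    intro i
    have e : (fun y => fieldW Ψ F y i) = fun y =>
        -((scale Ψ F y * (opU Ψ F y)⁻¹) * fieldN Ψ F y i)
          - (kDual Ψ F y *ᵥ muForm Ψ F y) i := rfl
    have d1 : DifferentiableAt ℝ (fun y => (scale Ψ F y * (opU Ψ F y)⁻¹) * fieldN Ψ F y i) x :=
      differentiableAt_of_smooth ((hs.mul hUi).mul (smooth_fieldN hF i))
    have e2 : pd i (fun y => fieldW Ψ F y i) x =
        -pd i (fun y => (scale Ψ F y * (opU Ψ F y)⁻¹) * fieldN Ψ F y i) x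
          - pd i (fun y => (kDual Ψ F y *ᵥ muForm Ψ F y) i) x := by
      rw [e]
      simp only [pd]
      rw [fderiv_fun_sub d1.fun_neg (differentiableAt_of_smooth (smooth_kDual_mulVec hΨ hF hU i)),
        fderiv_fun_neg]
      rfl
    rw [e2, pd_mul i (differentiableAt_of_smooth (hs.mul hUi))
      (differentiableAt_of_smooth (smooth_fieldN hF i)),
      pd_mul i (differentiableAt_of_smooth hs) (differentiableAt_of_smooth hUi), h1,
      pd_scale hF hU]
    ring
  simp only [divergence, h2, Finset.sum_sub_distrib, Finset.sum_neg_distrib, ← Finset.mul_sum,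
    sum_pd_fieldN hF]
  simp only [dotProduct]
  ring

/-- `ρ(∂_v W) = -(∂_v ρ)(W)`. -/
theorem conormal_dotProduct_fderiv_fieldW (hΨ : Ψ ≠ 0) (hF : ∀ᶠ y in 𝓝 x, ContDiffAt ℝ ∞ F y)
    (hU : opU Ψ F x ≠ 0) (v : Vec (n + 1)) :
    conormal Ψ F x ⬝ᵥ fderiv ℝ (fieldW Ψ F) x v =
      -((opU Ψ F x)⁻¹ * (hessDet Ψ F x - fieldN Ψ F x ⬝ᵥ muForm Ψ F x) * (v ⬝ᵥ diff F x)) := by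
  have hFx := hF.self_of_nhds
  -- The identity ρ(W) = 1 holds on a full neighborhood, so it may be differentiated in every
  -- direction, including W itself.
  have hc : (fun y => ∑ j, conormal Ψ F y j * fieldW Ψ F y j) =ᶠ[𝓝 x] fun _ => 1 := by
    filter_upwards [hF, eventually_opU_ne_zero hFx hU] with y hy hyU
    exact conormal_dotProduct_fieldW hΨ (transpose_hess hy) hyU
  have dW : DifferentiableAt ℝ (fieldW Ψ F) x := differentiableAt_of_smooth (smooth_fieldW hΨ hFx hU)
  have h1 : ∀ p, conormal Ψ F x ⬝ᵥ pd p (fieldW Ψ F) x =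
      -(gradConormal Ψ F x *ᵥ fieldW Ψ F x) p := by
    intro p
    have h2 := pd_congr p hc
    rw [pd_const, pd_sum (f := fun j y => conormal Ψ F y j * fieldW Ψ F y j) p fun j _ =>
      differentiableAt_of_smooth ((smooth_conormal hFx hU j).mul
        (smooth_fieldW_apply hΨ hFx hU j))] at h2
    simp only [pd_mul p (differentiableAt_of_smooth (smooth_conormal hFx hU _))
      (differentiableAt_of_smooth (smooth_fieldW_apply hΨ hFx hU _)), pd_apply p _ dW,
      Finset.sum_add_distrib] at h2
    rw [eq_neg_iff_add_eq_zero, ← h2]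
    simp only [dotProduct, Matrix.mulVec, gradConormal, Matrix.of_apply, mul_comm]
  rw [fderiv_eq_sum_pd, dotProduct_sum]
  have h3 : ∀ p, conormal Ψ F x ⬝ᵥ (v p • pd p (fieldW Ψ F) x) =
      -((opU Ψ F x)⁻¹ * (hessDet Ψ F x - fieldN Ψ F x ⬝ᵥ muForm Ψ F x) * (v p * diff F x p)) := by
    intro p
    rw [dotProduct_smul, h1, gradConormal_eq hFx hU,
      conormalHess_mulVec_fieldW hΨ (transpose_hess hFx) hU, Pi.smul_apply, smul_eq_mul,
      smul_eq_mul]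
    ring
  simp only [h3, Finset.sum_neg_distrib, ← Finset.mul_sum]
  rfl

end Normal

/-! ### Frames along a parametrized hypersurface -/

section Frames

variable {n : ℕ} {f ξ : Vec n → Vec (n + 1)} {x : Vec n}

theorem isUnit_det_frame (h : LinearIndependent ℝ (frame f ξ x)) :
    IsUnit (Matrix.of (frame f ξ x)).det :=
  (Matrix.isUnit_iff_isUnit_det _).1 (Matrix.linearIndependent_rows_iff_isUnit.1 h)

theorem sum_coord_smul (h : LinearIndependent ℝ (frame f ξ x)) (v : Vec (n + 1)) :
    v = coord f ξ x v 0 • ξ x + ∑ k : Fin n, coord f ξ x v k.succ • pd k f x := by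
  have hu : IsUnit ((Matrix.of (frame f ξ x))ᵀ).det := by
    rw [Matrix.det_transpose]; exact isUnit_det_frame h
  have h1 : (Matrix.of (frame f ξ x))ᵀ *ᵥ coord f ξ x v = v := by
    rw [coord, Matrix.mulVec_mulVec, Matrix.mul_nonsing_inv _ hu, Matrix.one_mulVec]
  have h2 : (Matrix.of (frame f ξ x))ᵀ *ᵥ coord f ξ x v =
      ∑ a, coord f ξ x v a • frame f ξ x a := by
    ext p
    simp [Matrix.mulVec, dotProduct, mul_comm]
  conv_lhs => rw [← h1, h2, Fin.sum_univ_succ]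
  rfl

/-- Tangential components drop out against a covector that kills tangent vectors. Applied with θ =
ρ, this reads off h from ∂ᵢ∂ⱼf and τ from ∂ᵢξ. -/
theorem dotProduct_eq_coord (h : LinearIndependent ℝ (frame f ξ x)) {θ : Vec (n + 1)}
    (hθ : ∀ k, θ ⬝ᵥ pd k f x = 0) (v : Vec (n + 1)) :
    θ ⬝ᵥ v = coord f ξ x v 0 * (θ ⬝ᵥ ξ x) := by
  conv_lhs => rw [sum_coord_smul h v]
  simp [dotProduct_add, dotProduct_sum, dotProduct_smul, hθ]

/-- Conjugation by the frame matrix preserves the trace. -/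
theorem sum_coord_mulVec (h : LinearIndependent ℝ (frame f ξ x))
    (M : Matrix (Fin (n + 1)) (Fin (n + 1)) ℝ) :
    ∑ a, coord f ξ x (M *ᵥ frame f ξ x a) a = M.trace := by
  have hu : IsUnit ((Matrix.of (frame f ξ x))ᵀ).det := by
    rw [Matrix.det_transpose]; exact isUnit_det_frame h
  have h1 : ∀ a, coord f ξ x (M *ᵥ frame f ξ x a) a =
      (((Matrix.of (frame f ξ x))ᵀ)⁻¹ * (M * (Matrix.of (frame f ξ x))ᵀ)) a a := by
    intro a
    rw [Matrix.mul_apply]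
    rfl
  simp only [h1]
  change Matrix.trace _ = _
  rw [Matrix.trace_mul_comm, Matrix.mul_assoc, Matrix.mul_nonsing_inv _ hu, Matrix.mul_one]

/-- Replacing a row of the frame by its derivative multiplies the determinant by the corresponding
coordinate of that derivative. The row ξ contributes τᵢ and the rows ∂ⱼf contribute the trace of Γ,
so parallelism of the volume amounts to τ = 0. -/
theorem pd_inducedVolume (Ψ : Vec (n + 1) [⋀^Fin (n + 1)]→ₗ[ℝ] ℝ)
    (h : LinearIndependent ℝ (frame f ξ x)) (hξ : DifferentiableAt ℝ ξ x)
    (hf : ∀ j, DifferentiableAt ℝ (pd j f) x) (i : Fin n) :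
    pd i (inducedVolume Ψ f ξ) x =
      (coord f ξ x (pd i ξ x) 0 + ∑ j, christoffel f ξ x i j j) * inducedVolume Ψ f ξ x := by
  have hd : ∀ a p, DifferentiableAt ℝ (fun y => Matrix.of (frame f ξ y) a p) x := by
    intro a p
    refine Fin.cases ?_ (fun j => ?_) a
    · exact differentiableAt_pi.1 hξ p
    · exact differentiableAt_pi.1 (hf j) p
  have e : inducedVolume Ψ f ξ = fun y => volCoeff Ψ * (Matrix.of (frame f ξ y)).det := by
    ext y; exact volume_eq_det Ψ _
  have hdet := (isUnit_det_frame h).ne_zero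
  have hcoord : ∀ v a, (Matrix.of (frame f ξ x)).det * coord f ξ x v a =
      ∑ p, (Matrix.of (frame f ξ x)).adjugate p a * v p := by
    intro v a
    rw [coord, Matrix.inv_def, Ring.inverse_eq_inv', Matrix.det_transpose, Matrix.smul_mulVec,
      Pi.smul_apply, smul_eq_mul, mul_inv_cancel_left₀ hdet, ← Matrix.adjugate_transpose]
    rfl
  have hD : DifferentiableAt ℝ (fun y => (Matrix.of (frame f ξ y)).det) x := by
    have := (contDiffAt_det (r := 1) (A := fun A : Fin (n + 1) → Fin (n + 1) → ℝ => Matrix.of A)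
      (x := frame f ξ x) fun i j => by
        simp only [Matrix.of_apply]; fun_prop).differentiableAt (by simp)
    exact this.comp x (differentiableAt_pi.2 fun a => differentiableAt_pi.2 (hd a))
  rw [e, pd_mul i (differentiableAt_const _) hD, pd_const, mul_zero, add_zero, pd_det hd,
    Fin.sum_univ_succ]
  have h0 : ∑ p, (Matrix.of (frame f ξ x)).adjugate p 0 *
      pd i (fun y => Matrix.of (frame f ξ y) 0 p) x =
        (Matrix.of (frame f ξ x)).det * coord f ξ x (pd i ξ x) 0 := by
    rw [hcoord]
    refine Finset.sum_congr rfl fun p _ => ?_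
    rw [← pd_apply i p hξ]
    rfl
  have h1 : ∀ j : Fin n, ∑ p, (Matrix.of (frame f ξ x)).adjugate p j.succ *
      pd i (fun y => Matrix.of (frame f ξ y) j.succ p) x =
        (Matrix.of (frame f ξ x)).det * christoffel f ξ x i j j := by
    intro j
    rw [christoffel, hcoord]
    refine Finset.sum_congr rfl fun p _ => ?_
    rw [← pd_apply i p (hf j)]
    rfl
  simp only [h0, h1, ← Finset.mul_sum]
  ring

end Frames

theorem IsParam.contDiffAt {n : ℕ} {S : Set (Vec (n + 1))} {Δ : Set (Vec n)}
    {f : Vec n → Vec (n + 1)} (hf : IsParam S Δ f) {x : Vec n} (hx : x ∈ Δ) :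
    ContDiffAt ℝ ∞ f x := (hf.smooth x hx).contDiffAt (hf.isOpen.mem_nhds hx)

/-! ### Parametrized level sets -/

section Level

variable {n : ℕ} {Ψ : Vec (n + 1) [⋀^Fin (n + 1)]→ₗ[ℝ] ℝ} {F : Vec (n + 1) → ℝ}
  {Ω : Set (Vec (n + 1))} {r : ℝ} {Δ : Set (Vec n)} {f ξ : Vec n → Vec (n + 1)} {x : Vec n}

theorem eventually_smooth (hΩ : IsOpen Ω) (hF : ∀ y ∈ Ω, ContDiffAt ℝ ∞ F y) {p : Vec (n + 1)}
    (hp : p ∈ Ω) : ∀ᶠ y in 𝓝 p, ContDiffAt ℝ ∞ F y := by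
  filter_upwards [hΩ.mem_nhds hp] with y hy using hF y hy

theorem diff_dotProduct_pd (hF : ∀ y ∈ Ω, ContDiffAt ℝ ∞ F y) (hf : IsParam (level F r Ω) Δ f)
    (hx : x ∈ Δ) (i : Fin n) : diff F (f x) ⬝ᵥ pd i f x = 0 := by
  have e : (fun y => F (f y)) =ᶠ[𝓝 x] fun _ => r := by
    filter_upwards [hf.isOpen.mem_nhds hx] with y hy using (hf.mapsTo hy).2
  have h := pd_congr i e
  rw [pd_const, pd_comp i (differentiableAt_of_smooth (hF _ (hf.mapsTo hx).1))
    (differentiableAt_of_smooth (hf.contDiffAt hx))] at h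
  rw [← h]
  simp only [dotProduct, diff, smul_eq_mul, mul_comm]

theorem conormal_dotProduct_pd (hF : ∀ y ∈ Ω, ContDiffAt ℝ ∞ F y)
    (hf : IsParam (level F r Ω) Δ f) (hx : x ∈ Δ) (i : Fin n) :
    conormal Ψ F (f x) ⬝ᵥ pd i f x = 0 := by
  rw [conormal_eq, neg_dotProduct, smul_dotProduct, diff_dotProduct_pd hF hf hx, smul_zero,
    neg_zero]

/-- Differentiating `ρ(X) = c` along the hypersurface. -/
theorem conormal_dotProduct_pd_of_const (hF : ∀ y ∈ Ω, ContDiffAt ℝ ∞ F y)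
    (hU : ∀ y ∈ Ω, opU Ψ F y ≠ 0) (hf : IsParam (level F r Ω) Δ f) (hx : x ∈ Δ)
    {X : Vec n → Vec (n + 1)} (hX : DifferentiableAt ℝ X x) {c : ℝ}
    (hc : ∀ y ∈ Δ, conormal Ψ F (f y) ⬝ᵥ X y = c) (i : Fin n) :
    conormal Ψ F (f x) ⬝ᵥ pd i X x = -(pd i f x ⬝ᵥ (conormalHess Ψ F (f x) *ᵥ X x)) := by
  have hFx := hF _ (hf.mapsTo hx).1
  have hUx := hU _ (hf.mapsTo hx).1
  have dρ : ∀ j, DifferentiableAt ℝ (fun y => conormal Ψ F y j) (f x) := fun j =>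
    differentiableAt_of_smooth (smooth_conormal hFx hUx j)
  have df : DifferentiableAt ℝ f x := differentiableAt_of_smooth (hf.contDiffAt hx)
  have e : (fun y => ∑ j, conormal Ψ F (f y) j * X y j) =ᶠ[𝓝 x] fun _ => c := by
    filter_upwards [hf.isOpen.mem_nhds hx] with y hy using hc y hy
  have h := pd_congr i e
  have dX : ∀ j, DifferentiableAt ℝ (fun y => X y j) x := differentiableAt_pi.1 hX
  have dρf : ∀ j, DifferentiableAt ℝ (fun y => conormal Ψ F (f y) j) x := fun j =>
    (dρ j).comp x df
  rw [pd_const, pd_sum (f := fun j y => conormal Ψ F (f y) j * X y j) i fun j _ =>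
    (dρf j).fun_mul (dX j)] at h
  have h2 : ∀ j, pd i (fun y => conormal Ψ F (f y) j * X y j) x =
      conormal Ψ F (f x) j * pd i X x j +
        ∑ p, pd i f x p * (gradConormal Ψ F (f x) p j * X x j) := by
    intro j
    rw [pd_mul i (dρf j) (dX j), pd_apply i j hX, pd_comp i (dρ j) df, mul_comm (X x j),
      Finset.sum_mul]
    simp only [smul_eq_mul, mul_assoc]
    rfl
  simp only [h2, Finset.sum_add_distrib] at h
  rw [Finset.sum_comm] at h
  rw [eq_neg_iff_add_eq_zero, ← h, gradConormal_eq hFx hUx]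
  simp only [dotProduct, Matrix.mulVec, Finset.mul_sum]

theorem differentiableAt_pd {S : Set (Vec (n + 1))} (hf : IsParam S Δ f) (hx : x ∈ Δ) (j : Fin n) :
    DifferentiableAt ℝ (pd j f) x := differentiableAt_of_smooth ((hf.contDiffAt hx).pd j)

/-- The components `ρ(∂ᵢ∂ⱼf)` of the second fundamental form with respect to `W`. -/
noncomputable abbrev conormalForm (Ψ : Vec (n + 1) [⋀^Fin (n + 1)]→ₗ[ℝ] ℝ) (F : Vec (n + 1) → ℝ)
    (f : Vec n → Vec (n + 1)) (x : Vec n) : Matrix (Fin n) (Fin n) ℝ :=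
  Matrix.of fun i j => conormal Ψ F (f x) ⬝ᵥ pd i (pd j f) x

theorem conormalForm_apply (hF : ∀ y ∈ Ω, ContDiffAt ℝ ∞ F y)
    (hU : ∀ y ∈ Ω, opU Ψ F y ≠ 0) (hf : IsParam (level F r Ω) Δ f) (hx : x ∈ Δ) (i j : Fin n) :
    conormalForm Ψ F f x i j = -(pd i f x ⬝ᵥ (conormalHess Ψ F (f x) *ᵥ pd j f x)) :=
  conormal_dotProduct_pd_of_const hF hU hf hx (differentiableAt_pd hf hx j)
    (fun _ hy => conormal_dotProduct_pd hF hf hy j) i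

theorem linearIndependent_frame (hF : ∀ y ∈ Ω, ContDiffAt ℝ ∞ F y)
    (hf : IsParam (level F r Ω) Δ f) (hx : x ∈ Δ) (hξ : conormal Ψ F (f x) ⬝ᵥ ξ x ≠ 0) :
    LinearIndependent ℝ (frame f ξ x) := by
  refine linearIndependent_finCons.2 ⟨hf.immersion x hx, fun hmem => hξ ?_⟩
  refine Submodule.span_induction (p := fun v _ => conormal Ψ F (f x) ⬝ᵥ v = 0) ?_ (by simp)
    (fun a b _ _ ha hb => by rw [dotProduct_add, ha, hb, add_zero])
    (fun c a _ ha => by rw [dotProduct_smul, ha, smul_zero]) hmem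
  rintro _ ⟨i, rfl⟩
  exact conormal_dotProduct_pd hF hf hx i

theorem conormal_dotProduct_of_mem_span (hF : ∀ y ∈ Ω, ContDiffAt ℝ ∞ F y)
    (hf : IsParam (level F r Ω) Δ f) (hx : x ∈ Δ) {v : Vec (n + 1)}
    (hv : v ∈ Submodule.span ℝ (range fun i => pd i f x)) : conormal Ψ F (f x) ⬝ᵥ v = 0 := by
  by_contra h
  exact (linearIndependent_finCons.1 (linearIndependent_frame (ξ := fun _ => v) hF hf hx h)).2 hv

theorem conormal_dotProduct_fieldW_of_mem (hΨ : Ψ ≠ 0) (hF : ∀ y ∈ Ω, ContDiffAt ℝ ∞ F y)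
    (hU : ∀ y ∈ Ω, opU Ψ F y ≠ 0) {p : Vec (n + 1)} (hp : p ∈ Ω) :
    conormal Ψ F p ⬝ᵥ fieldW Ψ F p = 1 :=
  conormal_dotProduct_fieldW hΨ (transpose_hess (hF p hp)) (hU p hp)

theorem linearIndependent_frame_fieldW (hΨ : Ψ ≠ 0) (hF : ∀ y ∈ Ω, ContDiffAt ℝ ∞ F y)
    (hU : ∀ y ∈ Ω, opU Ψ F y ≠ 0) (hf : IsParam (level F r Ω) Δ f) (hx : x ∈ Δ) :
    LinearIndependent ℝ (frame f (fieldW Ψ F ∘ f) x) :=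
  linearIndependent_frame (Ψ := Ψ) hF hf hx (by
    rw [Function.comp_apply, conormal_dotProduct_fieldW_of_mem hΨ hF hU (hf.mapsTo hx).1]
    exact one_ne_zero)

theorem mem_span_of_conormal (hΨ : Ψ ≠ 0) (hF : ∀ y ∈ Ω, ContDiffAt ℝ ∞ F y)
    (hU : ∀ y ∈ Ω, opU Ψ F y ≠ 0) (hf : IsParam (level F r Ω) Δ f) (hx : x ∈ Δ) {v : Vec (n + 1)}
    (hv : conormal Ψ F (f x) ⬝ᵥ v = 0) : v ∈ Submodule.span ℝ (range fun i => pd i f x) := by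
  have hE := linearIndependent_frame_fieldW hΨ hF hU hf hx
  have h0 := dotProduct_eq_coord hE (conormal_dotProduct_pd (Ψ := Ψ) hF hf hx) v
  rw [hv, Function.comp_apply, conormal_dotProduct_fieldW_of_mem hΨ hF hU (hf.mapsTo hx).1,
    mul_one] at h0
  rw [sum_coord_smul hE v, ← h0, zero_smul, zero_add]
  exact Submodule.sum_mem _ fun k _ => Submodule.smul_mem _ _ (Submodule.subset_span ⟨k, rfl⟩)

/-- With respect to `W`, the squared volume is the determinant of the second fundamental form, up
to the sign of `U(F)`. -/
theorem inducedVolume_fieldW_sq (hΨ : Ψ ≠ 0) (hF : ∀ y ∈ Ω, ContDiffAt ℝ ∞ F y)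
    (hU : ∀ y ∈ Ω, opU Ψ F y ≠ 0) (hf : IsParam (level F r Ω) Δ f) (hx : x ∈ Δ) :
    (conormalForm Ψ F f x).det =
      inducedVolume Ψ f (fieldW Ψ F ∘ f) x ^ 2 * (opU Ψ F (f x) / |opU Ψ F (f x)|) := by
  have hp := (hf.mapsTo hx).1
  have hFx := hF _ hp
  have hUx := hU _ hp
  have hs := transpose_hess hFx
  have hsc := (scale_pos hUx).ne'
  have hρW := conormal_dotProduct_fieldW_of_mem hΨ hF hU hp
  set p := f x with hpdef
  -- The value of t for which G(W, W) = 1. Since GW is a multiple of dF, the matrix of G in the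
  -- frame (W, ∂f) is then block triangular with blocks 1 and h.
  set t : ℝ := 1 - scale Ψ F p * (opU Ψ F p)⁻¹ *
    (hessDet Ψ F p - fieldN Ψ F p ⬝ᵥ muForm Ψ F p) with ht
  set G := -conormalHess Ψ F p + Matrix.vecMulVec (t • conormal Ψ F p) (conormal Ψ F p) with hG
  set E := Matrix.of (frame f (fieldW Ψ F ∘ f) x) with hE
  have hM : ∀ a b, (E * G * Eᵀ) a b = E a ⬝ᵥ (G *ᵥ E b) := by
    intro a b
    rw [Matrix.dotProduct_mulVec]
    rfl
  have hE0 : E 0 = fieldW Ψ F p := rfl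
  have hEs : ∀ i : Fin n, E i.succ = pd i f x := fun _ => rfl
  have hGW : G *ᵥ fieldW Ψ F p = -((opU Ψ F p)⁻¹ *
      (hessDet Ψ F p - fieldN Ψ F p ⬝ᵥ muForm Ψ F p)) • diff F p + t • conormal Ψ F p := by
    rw [hG, Matrix.add_mulVec, Matrix.neg_mulVec, conormalHess_mulVec_fieldW hΨ hs hUx,
      Matrix.vecMulVec_mulVec, hρW, neg_smul]
    simp
  have h00 : (E * G * Eᵀ) 0 0 = 1 := by
    rw [hM, hE0, hGW, dotProduct_add, dotProduct_smul, dotProduct_smul,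
      dotProduct_comm _ (conormal Ψ F p), hρW, dotProduct_comm _ (diff F p),
      diff_dotProduct_fieldW hΨ hs hUx, ht]
    simp only [smul_eq_mul]
    ring
  have hs0 : ∀ i : Fin n, (E * G * Eᵀ) i.succ 0 = 0 := by
    intro i
    rw [hM, hE0, hGW, hEs, dotProduct_add, dotProduct_smul, dotProduct_smul,
      dotProduct_comm _ (conormal Ψ F p), conormal_dotProduct_pd hF hf hx,
      dotProduct_comm _ (diff F p), diff_dotProduct_pd hF hf hx, smul_zero, smul_zero, add_zero]
  have hss : (E * G * Eᵀ).submatrix Fin.succ Fin.succ = conormalForm Ψ F f x := by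
    ext i j
    rw [Matrix.submatrix_apply, hM, hEs, hEs, conormalForm_apply hF hU hf hx, hG,
      Matrix.add_mulVec, Matrix.vecMulVec_mulVec, conormal_dotProduct_pd hF hf hx,
      Matrix.neg_mulVec, dotProduct_add, dotProduct_neg]
    simp [hpdef]
  have hdet : (E * G * Eᵀ).det = (conormalForm Ψ F f x).det := by
    rw [Matrix.det_succ_column_zero, Fin.sum_univ_succ, h00]
    simp only [hs0, mul_zero, zero_mul, Finset.sum_const_zero, add_zero, Fin.val_zero, pow_zero,
      one_mul]
    rw [← hss]
    rfl
  have hvol : inducedVolume Ψ f (fieldW Ψ F ∘ f) x = volCoeff Ψ * E.det := volume_eq_det Ψ _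
  rw [← hdet, Matrix.det_mul, Matrix.det_mul, Matrix.det_transpose, hG,
    det_conormalHess_sub hΨ hs, hvol, ht]
  -- The choice of t cancels H - N·μ in det G and leaves Ψ² U s^{-(n+2)}: n+1 factors s⁻¹ come from
  -- the size of the matrix and one from ρ ⊗ ρ. This equals ±Ψ² exactly because s^{n+2} = |U|.
  have hpow : scale Ψ F p ^ (n + 2) = |opU Ψ F p| := rpow_one_div_pow _
  have hA : scale Ψ F p ^ (n + 1) ≠ 0 := pow_ne_zero _ hsc
  rw [← hpow, pow_succ, inv_pow]
  generalize scale Ψ F p ^ (n + 1) = A at hA ⊢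
  field_simp
  ring

theorem secondForm_eq (hF : ∀ y ∈ Ω, ContDiffAt ℝ ∞ F y)
    (hf : IsParam (level F r Ω) Δ f) (hx : x ∈ Δ) (hξ : conormal Ψ F (f x) ⬝ᵥ ξ x ≠ 0) :
    conormalForm Ψ F f x = (conormal Ψ F (f x) ⬝ᵥ ξ x) • secondForm f ξ x := by
  ext i j
  have := dotProduct_eq_coord (linearIndependent_frame hF hf hx hξ)
    (conormal_dotProduct_pd (Ψ := Ψ) hF hf hx) (pd i (pd j f) x)
  simp only [conormalForm, secondForm, Matrix.smul_apply, Matrix.of_apply, smul_eq_mul, this]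
  ring

theorem det_conormalForm_ne_zero (hΨ : Ψ ≠ 0) (hF : ∀ y ∈ Ω, ContDiffAt ℝ ∞ F y)
    (hU : ∀ y ∈ Ω, opU Ψ F y ≠ 0) (hf : IsParam (level F r Ω) Δ f) (hx : x ∈ Δ) :
    (conormalForm Ψ F f x).det ≠ 0 := by
  have hUx := hU _ (hf.mapsTo hx).1
  rw [inducedVolume_fieldW_sq hΨ hF hU hf hx, inducedVolume, volume_eq_det]
  have h1 := (isUnit_det_frame (linearIndependent_frame_fieldW hΨ hF hU hf hx)).ne_zero
  have h2 := volCoeff_ne_zero hΨ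
  have h3 := abs_ne_zero.2 hUx
  positivity

theorem abs_det_conormalForm (hΨ : Ψ ≠ 0) (hF : ∀ y ∈ Ω, ContDiffAt ℝ ∞ F y)
    (hU : ∀ y ∈ Ω, opU Ψ F y ≠ 0) (hf : IsParam (level F r Ω) Δ f) (hx : x ∈ Δ) :
    |(conormalForm Ψ F f x).det| = inducedVolume Ψ f (fieldW Ψ F ∘ f) x ^ 2 := by
  have hUx := abs_ne_zero.2 (hU _ (hf.mapsTo hx).1)
  rw [inducedVolume_fieldW_sq hΨ hF hU hf hx, abs_mul, abs_div, abs_abs, div_self hUx, mul_one,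
    abs_of_nonneg (sq_nonneg _)]

/-- `W` is an equiaffine normal along each parametrized piece of a level set. -/
theorem isEquiaffineNormalAlong (hΨ : Ψ ≠ 0) (hF : ∀ y ∈ Ω, ContDiffAt ℝ ∞ F y)
    (hU : ∀ y ∈ Ω, opU Ψ F y ≠ 0) (hf : IsParam (level F r Ω) Δ f)
    (hξ : ∀ y ∈ Δ, ξ y = fieldW Ψ F (f y)) : IsEquiaffineNormalAlong Ψ Δ f ξ := by
  have hWs : ∀ x ∈ Δ, ContDiffAt ℝ ∞ (fun y => fieldW Ψ F (f y)) x := fun x hx =>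
    (smooth_fieldW hΨ (hF _ (hf.mapsTo hx).1) (hU _ (hf.mapsTo hx).1)).comp x (hf.contDiffAt hx)
  have hξs : ∀ x ∈ Δ, ContDiffAt ℝ ∞ ξ x := fun x hx => (hWs x hx).congr_of_eventuallyEq (by
    filter_upwards [hf.isOpen.mem_nhds hx] with y hy using hξ y hy)
  have hρ : ∀ x ∈ Δ, conormal Ψ F (f x) ⬝ᵥ ξ x = 1 := fun x hx => by
    rw [hξ x hx, conormal_dotProduct_fieldW_of_mem hΨ hF hU (hf.mapsTo hx).1]
  have hE : ∀ x ∈ Δ, LinearIndependent ℝ (frame f ξ x) := fun x hx =>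
    linearIndependent_frame (Ψ := Ψ) hF hf hx (by rw [hρ x hx]; exact one_ne_zero)
  have hsec : ∀ x ∈ Δ, secondForm f ξ x = conormalForm Ψ F f x := fun x hx => by
    rw [secondForm_eq (ξ := ξ) hF hf hx (by rw [hρ x hx]; exact one_ne_zero), hρ x hx, one_smul]
  have hframe : ∀ x ∈ Δ, frame f ξ x = frame f (fieldW Ψ F ∘ f) x := fun x hx => by
    rw [frame, hξ x hx]; rfl
  refine ⟨fun x hx => (hξs x hx).contDiffWithinAt, hE, fun x hx => ?_, fun x hx => ?_,
    fun x hx i => ?_⟩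
  · rw [hsec x hx]
    exact det_conormalForm_ne_zero hΨ hF hU hf hx
  · rw [hsec x hx, abs_det_conormalForm hΨ hF hU hf hx, Real.sqrt_sq_eq_abs, inducedVolume,
      inducedVolume, hframe x hx]
  · have dξ := differentiableAt_of_smooth (hξs x hx)
    rw [pd_inducedVolume Ψ (hE x hx) dξ (differentiableAt_pd hf hx)]
    -- This coordinate is τᵢ. It vanishes because (∇ρ)W is a multiple of dF, which kills ∂ᵢf.
    have h0 := dotProduct_eq_coord (hE x hx) (conormal_dotProduct_pd (Ψ := Ψ) hF hf hx) (pd i ξ x)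
    rw [hρ x hx, mul_one, conormal_dotProduct_pd_of_const hF hU hf hx dξ hρ, hξ x hx,
      conormalHess_mulVec_fieldW hΨ (transpose_hess (hF _ (hf.mapsTo hx).1))
        (hU _ (hf.mapsTo hx).1), dotProduct_smul,
        dotProduct_comm _ (diff F _), diff_dotProduct_pd hF hf hx,
      smul_zero, neg_zero] at h0
    rw [← h0, zero_add]

/-- The value is positive, so the co-oriented side of a level set is the side on which ρ is
positive. -/
theorem conormal_dotProduct_coorient (hU : ∀ y ∈ Ω, opU Ψ F y ≠ 0) {p : Vec (n + 1)}
    (hp : p ∈ Ω) : conormal Ψ F p ⬝ᵥ coorient Ψ F p = (scale Ψ F p)⁻¹ * |opU Ψ F p| := by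
  rw [conormal_eq, coorient, neg_dotProduct_neg, smul_dotProduct, dotProduct_smul,
    diff_dotProduct_fieldN, smul_eq_mul, smul_eq_mul]
  congr 1
  rcases (hU p hp).lt_or_gt with h | h
  · rw [Real.sign_of_neg h, abs_of_neg h]; ring
  · rw [Real.sign_of_pos h, abs_of_pos h]; ring

/-- A co-oriented equiaffine normal along a parametrized piece of a level set equals `W`. -/
theorem eq_fieldW_of_isEquiaffineNormalAlong (hΨ : Ψ ≠ 0) (hF : ∀ y ∈ Ω, ContDiffAt ℝ ∞ F y)
    (hU : ∀ y ∈ Ω, opU Ψ F y ≠ 0) (hf : IsParam (level F r Ω) Δ f)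
    (hξ : IsEquiaffineNormalAlong Ψ Δ f ξ)
    (hV : ∀ x ∈ Δ, ∃ a : ℝ, 0 < a ∧
      ξ x - a • coorient Ψ F (f x) ∈ Submodule.span ℝ (range fun i => pd i f x))
    (hx : x ∈ Δ) : ξ x = fieldW Ψ F (f x) := by
  have hpos : ∀ x ∈ Δ, 0 < conormal Ψ F (f x) ⬝ᵥ ξ x := by
    intro x hx
    obtain ⟨a, ha, hmem⟩ := hV x hx
    have hp := (hf.mapsTo hx).1
    have h := conormal_dotProduct_of_mem_span (Ψ := Ψ) hF hf hx hmem
    rw [dotProduct_sub, dotProduct_smul, conormal_dotProduct_coorient hU hp, sub_eq_zero] at h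
    rw [h, smul_eq_mul]
    have := scale_pos (hU _ hp)
    have := abs_pos.2 (hU _ hp)
    positivity
  have hone : ∀ x ∈ Δ, conormal Ψ F (f x) ⬝ᵥ ξ x = 1 := by
    intro x hx
    have ha := hpos x hx
    set a := conormal Ψ F (f x) ⬝ᵥ ξ x with hadef
    have hp := (hf.mapsTo hx).1
    -- Modulo tangent vectors ξ is aW, and a tangential summand in the first slot repeats another
    -- slot of the alternating form.
    have hvol : inducedVolume Ψ f ξ x = a * inducedVolume Ψ f (fieldW Ψ F ∘ f) x := by
      have hE := linearIndependent_frame_fieldW hΨ hF hU hf hx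
      have h0 := dotProduct_eq_coord hE (conormal_dotProduct_pd (Ψ := Ψ) hF hf hx) (ξ x)
      rw [Function.comp_apply, conormal_dotProduct_fieldW_of_mem hΨ hF hU hp, mul_one] at h0
      have h1 := sum_coord_smul hE (ξ x)
      rw [← h0, ← hadef] at h1
      have hupd : ∀ w, Ψ (Fin.cons w fun i => pd i f x) =
          Ψ (Function.update (Fin.cons 0 fun i => pd i f x) 0 w) := by
        intro w; rw [Fin.update_cons_zero]
      have hz : ∀ k : Fin n, Ψ (Function.update (Fin.cons 0 fun i => pd i f x) 0 (pd k f x)) = 0 := by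
        intro k
        rw [Fin.update_cons_zero]
        exact Ψ.map_eq_zero_of_eq _ (i := 0) (j := k.succ) (by simp) (Fin.succ_ne_zero k).symm
      rw [inducedVolume, inducedVolume, frame, frame, hupd, hupd, h1, Ψ.map_update_add,
        Ψ.map_update_smul, Ψ.map_update_sum]
      simp only [Ψ.map_update_smul, hz, mul_zero, Finset.sum_const_zero, add_zero, smul_eq_mul]
    have h2 := hξ.volume_eq x hx
    have h3 := abs_det_conormalForm hΨ hF hU hf hx
    rw [secondForm_eq hF hf hx ha.ne', Matrix.det_smul, Fintype.card_fin, abs_mul, abs_pow,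
      abs_of_pos ha] at h3
    have h4 : |(secondForm f ξ x).det| = inducedVolume Ψ f ξ x ^ 2 := by
      rw [← sq_abs (inducedVolume _ _ _ _), h2, Real.sq_sqrt (abs_nonneg _)]
    rw [h4, hvol] at h3
    have hv0 : inducedVolume Ψ f (fieldW Ψ F ∘ f) x ^ 2 ≠ 0 := by
      rw [← abs_det_conormalForm hΨ hF hU hf hx]
      exact abs_ne_zero.2 (det_conormalForm_ne_zero hΨ hF hU hf hx)
    -- Passing from W to ξ multiplies the squared volume by a² and det h by a^{-n}.
    have h5 : a ^ (n + 2) = 1 := by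
      refine mul_right_cancel₀ hv0 ?_
      linear_combination h3
    exact (pow_eq_one_iff_of_nonneg ha.le (by omega)).1 h5
  have hp := (hf.mapsTo hx).1
  have hE := hξ.transverse x hx
  have dξ : DifferentiableAt ℝ ξ x :=
    differentiableAt_of_smooth ((hξ.smooth x hx).contDiffAt (hf.isOpen.mem_nhds hx))
  have hvol0 : inducedVolume Ψ f ξ x ≠ 0 := by
    rw [inducedVolume, volume_eq_det]
    exact mul_ne_zero (volCoeff_ne_zero hΨ) (isUnit_det_frame hE).ne_zero
  -- Parallelism means τ = 0 for ξ. With ρ(ξ) = 1, this is the same condition on (∇ρ)ξ that W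
  -- satisfies.
  have hτ : ∀ i, pd i f x ⬝ᵥ (conormalHess Ψ F (f x) *ᵥ ξ x) = 0 := by
    intro i
    have h1 := hξ.parallel x hx i
    rw [pd_inducedVolume Ψ hE dξ (differentiableAt_pd hf hx)] at h1
    have h2 := mul_right_cancel₀ hvol0 h1
    have h3 := dotProduct_eq_coord hE (conormal_dotProduct_pd (Ψ := Ψ) hF hf hx) (pd i ξ x)
    rw [add_eq_right.1 h2, zero_mul, conormal_dotProduct_pd_of_const hF hU hf hx dξ hone] at h3
    exact neg_eq_zero.1 h3
  have hEW := linearIndependent_frame_fieldW hΨ hF hU hf hx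
  have hZ : conormal Ψ F (f x) ⬝ᵥ (ξ x - fieldW Ψ F (f x)) = 0 := by
    rw [dotProduct_sub, hone x hx, conormal_dotProduct_fieldW_of_mem hΨ hF hU hp, sub_self]
  have h0 := dotProduct_eq_coord hEW (conormal_dotProduct_pd (Ψ := Ψ) hF hf hx)
    (ξ x - fieldW Ψ F (f x))
  rw [hZ, Function.comp_apply, conormal_dotProduct_fieldW_of_mem hΨ hF hU hp, mul_one] at h0
  have h1 := sum_coord_smul hEW (ξ x - fieldW Ψ F (f x))
  rw [← h0, zero_smul, zero_add] at h1
  set z : Vec n := fun k => coord f (fieldW Ψ F ∘ f) x (ξ x - fieldW Ψ F (f x)) k.succ with hz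
  -- The tangent vector ξ - W, with components z, is in the kernel of h by the two vanishing
  -- conditions; nondegeneracy of h then gives ξ = W.
  have hhz : conormalForm Ψ F f x *ᵥ z = 0 := by
    ext i
    have h2 : pd i f x ⬝ᵥ (conormalHess Ψ F (f x) *ᵥ (ξ x - fieldW Ψ F (f x))) = 0 := by
      rw [Matrix.mulVec_sub, dotProduct_sub, hτ,
        conormalHess_mulVec_fieldW hΨ (transpose_hess (hF _ hp)) (hU _ hp), dotProduct_smul,
        dotProduct_comm _ (diff F _), diff_dotProduct_pd hF hf hx, smul_zero, sub_zero]
    rw [h1, Matrix.mulVec_sum, dotProduct_sum] at h2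
    simp only [Matrix.mulVec_smul, dotProduct_smul, smul_eq_mul] at h2
    simp only [Matrix.mulVec, dotProduct, Pi.zero_apply]
    rw [← neg_eq_zero, ← h2, ← Finset.sum_neg_distrib]
    refine Finset.sum_congr rfl fun k _ => ?_
    rw [conormalForm_apply hF hU hf hx, hz]
    simp only [dotProduct, Matrix.mulVec]
    ring
  have hz0 : z = 0 :=
    Matrix.eq_zero_of_mulVec_eq_zero (det_conormalForm_ne_zero hΨ hF hU hf hx) hhz
  rw [← sub_eq_zero, h1]
  exact Finset.sum_eq_zero fun k _ => by
    change z k • _ = _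
    rw [hz0, Pi.zero_apply, zero_smul]

/-- The trace of the shape operator of `W`. -/
theorem meanCurvature_eq (hn : 1 ≤ n) (hΨ : Ψ ≠ 0) (hΩ : IsOpen Ω)
    (hF : ∀ y ∈ Ω, ContDiffAt ℝ ∞ F y)
    (hU : ∀ y ∈ Ω, opU Ψ F y ≠ 0) (hf : IsParam (level F r Ω) Δ f) (hx : x ∈ Δ)
    (hξ : ∀ y ∈ Δ, ξ y = fieldW Ψ F (f y)) :
    n * meanCurvature f ξ x = divergence (fun y => kDual Ψ F y *ᵥ muForm Ψ F y) (f x)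
      + (n + 2) * scale Ψ F (f x) * (opU Ψ F (f x))⁻¹ *
        (hessDet Ψ F (f x) - fieldN Ψ F (f x) ⬝ᵥ muForm Ψ F (f x)) := by
  have hp := (hf.mapsTo hx).1
  have hFx := hF _ hp
  have hUx := hU _ hp
  have hn0 : (n : ℝ) ≠ 0 := by positivity
  have hEW := linearIndependent_frame_fieldW hΨ hF hU hf hx
  have hframe : frame f ξ x = frame f (fieldW Ψ F ∘ f) x := by rw [frame, hξ x hx]; rfl
  have hcoord : coord f ξ x = coord f (fieldW Ψ F ∘ f) x := by
    ext v; rw [coord, coord, hframe]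
  have hW : DifferentiableAt ℝ (fieldW Ψ F) (f x) :=
    differentiableAt_of_smooth (smooth_fieldW hΨ hFx hUx)
  have hpd : ∀ i, pd i ξ x = fderiv ℝ (fieldW Ψ F) (f x) (pd i f x) := by
    intro i
    have e : ξ =ᶠ[𝓝 x] fun y => fieldW Ψ F (f y) := by
      filter_upwards [hf.isOpen.mem_nhds hx] with y hy using hξ y hy
    rw [pd_congr i e, pd_comp i hW (differentiableAt_of_smooth (hf.contDiffAt hx)),
      fderiv_eq_sum_pd]
  -- The Jacobian of W. In the frame (W, ∂f) its first diagonal entry is ρ(∂_W W) = sU⁻¹(H - N·μ),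
  -- and the remaining ones add up to -tr S.
  set M : Matrix (Fin (n + 1)) (Fin (n + 1)) ℝ :=
    Matrix.of fun j p => pd p (fieldW Ψ F) (f x) j with hM
  have hMv : ∀ v, M *ᵥ v = fderiv ℝ (fieldW Ψ F) (f x) v := by
    intro v
    rw [fderiv_eq_sum_pd]
    ext j
    simp [hM, Matrix.mulVec, dotProduct, mul_comm]
  have htr : M.trace = divergence (fieldW Ψ F) (f x) := by
    simp only [Matrix.trace, Matrix.diag, divergence, hM, Matrix.of_apply, pd_apply _ _ hW]
  have h1 := sum_coord_mulVec hEW M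
  rw [Fin.sum_univ_succ, htr, divergence_fieldW hΨ hFx hUx] at h1
  have h2 : coord f (fieldW Ψ F ∘ f) x (M *ᵥ frame f (fieldW Ψ F ∘ f) x 0) 0 =
      (opU Ψ F (f x))⁻¹ * (hessDet Ψ F (f x) - fieldN Ψ F (f x) ⬝ᵥ muForm Ψ F (f x)) *
        scale Ψ F (f x) := by
    have h3 := dotProduct_eq_coord hEW (conormal_dotProduct_pd (Ψ := Ψ) hF hf hx)
      (M *ᵥ frame f (fieldW Ψ F ∘ f) x 0)
    rw [Function.comp_apply, conormal_dotProduct_fieldW_of_mem hΨ hF hU hp, mul_one] at h3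
    rw [← h3, hMv]
    change _ ⬝ᵥ fderiv ℝ (fieldW Ψ F) (f x) (fieldW Ψ F (f x)) = _
    rw [conormal_dotProduct_fderiv_fieldW hΨ (eventually_smooth hΩ hF hp) hUx,
      dotProduct_comm _ (diff F _), diff_dotProduct_fieldW hΨ (transpose_hess hFx) hUx]
    ring
  have h4 : (shapeOperator f ξ x).trace =
      -∑ i : Fin n, coord f (fieldW Ψ F ∘ f) x (M *ᵥ frame f (fieldW Ψ F ∘ f) x i.succ) i.succ := by
    simp only [Matrix.trace, Matrix.diag, shapeOperator, Matrix.of_apply, hcoord, hpd, hMv,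
      Finset.sum_neg_distrib]
    rfl
  rw [meanCurvature, mul_inv_cancel_left₀ hn0, h4]
  rw [h2] at h1
  linear_combination -h1

end Level

/-! ### Level sets are hypersurfaces -/

section Hypersurface

variable {n : ℕ}

theorem contDiff_insertNth (j : Fin (n + 1)) (r : ℝ) :
    ContDiff ℝ ∞ fun y : Vec n => (j.insertNth r y : Vec (n + 1)) := by
  refine contDiff_pi.2 fun q => ?_
  refine j.succAboveCases ?_ (fun k => ?_) q
  · simpa using contDiff_const
  · simpa using contDiff_apply ℝ ℝ k

theorem pd_insertNth (j : Fin (n + 1)) (r : ℝ) (i : Fin n) (x : Vec n) :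
    pd i (fun y : Vec n => (j.insertNth r y : Vec (n + 1))) x = Pi.single (j.succAbove i) 1 := by
  have hd : DifferentiableAt ℝ (fun y : Vec n => (j.insertNth r y : Vec (n + 1))) x :=
    (contDiff_insertNth j r).differentiable (by simp) x
  ext q
  rw [← pd_apply i q hd]
  refine j.succAboveCases ?_ (fun k => ?_) q
  · simp [pd_const]
  · have : fderiv ℝ (fun y : Vec n => y k) x = ContinuousLinearMap.proj k :=
      (ContinuousLinearMap.proj (R := ℝ) (φ := fun _ : Fin n => ℝ) k).hasFDerivAt.fderiv
    simp [pd, this, Pi.single_apply]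

/-- Where F_j ≠ 0, the map G that replaces the j-th coordinate by F is a local diffeomorphism taking
the level set to a coordinate slice. The parametrization is the inverse of G on that slice. -/
theorem isHypersurface_level {F : Vec (n + 1) → ℝ} {Ω : Set (Vec (n + 1))} (hΩ : IsOpen Ω)
    (hF : ∀ y ∈ Ω, ContDiffAt ℝ ∞ F y) (r : ℝ) (hd : ∀ y ∈ Ω, diff F y ≠ 0) :
    IsHypersurface (level F r Ω) := by
  rintro p ⟨hpΩ, hpr⟩
  obtain ⟨j, hj⟩ := Function.ne_iff.1 (hd p hpΩ)
  rw [Pi.zero_apply] at hj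
  set G : Vec (n + 1) → Vec (n + 1) := fun y => y + (F y - y j) • Pi.single j 1 with hG
  have hGins : ∀ y, G y = j.insertNth (F y) (j.removeNth y) := by
    intro y
    ext q
    refine j.succAboveCases ?_ (fun k => ?_) q
    · simp [hG]
    · simp [hG, Fin.removeNth]
  have hGs : ∀ y ∈ Ω, ContDiffAt ℝ ∞ G y := fun y hy =>
    contDiffAt_id.add (((hF y hy).sub (contDiff_apply ℝ ℝ j).contDiffAt).smul contDiffAt_const)
  let L : Vec (n + 1) → Vec (n + 1) →L[ℝ] Vec (n + 1) := fun y =>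
    ContinuousLinearMap.id ℝ _ + (fderiv ℝ F y - ContinuousLinearMap.proj j).smulRight
      (Pi.single j 1)
  have hGd : ∀ y ∈ Ω, HasFDerivAt G (L y) y := by
    intro y hy
    have h1 := (differentiableAt_of_smooth (hF y hy)).hasFDerivAt
    have h2 := (ContinuousLinearMap.proj (R := ℝ) (φ := fun _ : Fin (n + 1) => ℝ) j).hasFDerivAt
      (x := y)
    exact (hasFDerivAt_id y).add ((h1.sub h2).smul_const _)
  have hLinj : ∀ y, diff F y j ≠ 0 → Function.Injective (L y) := by
    intro y hy
    refine (injective_iff_map_eq_zero (L y)).2 fun v hv => ?_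
    have hv1 : ∀ k, k ≠ j → v k = 0 := by
      intro k hk
      have := congrFun hv k
      simpa [L, Pi.single_eq_of_ne hk] using this
    have hvs : v = Pi.single j (v j) := by
      ext k
      by_cases hk : k = j
      · subst hk; simp
      · rw [hv1 k hk, Pi.single_eq_of_ne hk]
    have h2 := congrFun hv j
    simp only [L, add_apply, ContinuousLinearMap.id_apply, ContinuousLinearMap.smulRight_apply,
      sub_apply, ContinuousLinearMap.proj_apply, Pi.add_apply, Pi.smul_apply, Pi.single_eq_same,
      smul_eq_mul, mul_one, add_sub_cancel, Pi.zero_apply] at h2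
    rw [fderiv_eq_sum_pd, Finset.sum_eq_single j (fun k _ hk => by rw [hv1 k hk, zero_smul])
      (by simp), smul_eq_mul] at h2
    have h3 : v j = 0 := (mul_eq_zero.1 h2).resolve_right hy
    rw [hvs, h3, Pi.single_zero]
  let Le : ∀ y, diff F y j ≠ 0 → (Vec (n + 1) ≃L[ℝ] Vec (n + 1)) := fun y hy =>
    (LinearEquiv.ofInjectiveEndo (L y : Vec (n + 1) →ₗ[ℝ] Vec (n + 1))
      (hLinj y hy)).toContinuousLinearEquiv
  have hLe : ∀ y hy, (Le y hy : Vec (n + 1) →L[ℝ] Vec (n + 1)) = L y := by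
    intro y hy
    ext v
    rfl
  have hGde : ∀ y ∈ Ω, ∀ hy, HasFDerivAt G (Le y hy : Vec (n + 1) →L[ℝ] Vec (n + 1)) y := by
    intro y hyΩ hy
    rw [hLe y hy]
    exact hGd y hyΩ
  set e₀ := (hGs p hpΩ).toOpenPartialHomeomorph G (hGde p hpΩ hj) (by simp) with he₀
  have hV : IsOpen {y ∈ Ω | diff F y j ≠ 0} := by
    have hc : ContinuousOn (fun y => diff F y j) Ω := fun y hy =>
      (smooth_diff (hF y hy) j).continuousAt.continuousWithinAt
    exact hc.isOpen_inter_preimage hΩ isOpen_ne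
  -- On the restricted source the derivative of G is invertible at every point, so the inverse is
  -- smooth on the whole target and not only at the image of p.
  set e := e₀.restr {y ∈ Ω | diff F y j ≠ 0} with he
  have heG : ∀ y, e y = G y := fun _ => rfl
  have hes : e.source = e₀.source ∩ {y ∈ Ω | diff F y j ≠ 0} := by
    rw [he, OpenPartialHomeomorph.restr_source, hV.interior_eq]
  have hpe : p ∈ e.source := by
    rw [hes]
    exact ⟨(hGs p hpΩ).mem_toOpenPartialHomeomorph_source (hGde p hpΩ hj) (by simp), hpΩ, hj⟩
  have hsymm : ∀ a ∈ e.target, e.symm a ∈ Ω ∧ diff F (e.symm a) j ≠ 0 ∧ G (e.symm a) = a := by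
    intro a ha
    have h1 := e.map_target ha
    rw [hes] at h1
    exact ⟨h1.2.1, h1.2.2, e.right_inv ha⟩
  have hsm : ∀ a ∈ e.target, ContDiffAt ℝ ∞ e.symm a := by
    intro a ha
    obtain ⟨h1, h2, -⟩ := hsymm a ha
    exact e.contDiffAt_symm ha (hGde _ h1 h2) (hGs _ h1)
  have hιc : Continuous fun y : Vec n => (j.insertNth r y : Vec (n + 1)) :=
    (contDiff_insertNth j r).continuous
  set f : Vec n → Vec (n + 1) := fun y => e.symm (j.insertNth r y) with hf
  set Δ : Set (Vec n) := {y | (j.insertNth r y : Vec (n + 1)) ∈ e.target} with hΔ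
  have hΔo : IsOpen Δ := e.open_target.preimage hιc
  have hfs : ∀ y ∈ Δ, ContDiffAt ℝ ∞ f y := fun y hy =>
    (hsm _ hy).comp y (contDiff_insertNth j r).contDiffAt
  refine ⟨Δ, f, ⟨hΔo, fun y hy => (hfs y hy).contDiffWithinAt, ?_, ?_, ?_⟩, ?_, ?_⟩
  · intro y hy y' hy' h
    simpa using congrArg j.removeNth (e.symm.injOn hy hy' h)
  · intro y hy
    obtain ⟨h1, h2, h3⟩ := hsymm _ hy
    refine LinearIndependent.of_comp (L (f y)).toLinearMap ?_
    -- The derivative of G maps the tangent vectors to distinct standard basis vectors, from which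
    -- independence is pulled back.
    have hcomp : (L (f y)).toLinearMap ∘ (fun i => pd i f y) =
        (Pi.basisFun ℝ (Fin (n + 1))) ∘ j.succAbove := by
      funext i
      have hG1 : (fun z => G (f z)) =ᶠ[𝓝 y] fun z => j.insertNth r z := by
        filter_upwards [hΔo.mem_nhds hy] with z hz using (hsymm _ hz).2.2
      have h4 := pd_congr i hG1
      rw [pd_insertNth, pd_comp i (hGd _ h1).differentiableAt (differentiableAt_of_smooth (hfs y hy)),
        ← fderiv_eq_sum_pd, (hGd _ h1).fderiv] at h4
      simpa using h4
    rw [hcomp]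
    exact (Pi.basisFun ℝ (Fin (n + 1))).linearIndependent.comp _ Fin.succAbove_right_injective
  · intro y hy
    obtain ⟨h1, -, h3⟩ := hsymm _ hy
    refine ⟨h1, ?_⟩
    have := congrFun h3 j
    rw [hGins] at this
    simpa using this
  · refine ⟨j.removeNth p, ?_, ?_⟩
    · have := e.map_source hpe
      rw [heG, hGins, hpr] at this
      exact this
    · have := e.left_inv hpe
      rw [heG, hGins, hpr] at this
      exact this
  · filter_upwards [nhdsWithin_le_nhds (e.open_source.mem_nhds hpe), self_mem_nhdsWithin]
      with z hz hzS
    refine ⟨j.removeNth z, ?_, ?_⟩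
    · have := e.map_source hz
      rw [heG, hGins, hzS.2] at this
      exact this
    · have := e.left_inv hz
      rw [heG, hGins, hzS.2] at this
      exact this

end Hypersurface

/-! ### The equiaffine normal and the mean curvature of level sets -/

section LevelSets

variable {n : ℕ} {Ψ : Vec (n + 1) [⋀^Fin (n + 1)]→ₗ[ℝ] ℝ} {F : Vec (n + 1) → ℝ}
  {Ω : Set (Vec (n + 1))} {r : ℝ}

theorem diff_ne_zero_of_opU {x : Vec (n + 1)} (hU : opU Ψ F x ≠ 0) : diff F x ≠ 0 := by
  intro h
  exact hU (by rw [opU, h, dotProduct_zero])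

theorem exists_isParam (hΩ : IsOpen Ω) (hF : ∀ y ∈ Ω, ContDiffAt ℝ ∞ F y)
    (hU : ∀ y ∈ Ω, opU Ψ F y ≠ 0) {p : Vec (n + 1)} (hp : p ∈ level F r Ω) :
    ∃ (Δ : Set (Vec n)) (f : Vec n → Vec (n + 1)), IsParam (level F r Ω) Δ f ∧ p ∈ f '' Δ := by
  obtain ⟨Δ, f, h1, h2, -⟩ := isHypersurface_level hΩ hF r
    (fun y hy => diff_ne_zero_of_opU (hU y hy)) p hp
  exact ⟨Δ, f, h1, h2⟩

/-- `W` is the unique co-oriented equiaffine normal of the level set. -/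
theorem isEquiaffineNormal_iff (hΨ : Ψ ≠ 0) (hΩ : IsOpen Ω) (hF : ∀ y ∈ Ω, ContDiffAt ℝ ∞ F y)
    (hU : ∀ y ∈ Ω, opU Ψ F y ≠ 0) (ξ : Vec (n + 1) → Vec (n + 1)) :
    IsEquiaffineNormal Ψ (level F r Ω) (coorient Ψ F) ξ ↔
      EqOn ξ (fieldW Ψ F) (level F r Ω) := by
  constructor
  · rintro ⟨-, h⟩ p hp
    obtain ⟨Δ, f, hf, x, hx, rfl⟩ := exists_isParam hΩ hF hU hp
    exact eq_fieldW_of_isEquiaffineNormalAlong hΨ hF hU hf (h Δ f hf).1 (h Δ f hf).2 hx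
  · intro h
    refine ⟨isHypersurface_level hΩ hF r fun y hy => diff_ne_zero_of_opU (hU y hy),
      fun Δ f hf => ⟨isEquiaffineNormalAlong hΨ hF hU hf fun y hy => h (hf.mapsTo hy),
        fun x hx => ?_⟩⟩
    have hp := (hf.mapsTo hx).1
    have h1 := scale_pos (hU _ hp)
    have h2 := abs_pos.2 (hU _ hp)
    refine ⟨scale Ψ F (f x) / |opU Ψ F (f x)|, by positivity,
      mem_span_of_conormal hΨ hF hU hf hx ?_⟩
    rw [h (hf.mapsTo hx), dotProduct_sub, dotProduct_smul, conormal_dotProduct_coorient hU hp,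
      conormal_dotProduct_fieldW_of_mem hΨ hF hU hp, smul_eq_mul]
    field_simp
    ring

theorem isEquiaffineMeanCurvatureAt_iff (hn : 1 ≤ n) (hΨ : Ψ ≠ 0) (hΩ : IsOpen Ω)
    (hF : ∀ y ∈ Ω, ContDiffAt ℝ ∞ F y) (hU : ∀ y ∈ Ω, opU Ψ F y ≠ 0) {p : Vec (n + 1)}
    (hp : p ∈ level F r Ω) (H : ℝ) :
    IsEquiaffineMeanCurvatureAt Ψ (level F r Ω) (coorient Ψ F) p H ↔
      n * H = divergence (fun y => kDual Ψ F y *ᵥ muForm Ψ F y) p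
        + (n + 2) * scale Ψ F p * (opU Ψ F p)⁻¹ *
          (hessDet Ψ F p - fieldN Ψ F p ⬝ᵥ muForm Ψ F p) := by
  have hn0 : (n : ℝ) ≠ 0 := by positivity
  constructor
  · rintro ⟨ξ, hξ, ⟨Δ, f, hf, x, hx, rfl⟩, hH⟩
    rw [isEquiaffineNormal_iff hΨ hΩ hF hU] at hξ
    rw [← hH Δ f hf x hx rfl]
    exact meanCurvature_eq hn hΨ hΩ hF hU hf hx fun y hy => hξ (hf.mapsTo hy)
  · intro h
    refine ⟨fieldW Ψ F, (isEquiaffineNormal_iff hΨ hΩ hF hU _).2 fun _ _ => rfl,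
      exists_isParam hΩ hF hU hp, fun Δ f hf x hx hfx => ?_⟩
    refine mul_left_cancel₀ hn0 ?_
    rw [h, ← hfx]
    exact meanCurvature_eq hn hΨ hΩ hF hU hf hx fun _ _ => rfl

theorem sign_mul_rpow {a : ℝ} (ha : a ≠ 0) :
    |a| ^ (1 / ((n : ℝ) + 2)) * a⁻¹ = Real.sign a * |a| ^ (-((n : ℝ) + 1) / ((n : ℝ) + 2)) := by
  have h1 : |a| ^ (-((n : ℝ) + 1) / ((n : ℝ) + 2)) = |a| ^ (1 / ((n : ℝ) + 2)) * |a|⁻¹ := by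
    have : (n : ℝ) + 2 ≠ 0 := by positivity
    rw [← Real.rpow_neg_one |a|, ← Real.rpow_add (abs_pos.2 ha)]
    congr 1
    field_simp
    ring
  rw [h1]
  rcases ha.lt_or_gt with h | h
  · rw [Real.sign_of_neg h, abs_of_neg h, inv_neg]; ring
  · rw [Real.sign_of_pos h, abs_of_pos h]; ring

/-- The link between the two mean curvature formulas: det ∇ρ equals (-1)^{n+1} s^{-(n+1)} Ψ²(H -
N·μ), and s/U = sign(U) s^{-(n+1)} because s^{n+2} = |U|. -/
theorem detRel_gradConormal (hΨ : Ψ ≠ 0) {p : Vec (n + 1)} (hF : ContDiffAt ℝ ∞ F p)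
    (hU : opU Ψ F p ≠ 0) :
    (-1) ^ (n + 1) * (n + 2) * Real.sign (opU Ψ F p) * detRel Ψ (gradConormal Ψ F p) =
      (n + 2) * scale Ψ F p * (opU Ψ F p)⁻¹ *
        (hessDet Ψ F p - fieldN Ψ F p ⬝ᵥ muForm Ψ F p) := by
  have hc := volCoeff_ne_zero hΨ
  have hs := (scale_pos hU).ne'
  have h1 : scale Ψ F p * (opU Ψ F p)⁻¹ =
      Real.sign (opU Ψ F p) * (scale Ψ F p)⁻¹ ^ (n + 1) := by
    have h2 : scale Ψ F p ^ (n + 1) * scale Ψ F p = |opU Ψ F p| := by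
      rw [← pow_succ]; exact rpow_one_div_pow _
    have h3 : scale Ψ F p ^ (n + 1) ≠ 0 := pow_ne_zero _ hs
    have h4 : Real.sign (opU Ψ F p) = (opU Ψ F p)⁻¹ * |opU Ψ F p| := by
      rcases hU.lt_or_gt with h | h
      · rw [Real.sign_of_neg h, abs_of_neg h]; field_simp
      · rw [Real.sign_of_pos h, abs_of_pos h]; field_simp
    rw [h4, ← h2, inv_pow]
    field_simp
  have h5 : ((-1 : ℝ) ^ (n + 1)) * (-1) ^ (n + 1) = 1 := by rw [← mul_pow]; simp
  rw [detRel, gradConormal_eq hF hU, det_conormalHess hΨ (transpose_hess hF), mul_assoc (_ + _), h1]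
  field_simp
  linear_combination (Real.sign (opU Ψ F p) *
    (hessDet Ψ F p - fieldN Ψ F p ⬝ᵥ muForm Ψ F p)) * h5

end LevelSets

/-! ### Composition operators on spaces of continuous maps -/

section Superposition

variable {K E F : Type} [TopologicalSpace K] [CompactSpace K] [NormedAddCommGroup E]
  [NormedSpace ℝ E] [NormedAddCommGroup F] [NormedSpace ℝ F]

/-- Pointwise application `(A, h) ↦ (s ↦ A s (h s))`, as a bilinear map. -/
noncomputable def pointwiseApplyBilin : C(K, E →L[ℝ] F) →ₗ[ℝ] C(K, E) →ₗ[ℝ] C(K, F) :=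
  LinearMap.mk₂ ℝ
    (fun (A : C(K, E →L[ℝ] F)) (h : C(K, E)) =>
      (⟨fun s => A s (h s), A.continuous.clm_apply h.continuous⟩ : C(K, F)))
    (fun A A' h => by ext s; simp) (fun c A h => by ext s; simp)
    (fun A h h' => by ext s; simp) (fun c A h => by ext s; simp)

/-- Pointwise application `(A, h) ↦ (s ↦ A s (h s))`. -/
noncomputable def pointwiseApply : C(K, E →L[ℝ] F) →L[ℝ] C(K, E) →L[ℝ] C(K, F) :=
  LinearMap.mkContinuous₂ (𝕜 := ℝ) (𝕜₂ := ℝ) (𝕜₃ := ℝ) (E := C(K, E →L[ℝ] F)) (F := C(K, E))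
    (G := C(K, F)) (σ₂₃ := RingHom.id ℝ) (σ₁₃ := RingHom.id ℝ) pointwiseApplyBilin 1 (fun A h => by
    refine (ContinuousMap.norm_le _ (by positivity)).2 fun s => ?_
    rw [one_mul]
    exact (A s).le_of_opNorm_le_of_le (A.norm_coe_le_norm s) (h.norm_coe_le_norm s))

/-- Composition with g' is continuous in the sup norm, so g' varies by at most c along the segments
from γ(s) to γ'(s), uniformly in s. The mean value inequality then bounds the remainder in the sup
norm. -/
theorem hasFDerivAt_comp_continuousMap (g : C(E, F)) (g' : C(E, E →L[ℝ] F))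
    (hg : ∀ y, HasFDerivAt g (g' y) y) (γ : C(K, E)) :
    HasFDerivAt (fun γ : C(K, E) => g.comp γ) (pointwiseApply (g'.comp γ)) γ := by
  refine HasFDerivAt.of_isLittleO (Asymptotics.isLittleO_iff.2 fun c hc => ?_)
  have hcont : Continuous fun γ : C(K, E) => g'.comp γ := ContinuousMap.continuous_postcomp g'
  obtain ⟨δ, hδ, hball⟩ := (Metric.continuousAt_iff
    (f := fun γ : C(K, E) => g'.comp γ)).1 (hcont.continuousAt (x := γ)) c hc
  filter_upwards [Metric.ball_mem_nhds γ hδ] with γ' hγ'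
  refine (ContinuousMap.norm_le _ (by positivity)).2 fun s => ?_
  have hseg : ∀ z ∈ segment ℝ (γ s) (γ' s), ‖g' z - g' (γ s)‖ ≤ c := by
    intro z hz
    rw [segment_eq_image'] at hz
    obtain ⟨θ, hθ, rfl⟩ := hz
    have h1 : dist (γ + θ • (γ' - γ)) γ < δ := by
      rw [dist_eq_norm, add_sub_cancel_left, norm_smul, Real.norm_of_nonneg hθ.1]
      calc θ * ‖γ' - γ‖ ≤ 1 * ‖γ' - γ‖ := by gcongr; exact hθ.2
        _ < δ := by rw [one_mul, ← dist_eq_norm]; exact hγ'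
    have h2 := (ContinuousMap.dist_apply_le_dist s).trans (hball h1).le
    rwa [dist_eq_norm] at h2
  have h := (convex_segment (𝕜 := ℝ) (γ s) (γ' s)).norm_image_sub_le_of_norm_hasFDerivWithin_le'
    (fun z _ => (hg z).hasFDerivWithinAt) hseg (left_mem_segment ℝ _ _) (right_mem_segment ℝ _ _)
  refine h.trans ?_
  gcongr
  exact (γ' - γ).norm_coe_le_norm s

/-- Induction on k: the derivative of γ ↦ g ∘ γ is γ ↦ g' ∘ γ followed by a continuous linear map.
The target space varies because g' takes values in E →L F. -/
theorem contDiff_comp_continuousMap (k : ℕ) : ∀ {F : Type} [NormedAddCommGroup F]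
    [NormedSpace ℝ F] (g : C(E, F)), ContDiff ℝ k g →
      ContDiff ℝ k (fun γ : C(K, E) => g.comp γ) := by
  induction k with
  | zero =>
    intro F _ _ g _
    exact contDiff_zero.2 (ContinuousMap.continuous_postcomp g)
  | succ k ih =>
    intro F _ _ g hg
    push_cast at hg ⊢
    obtain ⟨g', hg', hd⟩ := contDiff_succ_iff_hasFDerivAt.1 hg
    have h1 := ih (F := E →L[ℝ] F) ⟨g', hg'.continuous⟩ hg'
    refine contDiff_succ_iff_hasFDerivAt.2
      ⟨fun γ => pointwiseApply ((⟨g', hg'.continuous⟩ : C(E, E →L[ℝ] F)).comp γ),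
        ContDiff.comp (g := fun A => pointwiseApply (K := K) (E := E) (F := F) A)
          (ContinuousLinearMap.contDiff _) h1, fun γ => ?_⟩
    exact hasFDerivAt_comp_continuousMap g ⟨g', hg'.continuous⟩ hd γ

end Superposition

/-! ### Smooth dependence of integral curves on the initial condition -/

section Volterra

open unitInterval

variable {E : Type} [NormedAddCommGroup E] [NormedSpace ℝ E]

/-- The operator `γ ↦ ∫₀ˢ γ` on continuous maps on the unit interval. -/
noncomputable def primitive : C(I, E) →L[ℝ] C(I, E) :=
  LinearMap.mkContinuous
    { toFun := fun γ => ⟨fun s => ∫ w in (0 : ℝ)..s, γ (projIcc 0 1 zero_le_one w), by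
        have hc : Continuous fun w : ℝ => γ (projIcc 0 1 zero_le_one w) :=
          γ.continuous.comp continuous_projIcc
        exact (intervalIntegral.continuous_primitive (fun a b => hc.intervalIntegrable a b) 0).comp
          continuous_subtype_val⟩
      map_add' := fun γ γ' => by
        ext s
        exact intervalIntegral.integral_add
          ((γ.continuous.comp continuous_projIcc).intervalIntegrable _ _)
          ((γ'.continuous.comp continuous_projIcc).intervalIntegrable _ _)
      map_smul' := fun c γ => by
        ext s
        exact intervalIntegral.integral_smul _ _ }
    1 (fun γ => by
      refine (ContinuousMap.norm_le _ (by positivity)).2 fun s => ?_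
      have h := intervalIntegral.norm_integral_le_of_norm_le_const (a := (0 : ℝ)) (b := s)
        (f := fun w => γ (projIcc 0 1 zero_le_one w)) (C := ‖γ‖)
        fun w _ => γ.norm_coe_le_norm _
      refine h.trans ?_
      rw [sub_zero, abs_of_nonneg s.2.1, one_mul]
      exact mul_le_of_le_one_right (norm_nonneg _) s.2.2)

/-- The constant map, as a continuous linear map in its value. -/
noncomputable def constMap : E →L[ℝ] C(I, E) :=
  LinearMap.mkContinuous
    { toFun := fun x => ContinuousMap.const I x
      map_add' := fun _ _ => rfl
      map_smul' := fun _ _ => rfl }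
    1 (fun x => (ContinuousMap.norm_le _ (by positivity)).2 fun s => by
      rw [one_mul]; exact le_rfl)

theorem constMap_apply (x : E) (s : I) : constMap x s = x := rfl

theorem norm_sub_le_of_integralCurve {α : ℝ → E} {v : ℝ → E} {L : ℝ} (hv : ∀ t, ‖v t‖ ≤ L)
    {J : Set ℝ} (hJ : J.OrdConnected) (h0 : (0 : ℝ) ∈ J) (h : ∀ s ∈ J, HasDerivAt α (v s) s)
    {t : ℝ} (ht : t ∈ J) : ‖α t - α 0‖ ≤ L * |t| := by
  have := hJ.convex.norm_image_sub_le_of_norm_hasDerivWithin_le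
    (fun s hs => (h s hs).hasDerivWithinAt) (fun s _ => hv s) h0 ht
  simpa using this

/-- Rescaled to [0,1], the curve s ↦ Φ(st, x) is a zero γ of G((t, x), γ) = γ - x - t∫X∘γ. The
implicit function theorem makes γ depend on (t, x) in a C^k way, and Φ(t, x) is γ evaluated at 1. -/
theorem contDiffAt_of_integralCurves [CompleteSpace E] (k : ℕ) (hk : k ≠ 0) {X : E → E}
    (hX : ContDiff ℝ k X) {L : ℝ} (hL : ∀ y, ‖X y‖ ≤ L) {Φ : ℝ × E → E} {q : E}
    (h : ∀ᶠ u in 𝓝 ((0 : ℝ), q), Φ (0, u.2) = u.2 ∧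
      ∀ s ∈ Icc (0 : ℝ) 1, HasDerivAt (fun t => Φ (t, u.2)) (X (Φ (s * u.1, u.2))) (s * u.1)) :
    ContDiffAt ℝ k Φ (0, q) := by
  classical
  let X' : C(E, E) := ⟨X, hX.continuous⟩
  let G : (ℝ × E) × C(I, E) → C(I, E) := fun v =>
    v.2 - constMap v.1.2 - v.1.1 • primitive (X'.comp v.2)
  have hGs : ContDiff ℝ k G := by
    refine (contDiff_snd.sub ((constMap (E := E)).contDiff.comp (contDiff_snd.comp contDiff_fst))).sub
      ((contDiff_fst.comp contDiff_fst).smul ((primitive (E := E)).contDiff.comp ?_))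
    exact (contDiff_comp_continuousMap k X' hX).comp contDiff_snd
  set v₀ : (ℝ × E) × C(I, E) := ((0, q), constMap q) with hv₀
  have hG0 : G v₀ = 0 := by simp [G, hv₀]
  have hk' : (k : WithTop ℕ∞) ≠ 0 := by exact_mod_cast hk
  -- At t = 0 the integral term disappears, and the partial derivative in γ is the identity.
  have hinv : (fderiv ℝ G v₀ ∘L ContinuousLinearMap.inr ℝ (ℝ × E) C(I, E)).IsInvertible := by
    have h1 : HasFDerivAt (fun γ : C(I, E) => ((0, q), γ) : C(I, E) → (ℝ × E) × C(I, E))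
        (ContinuousLinearMap.inr ℝ (ℝ × E) C(I, E)) (constMap q) :=
      hasFDerivAt_prodMk_right _ _
    have h2 := ((hGs.differentiable hk') v₀).hasFDerivAt.comp (constMap q) h1
    have h3 : HasFDerivAt (fun γ : C(I, E) => G ((0, q), γ))
        (ContinuousLinearMap.id ℝ C(I, E)) (constMap q) := by
      have e : (fun γ : C(I, E) => G ((0, q), γ)) = fun γ => γ - constMap q := by
        funext γ; simp [G]
      rw [e]
      exact (hasFDerivAt_id _).sub_const _
    rw [h2.unique h3]
    exact ContinuousLinearMap.isInvertible_equiv (f := ContinuousLinearEquiv.refl ℝ C(I, E))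
  have hGat : ContDiffAt ℝ k G v₀ := hGs.contDiffAt
  let ψ := hGat.implicitFunction hk' hinv
  have hψ : ContDiffAt ℝ k ψ (0, q) := hGat.contDiffAt_implicitFunction hk' hinv
  have hiff := hGat.eventually_apply_eq_iff_implicitFunction hk' hinv
  let path : ℝ × E → C(I, E) := fun u =>
    if hc : Continuous fun s : I => Φ (s * u.1, u.2) then ⟨_, hc⟩ else constMap q
  have hpath : ∀ᶠ u in 𝓝 ((0 : ℝ), q), ∀ s : I, path u s = Φ (s * u.1, u.2) := by
    filter_upwards [h] with u hu s
    have hc : Continuous fun s : I => Φ (s * u.1, u.2) := by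
      refine continuous_iff_continuousAt.2 fun s => ?_
      exact ContinuousAt.comp (f := fun s : I => (s : ℝ) * u.1) (g := fun t => Φ (t, u.2))
        (hu.2 s s.2).continuousAt (by fun_prop)
    simp only [path, dif_pos hc]
    rfl
  have hder : ∀ᶠ u in 𝓝 ((0 : ℝ), q), ∀ s ∈ Icc (0 : ℝ) 1,
      HasDerivAt (fun w : ℝ => Φ (w * u.1, u.2)) (u.1 • X (Φ (s * u.1, u.2))) s := by
    filter_upwards [h] with u hu s hs
    exact HasDerivAt.scomp s (hu.2 s hs) (by simpa using (hasDerivAt_id s).mul_const u.1)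
  -- The implicit function describes only the zeros of G near v₀, so the rescaled paths must be
  -- shown to converge uniformly to the constant path at q. The global bound on X provides this.
  have hbound : ∀ᶠ u in 𝓝 ((0 : ℝ), q), ‖path u - constMap q‖ ≤ L * |u.1| + ‖u.2 - q‖ := by
    filter_upwards [h, hpath, hder] with u hu hpu hdu
    have hL0 : 0 ≤ L := (norm_nonneg _).trans (hL q)
    refine (ContinuousMap.norm_le _ (by positivity)).2 fun s => ?_
    have h1 := (convex_Icc (0 : ℝ) 1).norm_image_sub_le_of_norm_hasDerivWithin_le (C := L * |u.1|)
      (fun w hw => (hdu w hw).hasDerivWithinAt) (fun w _ => by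
        rw [norm_smul, Real.norm_eq_abs, mul_comm]
        gcongr
        exact hL _) (left_mem_Icc.2 zero_le_one) s.2
    rw [zero_mul, hu.1, sub_zero, Real.norm_of_nonneg s.2.1] at h1
    calc ‖(path u - constMap q) s‖ = ‖(Φ (s * u.1, u.2) - u.2) + (u.2 - q)‖ := by
          rw [ContinuousMap.sub_apply, hpu, constMap_apply]; congr 1; abel
      _ ≤ ‖Φ (s * u.1, u.2) - u.2‖ + ‖u.2 - q‖ := norm_add_le _ _
      _ ≤ L * |u.1| + ‖u.2 - q‖ := by
          gcongr
          exact h1.trans (mul_le_of_le_one_right (by positivity) s.2.2)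
  have htend : Tendsto (fun u => (u, path u)) (𝓝 ((0 : ℝ), q)) (𝓝 v₀) := by
    refine Tendsto.prodMk_nhds tendsto_id (tendsto_iff_norm_sub_tendsto_zero.2 ?_)
    refine squeeze_zero' (Eventually.of_forall fun _ => norm_nonneg _) hbound ?_
    have : Continuous fun u : ℝ × E => L * |u.1| + ‖u.2 - q‖ := by fun_prop
    simpa using this.tendsto ((0 : ℝ), q)
  have hsol : ∀ᶠ u in 𝓝 ((0 : ℝ), q), G (u, path u) = 0 := by
    filter_upwards [h, hpath, hder] with u hu hpu hdu
    ext s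
    have hcX : Continuous fun w : ℝ => X (path u (projIcc 0 1 zero_le_one w)) :=
      hX.continuous.comp ((path u).continuous.comp continuous_projIcc)
    have h1 : ∫ w in (0 : ℝ)..s, u.1 • X (path u (projIcc 0 1 zero_le_one w)) =
        Φ (s * u.1, u.2) - Φ (0 * u.1, u.2) := by
      refine intervalIntegral.integral_eq_sub_of_hasDerivAt (f := fun w : ℝ => Φ (w * u.1, u.2))
        (fun w hw => ?_) ((hcX.const_smul _).intervalIntegrable _ _)
      rw [uIcc_of_le s.2.1] at hw
      have hw1 : w ∈ Icc (0 : ℝ) 1 := ⟨hw.1, hw.2.trans s.2.2⟩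
      have h2 := hdu w hw1
      rwa [projIcc_of_mem zero_le_one hw1, hpu]
    rw [intervalIntegral.integral_smul, zero_mul, hu.1] at h1
    change path u s - u.2 - u.1 • (∫ w in (0 : ℝ)..s, X (path u (projIcc 0 1 zero_le_one w))) = 0
    rw [h1, hpu, sub_self]
  refine ((ContinuousMap.evalCLM ℝ (1 : I)).contDiff.contDiffAt.comp (0, q) hψ).congr_of_eventuallyEq
    ?_
  filter_upwards [htend.eventually hiff, hsol, hpath] with u h1 h2 h3
  have h4 := h1.1 (h2.trans hG0.symm)
  change Φ u = ψ u 1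
  change ψ u = path u at h4
  rw [h4, h3]
  simp

end Volterra

/-! ### The maximal flow of a smooth vector field -/

section Flow

variable {m : ℕ} {X : Vec m → Vec m} {Ω : Set (Vec m)} {p : Vec m} {J J' : Set ℝ}
  {γ γ' : ℝ → Vec m}

/-- Agreement at a point spreads to nearby points by local Lipschitz uniqueness, and disagreement
spreads by continuity; the intersection of the two intervals is connected and contains 0. -/
theorem IsIntegralCurveFrom.eqOn (hX : ∀ y ∈ Ω, ContDiffAt ℝ ∞ X y)
    (h : IsIntegralCurveFrom X Ω p J γ) (h' : IsIntegralCurveFrom X Ω p J' γ') :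
    EqOn γ γ' (J ∩ J') := by
  have hpre : IsPreconnected (J ∩ J') := (h.ordConnected.inter h'.ordConnected).isPreconnected
  have hopen : IsOpen (J ∩ J') := h.isOpen.inter h'.isOpen
  intro t ht
  refine hpre.induction₂' (fun a b => γ a = γ' a → γ b = γ' b) ?_
    (fun a b c _ _ _ hab hbc ha => hbc (hab ha)) (x := 0) ⟨h.zero_mem, h'.zero_mem⟩ ht
    (by rw [h.initial, h'.initial])
  intro a ha
  refine eventually_nhdsWithin_of_eventually_nhds ?_
  have hca := (h.hasDerivAt a ha.1).continuousAt
  have hca' := (h'.hasDerivAt a ha.2).continuousAt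
  by_cases heq : γ a = γ' a
  · obtain ⟨K, s, hs, hK⟩ := ((hX _ (h.mem a ha.1)).of_le (by simp)).exists_lipschitzOnWith
    have hev : γ =ᶠ[𝓝 a] γ' := by
      refine ODE_solution_unique_of_eventually (v := fun _ => X) (s := fun _ => s) (K := K)
        (Eventually.of_forall fun _ => hK) ?_ ?_ heq
      · filter_upwards [h.isOpen.mem_nhds ha.1, hca hs] with b hb hbs
        exact ⟨h.hasDerivAt b hb, hbs⟩
      · rw [heq] at hs
        filter_upwards [h'.isOpen.mem_nhds ha.2, hca' hs] with b hb hbs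
        exact ⟨h'.hasDerivAt b hb, hbs⟩
    filter_upwards [hev] with b hb using ⟨fun _ => hb, fun _ => heq⟩
  · have hne : ∀ᶠ b in 𝓝 a, γ b ≠ γ' b := by
      filter_upwards [(hca.sub hca').eventually_ne (sub_ne_zero.2 heq)] with b hb
      exact sub_ne_zero.1 hb
    filter_upwards [hne] with b hb using ⟨fun h => absurd h heq, fun h => absurd h hb⟩

/-- Uniqueness removes the dependence on the chosen curve: any integral curve through p computes the
flow. -/
theorem IsIntegralCurveFrom.maximalFlow_eq (hX : ∀ y ∈ Ω, ContDiffAt ℝ ∞ X y)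
    (h : IsIntegralCurveFrom X Ω p J γ) {t : ℝ} (ht : t ∈ J) :
    (t, p) ∈ flowDomain X Ω ∧ maximalFlow X Ω t p = γ t := by
  have hmem : (t, p) ∈ flowDomain X Ω := ⟨J, γ, h, ht⟩
  refine ⟨hmem, ?_⟩
  rw [maximalFlow, dif_pos hmem]
  have h2 := hmem.choose_spec.choose_spec
  exact h2.1.eqOn hX h ⟨h2.2, ht⟩

theorem IsIntegralCurveFrom.shift (h : IsIntegralCurveFrom X Ω p J γ) {s : ℝ} (hs : s ∈ J) :
    IsIntegralCurveFrom X Ω (γ s) ((fun t => t + s) ⁻¹' J) (fun t => γ (t + s)) where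
  isOpen := h.isOpen.preimage (by fun_prop)
  ordConnected := h.ordConnected.preimage_mono (fun a b hab => by gcongr)
  zero_mem := by simpa using hs
  initial := by simp
  mem t ht := h.mem _ ht
  hasDerivAt t ht := (h.hasDerivAt _ ht).comp_add_const t s

/-- Concatenation of integral curves. -/
theorem IsIntegralCurveFrom.concat (hX : ∀ y ∈ Ω, ContDiffAt ℝ ∞ X y)
    (h : IsIntegralCurveFrom X Ω p J γ) {s : ℝ} (hs : s ∈ J)
    (h' : IsIntegralCurveFrom X Ω (γ s) J' γ') {t : ℝ} (ht : t ∈ J') :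
    (s + t, p) ∈ flowDomain X Ω ∧ maximalFlow X Ω (s + t) p = γ' t := by
  classical
  let J₂ : Set ℝ := (fun u => u - s) ⁻¹' J'
  let γ₂ : ℝ → Vec m := fun u => if u ∈ J then γ u else γ' (u - s)
  have hJ₂ : IsOpen J₂ := h'.isOpen.preimage (by fun_prop)
  -- Agreement on the overlap shows that γ₂ coincides with one of the two curves on each of the open
  -- sets J and J₂, so derivatives can be computed there.
  have hagree : ∀ u ∈ J, u ∈ J₂ → γ u = γ' (u - s) := by
    intro u hu hu2
    have := (h.shift hs).eqOn hX h' (x := u - s) ⟨by simpa using hu, hu2⟩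
    simpa using this
  have e1 : ∀ u ∈ J, γ₂ u = γ u := fun u hu => if_pos hu
  have e2 : ∀ u ∈ J₂, γ₂ u = γ' (u - s) := by
    intro u hu
    by_cases huJ : u ∈ J
    · rw [e1 u huJ, hagree u huJ hu]
    · exact if_neg huJ
  have hcurve : IsIntegralCurveFrom X Ω p (J ∪ J₂) γ₂ := by
    refine ⟨h.isOpen.union hJ₂, ?_, Or.inl h.zero_mem, ?_, ?_, ?_⟩
    · have hoc : J₂.OrdConnected := h'.ordConnected.preimage_mono (fun a b hab => by gcongr)
      exact (IsPreconnected.union s hs (by simpa [J₂] using h'.zero_mem)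
        h.ordConnected.isPreconnected hoc.isPreconnected).ordConnected
    · rw [e1 0 h.zero_mem, h.initial]
    · rintro u (hu | hu)
      · rw [e1 u hu]; exact h.mem u hu
      · rw [e2 u hu]; exact h'.mem _ hu
    · rintro u (hu | hu)
      · rw [e1 u hu]
        refine (h.hasDerivAt u hu).congr_of_eventuallyEq ?_
        filter_upwards [h.isOpen.mem_nhds hu] with w hw using e1 w hw
      · rw [e2 u hu]
        refine ((h'.hasDerivAt _ hu).comp_sub_const u s).congr_of_eventuallyEq ?_
        filter_upwards [hJ₂.mem_nhds hu] with w hw using e2 w hw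
  have hmem : s + t ∈ J₂ := by simpa [J₂] using ht
  have := hcurve.maximalFlow_eq hX (Or.inr hmem : s + t ∈ J ∪ J₂)
  rw [e2 _ hmem] at this
  simpa using this

theorem flow_add (hX : ∀ y ∈ Ω, ContDiffAt ℝ ∞ X y) {s t : ℝ} (hs : (s, p) ∈ flowDomain X Ω)
    (ht : (t, maximalFlow X Ω s p) ∈ flowDomain X Ω) :
    (s + t, p) ∈ flowDomain X Ω ∧
      maximalFlow X Ω (s + t) p = maximalFlow X Ω t (maximalFlow X Ω s p) := by
  obtain ⟨J, γ, h, hsJ⟩ := hs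
  obtain ⟨J', γ', h', htJ⟩ := ht
  rw [(h'.maximalFlow_eq hX htJ).2]
  rw [(h.maximalFlow_eq hX hsJ).2] at h'
  exact h.concat hX hsJ h' htJ

theorem flow_neg (hX : ∀ y ∈ Ω, ContDiffAt ℝ ∞ X y) {s : ℝ} (hs : (s, p) ∈ flowDomain X Ω) :
    (-s, maximalFlow X Ω s p) ∈ flowDomain X Ω ∧
      maximalFlow X Ω (-s) (maximalFlow X Ω s p) = p := by
  obtain ⟨J, γ, h, hsJ⟩ := hs
  rw [(h.maximalFlow_eq hX hsJ).2]
  have := (h.shift hsJ).maximalFlow_eq hX (t := -s) (by simpa using h.zero_mem)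
  simpa [h.initial] using this

theorem flow_hasDerivAt (hX : ∀ y ∈ Ω, ContDiffAt ℝ ∞ X y) {s : ℝ}
    (hs : (s, p) ∈ flowDomain X Ω) :
    HasDerivAt (fun t => maximalFlow X Ω t p) (X (maximalFlow X Ω s p)) s ∧
      maximalFlow X Ω s p ∈ Ω := by
  obtain ⟨J, γ, h, hsJ⟩ := hs
  rw [(h.maximalFlow_eq hX hsJ).2]
  refine ⟨(h.hasDerivAt s hsJ).congr_of_eventuallyEq ?_, h.mem s hsJ⟩
  filter_upwards [h.isOpen.mem_nhds hsJ] with t ht using (h.maximalFlow_eq hX ht).2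

/-- The flow is defined and of class `C^k` near `(0, q)`. -/
theorem flow_local (hΩ : IsOpen Ω) (hX : ∀ y ∈ Ω, ContDiffAt ℝ ∞ X y) (k : ℕ) (hk : k ≠ 0)
    {q : Vec m} (hq : q ∈ Ω) : flowDomain X Ω ∈ 𝓝 ((0 : ℝ), q) ∧
      ContDiffAt ℝ k (fun u : ℝ × Vec m => maximalFlow X Ω u.1 u.2) (0, q) := by
  obtain ⟨R, hR, hRΩ⟩ := Metric.isOpen_iff.1 hΩ q hq
  -- Cutting off replaces X by a globally smooth, bounded field Y that equals X on the ball of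
  -- radius R/4.
  let χ : ContDiffBump q := ⟨R / 4, R / 2, by positivity, by linarith⟩
  let Y : Vec m → Vec m := fun y => χ y • X y
  have hχin : ∀ y ∈ Metric.ball q (R / 4), Y y = X y := by
    intro y hy
    simp only [Y]
    rw [χ.one_of_mem_closedBall (Metric.ball_subset_closedBall hy), one_smul]
  have hYs : ContDiff ℝ ∞ Y := by
    refine contDiff_iff_contDiffAt.2 fun y => ?_
    by_cases hy : y ∈ Metric.ball q R
    · exact χ.contDiff.contDiffAt.smul (hX y (hRΩ hy))
    · have : Y =ᶠ[𝓝 y] fun _ => 0 := by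
        have hcl : (Metric.closedBall q (R / 2))ᶜ ∈ 𝓝 y := by
          refine Metric.isClosed_closedBall.isOpen_compl.mem_nhds fun h => hy ?_
          exact Metric.closedBall_subset_ball (by linarith) h
        filter_upwards [hcl] with z hz
        simp only [Y]
        rw [χ.zero_of_le_dist (le_of_not_ge hz), zero_smul]
      exact contDiffAt_const.congr_of_eventuallyEq this
  have hYc : HasCompactSupport Y := χ.hasCompactSupport.smul_right
  obtain ⟨L, hL⟩ := hYc.exists_bound_of_continuous hYs.continuous
  have hL0 : 0 ≤ L := (norm_nonneg _).trans (hL q)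
  obtain ⟨r, hr, ε, hε, hα⟩ :=
    ContDiffAt.exists_forall_mem_closedBall_exists_eq_forall_mem_Ioo_hasDerivAt
      ((hYs.contDiffAt (x := q)).of_le (by simp)) 0
  -- A curve of Y that starts within R/8 of q moves at most R/8 in this time, so it stays where Y =
  -- X. The denominator L + 1 covers the case L = 0.
  set ε' := min ε (R / 8 / (L + 1)) with hε'
  have hε'0 : 0 < ε' := lt_min hε (by positivity)
  set r' := min r (R / 8) with hr'
  have hr'0 : 0 < r' := lt_min hr (by positivity)
  have hcurve : ∀ x ∈ Metric.ball q r', ∃ α, IsIntegralCurveFrom X Ω x (Ioo (-ε') ε') α ∧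
      ∀ t ∈ Ioo (-ε') ε', HasDerivAt α (Y (α t)) t := by
    intro x hx
    have hxr : x ∈ Metric.closedBall q r :=
      Metric.ball_subset_closedBall (Metric.ball_subset_ball (min_le_left _ _) hx)
    obtain ⟨α, hα0, hαd⟩ := hα x hxr
    have h0 : (0 : ℝ) ∈ Ioo (-ε') ε' := ⟨by linarith, hε'0⟩
    have hd : ∀ t ∈ Ioo (-ε') ε', HasDerivAt α (Y (α t)) t := fun t ht => by
      have := min_le_left ε (R / 8 / (L + 1))
      exact hαd t ⟨by linarith [ht.1], by linarith [ht.2]⟩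
    have hball : ∀ t ∈ Ioo (-ε') ε', α t ∈ Metric.ball q (R / 4) := by
      intro t ht
      have h1 := norm_sub_le_of_integralCurve (fun t => hL (α t)) ordConnected_Ioo h0 hd ht
      rw [hα0] at h1
      have h2 : |t| < R / 8 / (L + 1) := (abs_lt.2 ht).trans_le (min_le_right _ _)
      have h3 : L * |t| ≤ R / 8 := by
        calc L * |t| ≤ (L + 1) * (R / 8 / (L + 1)) := by gcongr; linarith
          _ = R / 8 := by field_simp
      have h4 : dist x q < R / 8 := (Metric.mem_ball.1 hx).trans_le (min_le_right _ _)
      rw [Metric.mem_ball]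
      calc dist (α t) q ≤ dist (α t) x + dist x q := dist_triangle _ _ _
        _ < R / 4 := by rw [dist_eq_norm (α t)]; linarith
    refine ⟨α, ⟨isOpen_Ioo, ordConnected_Ioo, h0, hα0, fun t ht => hRΩ ?_, fun t ht => ?_⟩, hd⟩
    · exact Metric.ball_subset_ball (by linarith) (hball t ht)
    · rw [← hχin _ (hball t ht)]
      exact hd t ht
  have hnhds : ∀ᶠ u in 𝓝 ((0 : ℝ), q), u.1 ∈ Ioo (-ε') ε' ∧ u.2 ∈ Metric.ball q r' :=
    prod_mem_nhds (Ioo_mem_nhds (by simpa using hε'0) hε'0) (Metric.ball_mem_nhds q hr'0)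
  constructor
  · filter_upwards [hnhds] with u hu
    obtain ⟨α, hc, -⟩ := hcurve u.2 hu.2
    exact ⟨_, α, hc, hu.1⟩
  · refine contDiffAt_of_integralCurves k hk (hYs.of_le (by exact_mod_cast le_top)) hL ?_
    filter_upwards [hnhds] with u hu
    obtain ⟨α, hc, hd⟩ := hcurve u.2 hu.2
    refine ⟨?_, fun s hs => ?_⟩
    · rw [(hc.maximalFlow_eq hX hc.zero_mem).2, hc.initial]
    · have hmem : s * u.1 ∈ Ioo (-ε') ε' := by
        refine abs_lt.1 ?_
        rw [abs_mul, abs_of_nonneg hs.1]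
        calc s * |u.1| ≤ 1 * |u.1| := by gcongr; exact hs.2
          _ < ε' := by rw [one_mul]; exact abs_lt.2 hu.1
      change HasDerivAt (fun t => maximalFlow X Ω t u.2) (Y (maximalFlow X Ω (s * u.1) u.2)) _
      rw [(hc.maximalFlow_eq hX hmem).2]
      refine (hd _ hmem).congr_of_eventuallyEq ?_
      filter_upwards [Ioo_mem_nhds hmem.1 hmem.2] with t ht using (hc.maximalFlow_eq hX ht).2

theorem flow_zero (hΩ : IsOpen Ω) (hX : ∀ y ∈ Ω, ContDiffAt ℝ ∞ X y) (hp : p ∈ Ω) :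
    (0, p) ∈ flowDomain X Ω ∧ maximalFlow X Ω 0 p = p := by
  have hmem : ((0 : ℝ), p) ∈ flowDomain X Ω :=
    mem_of_mem_nhds (flow_local hΩ hX 1 one_ne_zero hp).1
  refine ⟨hmem, ?_⟩
  obtain ⟨J, γ, h, h0⟩ := hmem
  rw [(h.maximalFlow_eq hX h0).2]
  exact h.initial

/-- The flow is defined and of class `C^k` near each point of the flow domain. -/
theorem flow_contDiffAt_nat (hΩ : IsOpen Ω) (hX : ∀ y ∈ Ω, ContDiffAt ℝ ∞ X y) (k : ℕ)
    (hk : k ≠ 0) {t : ℝ} (ht : (t, p) ∈ flowDomain X Ω) : flowDomain X Ω ∈ 𝓝 (t, p) ∧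
      ContDiffAt ℝ k (fun u : ℝ × Vec m => maximalFlow X Ω u.1 u.2) (t, p) := by
  let Φ : ℝ × Vec m → Vec m := fun u => maximalFlow X Ω u.1 u.2
  let Good : ℝ × Vec m → Prop := fun u => flowDomain X Ω ∈ 𝓝 u ∧ ContDiffAt ℝ k Φ u
  change Good (t, p)
  -- Near (s+τ, p) the group law factors the flow as Φ(t, y) = Φ(t-s, Φ(s, y)), a composite of maps
  -- known to be C^k at the relevant points.
  have good_add : ∀ s τ, Good (s, p) → Good (τ, Φ (s, p)) → Good (s + τ, p) := by
    rintro s τ ⟨h1, h2⟩ ⟨h3, h4⟩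
    let M : ℝ × Vec m → ℝ × Vec m := fun u => (u.1 - s, Φ (s, u.2))
    have hM0 : M (s + τ, p) = (τ, Φ (s, p)) := by simp [M]
    have hinner : ContDiffAt ℝ k (fun u : ℝ × Vec m => (s, u.2)) (s + τ, p) :=
      contDiffAt_const.prodMk contDiffAt_snd
    have hM : ContDiffAt ℝ k M (s + τ, p) := by
      refine (contDiffAt_fst.sub contDiffAt_const).prodMk ?_
      exact ContDiffAt.comp (g := Φ) (s + τ, p) h2 hinner
    have ev1 : ∀ᶠ u in 𝓝 (s + τ, p), (s, u.2) ∈ flowDomain X Ω :=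
      hinner.continuousAt h1
    have ev2 : ∀ᶠ u in 𝓝 (s + τ, p), M u ∈ flowDomain X Ω :=
      hM.continuousAt (by rw [hM0]; exact h3)
    have ev : ∀ᶠ u in 𝓝 (s + τ, p), u ∈ flowDomain X Ω ∧ Φ u = Φ (M u) := by
      filter_upwards [ev1, ev2] with u hu1 hu2
      have := flow_add hX hu1 hu2
      rwa [add_sub_cancel] at this
    refine ⟨ev.mono fun u hu => hu.1, ?_⟩
    refine ContDiffAt.congr_of_eventuallyEq (f := Φ ∘ M) ?_ (ev.mono fun u hu => hu.2)
    exact ContDiffAt.comp (g := Φ) (s + τ, p) (by rw [hM0]; exact h4) hM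
  obtain ⟨J, γ, h, htJ⟩ := ht
  have hp : p ∈ Ω := by rw [← show γ 0 = p from h.initial]; exact h.mem 0 h.zero_mem
  have hΦ : ∀ s ∈ J, Φ (s, p) = γ s := fun s hs => (h.maximalFlow_eq hX hs).2
  -- Goodness propagates along J from time 0. All points near (0, γ a) are good, so for b near a a
  -- short flow step transfers goodness between a and b in both directions.
  refine h.ordConnected.isPreconnected.induction₂'
    (fun a b => Good (a, p) → Good (b, p)) ?_ (fun a b c _ _ _ hab hbc ha => hbc (hab ha))
    h.zero_mem htJ (flow_local hΩ hX k hk hp)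
  intro a ha
  obtain ⟨hl1, hl2⟩ := flow_local hΩ hX k hk (h.mem a ha)
  have hgood : ∀ᶠ u in 𝓝 ((0 : ℝ), γ a), Good u :=
    (eventually_eventually_nhds.2 hl1).and (hl2.eventually (by simp))
  have hγ : ContinuousAt γ a := (h.hasDerivAt a ha).continuousAt
  have c1 : Tendsto (fun b => (b - a, γ a)) (𝓝 a) (𝓝 ((0 : ℝ), γ a)) := by
    have : Continuous fun b : ℝ => (b - a, γ a) := by fun_prop
    simpa using this.tendsto a
  have c2 : Tendsto (fun b => (a - b, γ b)) (𝓝 a) (𝓝 ((0 : ℝ), γ a)) := by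
    have : Tendsto (fun b : ℝ => a - b) (𝓝 a) (𝓝 0) := by
      simpa using (continuous_sub_left a).tendsto a
    exact this.prodMk_nhds hγ
  filter_upwards [nhdsWithin_le_nhds (c1.eventually hgood), nhdsWithin_le_nhds (c2.eventually hgood),
    self_mem_nhdsWithin] with b hb1 hb2 hbJ
  constructor
  · intro hga
    have := good_add a (b - a) hga (by rw [hΦ a ha]; exact hb1)
    rwa [add_sub_cancel] at this
  · intro hgb
    have := good_add b (a - b) hgb (by rw [hΦ b hbJ]; exact hb2)
    rwa [add_sub_cancel] at this

theorem isOpen_flowDomain (hΩ : IsOpen Ω) (hX : ∀ y ∈ Ω, ContDiffAt ℝ ∞ X y) :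
    IsOpen (flowDomain X Ω) :=
  isOpen_iff_mem_nhds.2 fun _ hu => (flow_contDiffAt_nat hΩ hX 1 one_ne_zero hu).1

theorem flow_contDiffAt (hΩ : IsOpen Ω) (hX : ∀ y ∈ Ω, ContDiffAt ℝ ∞ X y) {u : ℝ × Vec m}
    (hu : u ∈ flowDomain X Ω) :
    ContDiffAt ℝ ∞ (fun u : ℝ × Vec m => maximalFlow X Ω u.1 u.2) u := by
  refine contDiffAt_infty.2 fun k => ?_
  exact (flow_contDiffAt_nat hΩ hX (k + 1) k.succ_ne_zero hu).2.of_le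
    (by exact_mod_cast k.le_succ)

end Flow

/-! ### Level sets of functions with constant `U(F)` -/

section ConstantU

variable {n : ℕ} {Ψ : Vec (n + 1) [⋀^Fin (n + 1)]→ₗ[ℝ] ℝ} {F : Vec (n + 1) → ℝ}
  {Ω : Set (Vec (n + 1))} {κ : ℝ}

theorem muForm_eq_zero (hΩ : IsOpen Ω) (hκU : ∀ y ∈ Ω, opU Ψ F y = κ) {x : Vec (n + 1)}
    (hx : x ∈ Ω) : muForm Ψ F x = 0 := by
  have e : (fun y => Real.log |opU Ψ F y|) =ᶠ[𝓝 x] fun _ => Real.log |κ| := by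
    filter_upwards [hΩ.mem_nhds hx] with y hy
    rw [hκU y hy]
  ext i
  simp only [muForm, Pi.smul_apply, diff]
  rw [pd_congr i e, pd_const, smul_zero]
  rfl

theorem fieldW_of_const (hΩ : IsOpen Ω) (hκ : κ ≠ 0) (hκU : ∀ y ∈ Ω, opU Ψ F y = κ)
    {x : Vec (n + 1)} (hx : x ∈ Ω) : fieldW Ψ F x =
      -((Real.sign κ * |κ| ^ (-((n : ℝ) + 1) / ((n : ℝ) + 2))) • fieldN Ψ F x) := by
  rw [fieldW_eq, muForm_eq_zero hΩ hκU hx, Matrix.mulVec_zero, sub_zero, scale, hκU x hx,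
    sign_mul_rpow hκ]

theorem divergence_kDual_of_const (hΩ : IsOpen Ω) (hκU : ∀ y ∈ Ω, opU Ψ F y = κ)
    {x : Vec (n + 1)} (hx : x ∈ Ω) :
    divergence (fun y => kDual Ψ F y *ᵥ muForm Ψ F y) x = 0 := by
  refine Finset.sum_eq_zero fun p _ => ?_
  have e : (fun y => (kDual Ψ F y *ᵥ muForm Ψ F y) p) =ᶠ[𝓝 x] fun _ => 0 := by
    filter_upwards [hΩ.mem_nhds hx] with y hy
    rw [muForm_eq_zero hΩ hκU hy, Matrix.mulVec_zero, Pi.zero_apply]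
  rw [pd_congr p e, pd_const]

theorem isEquiaffineMeanCurvatureAt_iff_of_const (hn : 1 ≤ n) (hΨ : Ψ ≠ 0) (hΩ : IsOpen Ω)
    (hF : ∀ y ∈ Ω, ContDiffAt ℝ ∞ F y) (hκ : κ ≠ 0) (hκU : ∀ y ∈ Ω, opU Ψ F y = κ) {r : ℝ}
    {p : Vec (n + 1)} (hp : p ∈ level F r Ω) (H : ℝ) :
    IsEquiaffineMeanCurvatureAt Ψ (level F r Ω) (coorient Ψ F) p H ↔
      n * H = (n + 2) * Real.sign κ * |κ| ^ (-((n : ℝ) + 1) / ((n : ℝ) + 2)) *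
        hessDet Ψ F p := by
  rw [isEquiaffineMeanCurvatureAt_iff hn hΨ hΩ hF (fun y hy => by rwa [hκU y hy]) hp,
    divergence_kDual_of_const hΩ hκU hp.1, muForm_eq_zero hΩ hκU hp.1, dotProduct_zero, sub_zero,
    zero_add, scale, hκU p hp.1, mul_assoc ((n : ℝ) + 2), sign_mul_rpow hκ, ← mul_assoc]

/-- Along the flow of `W`, the function `F` decreases at constant speed. -/
theorem apply_maximalFlow (hΨ : Ψ ≠ 0) (hF : ∀ y ∈ Ω, ContDiffAt ℝ ∞ F y) (hκ : κ ≠ 0)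
    (hκU : ∀ y ∈ Ω, opU Ψ F y = κ) {t : ℝ} {p : Vec (n + 1)}
    (ht : (t, p) ∈ flowDomain (fieldW Ψ F) Ω) :
    F (maximalFlow (fieldW Ψ F) Ω t p) = F p - |κ| ^ (1 / ((n : ℝ) + 2)) * t := by
  have hU : ∀ y ∈ Ω, opU Ψ F y ≠ 0 := fun y hy => by rwa [hκU y hy]
  have hX : ∀ y ∈ Ω, ContDiffAt ℝ ∞ (fieldW Ψ F) y := fun y hy =>
    smooth_fieldW hΨ (hF y hy) (hU y hy)
  obtain ⟨J, γ, h, htJ⟩ := ht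
  rw [(h.maximalFlow_eq hX htJ).2]
  -- Since dF(W) = -s(x) with s(x) = |κ|^{1/(n+2)} constant on Ω, adding this rate times the time
  -- makes the derivative vanish.
  have hd : ∀ s ∈ J, HasDerivAt (fun s => F (γ s) + |κ| ^ (1 / ((n : ℝ) + 2)) * s) 0 s := by
    intro s hs
    have hm := h.mem s hs
    have h1 := (differentiableAt_of_smooth (hF _ hm)).hasFDerivAt.comp_hasDerivAt s
      (h.hasDerivAt s hs)
    have h2 := diff_dotProduct_fieldW hΨ (transpose_hess (hF _ hm)) (hU _ hm)
    rw [scale, hκU _ hm] at h2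
    have h3 : fderiv ℝ F (γ s) (fieldW Ψ F (γ s)) = -|κ| ^ (1 / ((n : ℝ) + 2)) := by
      rw [← h2, fderiv_eq_sum_pd]
      simp only [dotProduct, diff, smul_eq_mul, mul_comm]
    rw [h3] at h1
    have h4 := h1.add ((hasDerivAt_id s).const_mul (|κ| ^ (1 / ((n : ℝ) + 2))))
    rw [mul_one, neg_add_cancel] at h4
    exact h4
  have h5 := norm_sub_le_of_integralCurve (v := fun _ => (0 : ℝ)) (L := 0) (by simp)
    h.ordConnected h.zero_mem hd htJ
  rw [zero_mul, norm_le_zero_iff, sub_eq_zero, h.initial, mul_zero, add_zero] at h5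
  linarith

theorem contDiffAt_maximalFlow_apply {m : ℕ} {X : Vec m → Vec m} {Ω : Set (Vec m)}
    (hΩ : IsOpen Ω) (hX : ∀ y ∈ Ω, ContDiffAt ℝ ∞ X y) {t : ℝ} {p : Vec m}
    (h : (t, p) ∈ flowDomain X Ω) : ContDiffAt ℝ ∞ (maximalFlow X Ω t) p :=
  ContDiffAt.comp (g := fun u : ℝ × Vec m => maximalFlow X Ω u.1 u.2) (f := fun y => (t, y)) p
    (flow_contDiffAt hΩ hX h) (contDiffAt_const.prodMk contDiffAt_id)

/-- The flow at time -t inverts the flow at time t near p, so by the chain rule its derivative is a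
left inverse. -/
theorem fderiv_maximalFlow_injective {m : ℕ} {X : Vec m → Vec m} {Ω : Set (Vec m)}
    (hΩ : IsOpen Ω) (hX : ∀ y ∈ Ω, ContDiffAt ℝ ∞ X y) {t : ℝ} {p : Vec m}
    (h : (t, p) ∈ flowDomain X Ω) :
    Function.Injective (fderiv ℝ (maximalFlow X Ω t) p) := by
  have h1 := differentiableAt_of_smooth (contDiffAt_maximalFlow_apply hΩ hX h)
  have h2 := differentiableAt_of_smooth (contDiffAt_maximalFlow_apply hΩ hX (flow_neg hX h).1)
  have e : (fun y => maximalFlow X Ω (-t) (maximalFlow X Ω t y)) =ᶠ[𝓝 p] id := by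
    have hev : ∀ᶠ y in 𝓝 p, (t, y) ∈ flowDomain X Ω :=
      (Continuous.prodMk_right t).continuousAt ((isOpen_flowDomain hΩ hX).mem_nhds h)
    filter_upwards [hev] with y hy using (flow_neg hX hy).2
  have h3 := h2.hasFDerivAt.comp p h1.hasFDerivAt
  have h4 := h3.unique ((hasFDerivAt_id p).congr_of_eventuallyEq e)
  refine Function.LeftInverse.injective
    (g := fderiv ℝ (maximalFlow X Ω (-t)) (maximalFlow X Ω t p)) fun v => ?_
  exact DFunLike.congr_fun h4 v

variable {t₀ : ℝ} {Δ : Set (Vec n)} {φ₀ : Vec n → Vec (n + 1)}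

/-- The flow of `W` maps parametrized pieces of level sets to parametrized pieces of level sets. -/
theorem isParam_maximalFlow (hΨ : Ψ ≠ 0) (hΩ : IsOpen Ω) (hF : ∀ y ∈ Ω, ContDiffAt ℝ ∞ F y)
    (hκ : κ ≠ 0) (hκU : ∀ y ∈ Ω, opU Ψ F y = κ) (hφ : IsParam (level F t₀ Ω) Δ φ₀) (t : ℝ) :
    IsParam (level F (t₀ - |κ| ^ (1 / ((n : ℝ) + 2)) * t) Ω)
      {x | x ∈ Δ ∧ (t, φ₀ x) ∈ flowDomain (fieldW Ψ F) Ω}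
      (fun x => maximalFlow (fieldW Ψ F) Ω t (φ₀ x)) := by
  have hX : ∀ y ∈ Ω, ContDiffAt ℝ ∞ (fieldW Ψ F) y := fun y hy =>
    smooth_fieldW hΨ (hF y hy) (by rwa [hκU y hy])
  refine ⟨?_, ?_, ?_, ?_, ?_⟩
  · have hc : ContinuousOn (fun x => (t, φ₀ x)) Δ :=
      continuousOn_const.prodMk hφ.smooth.continuousOn
    exact hc.isOpen_inter_preimage hφ.isOpen (isOpen_flowDomain hΩ hX)
  · rintro x ⟨hx, hxt⟩
    exact ((contDiffAt_maximalFlow_apply hΩ hX hxt).comp x (hφ.contDiffAt hx)).contDiffWithinAt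
  · rintro x ⟨hx, hxt⟩ y ⟨hy, hyt⟩ hxy
    refine hφ.injOn hx hy ?_
    rw [← (flow_neg hX hxt).2, ← (flow_neg hX hyt).2]
    exact congrArg _ hxy
  · rintro x ⟨hx, hxt⟩
    have hpd : (fun i => pd i (fun x => maximalFlow (fieldW Ψ F) Ω t (φ₀ x)) x) =
        (fderiv ℝ (maximalFlow (fieldW Ψ F) Ω t) (φ₀ x)).toLinearMap ∘ fun i => pd i φ₀ x := by
      funext i
      rw [pd_comp i (differentiableAt_of_smooth (contDiffAt_maximalFlow_apply hΩ hX hxt))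
        (differentiableAt_of_smooth (hφ.contDiffAt hx)), ← fderiv_eq_sum_pd]
      rfl
    rw [hpd]
    exact (hφ.immersion x hx).map' _
      (LinearMap.ker_eq_bot.2 (fderiv_maximalFlow_injective hΩ hX hxt))
  · rintro x ⟨hx, hxt⟩
    refine ⟨(flow_hasDerivAt hX hxt).2, ?_⟩
    rw [apply_maximalFlow hΨ hF hκ hκU hxt, (hφ.mapsTo hx).2]

/-- The flow of `W` solves the affine normal flow. -/
theorem isAffineNormalFlow_maximalFlow (hΨ : Ψ ≠ 0) (hΩ : IsOpen Ω)
    (hF : ∀ y ∈ Ω, ContDiffAt ℝ ∞ F y) (hκ : κ ≠ 0) (hκU : ∀ y ∈ Ω, opU Ψ F y = κ)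
    (hφ : IsParam (level F t₀ Ω) Δ φ₀) :
    IsAffineNormalFlow Ψ {q | q.2 ∈ Δ ∧ (q.1, φ₀ q.2) ∈ flowDomain (fieldW Ψ F) Ω}
      (fun t x => maximalFlow (fieldW Ψ F) Ω t (φ₀ x)) := by
  have hU : ∀ y ∈ Ω, opU Ψ F y ≠ 0 := fun y hy => by rwa [hκU y hy]
  have hX : ∀ y ∈ Ω, ContDiffAt ℝ ∞ (fieldW Ψ F) y := fun y hy =>
    smooth_fieldW hΨ (hF y hy) (hU y hy)
  refine ⟨?_, ?_, fun t => ?_⟩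
  · have hc : ContinuousOn (fun q : ℝ × Vec n => (q.1, φ₀ q.2)) (Prod.snd ⁻¹' Δ) :=
      continuousOn_fst.prodMk (hφ.smooth.continuousOn.comp continuousOn_snd fun _ hq => hq)
    exact hc.isOpen_inter_preimage (hφ.isOpen.preimage continuous_snd) (isOpen_flowDomain hΩ hX)
  · rintro q ⟨hq, hqt⟩
    have h1 : ContDiffAt ℝ ∞ (fun q : ℝ × Vec n => (q.1, φ₀ q.2)) q :=
      contDiffAt_fst.prodMk ((hφ.contDiffAt hq).comp q contDiffAt_snd)
    exact (ContDiffAt.comp (g := fun u : ℝ × Vec (n + 1) => maximalFlow (fieldW Ψ F) Ω u.1 u.2) q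
      (flow_contDiffAt hΩ hX hqt) h1).contDiffWithinAt
  · exact isEquiaffineNormalAlong hΨ hF hU (isParam_maximalFlow hΨ hΩ hF hκ hκU hφ t)
      fun x hx => (flow_hasDerivAt hX hx.2).1.deriv

end ConstantU

end LevelSet

/-! ### Assembly of the general case and the constant `U(F)` case -/

theorem lemma2p11 {n : ℕ} (hn : 1 ≤ n)
    (Ψ : LevelSet.Vec (n + 1) [⋀^Fin (n + 1)]→ₗ[ℝ] ℝ) (hΨ : Ψ ≠ 0)
    (D : Set (LevelSet.Vec (n + 1))) (hD : IsOpen D)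
    (F : LevelSet.Vec (n + 1) → ℝ) (hF : ContDiffOn ℝ ∞ F D) :
    -- level sets in a connected component of the region where `U(F)` does not vanish
    (∀ Ω : Set (LevelSet.Vec (n + 1)),
      (∃ x₀ ∈ {x ∈ D | LevelSet.opU Ψ F x ≠ 0},
        Ω = connectedComponentIn {x ∈ D | LevelSet.opU Ψ F x ≠ 0} x₀) →
      -- `ρ(W) = 1`
      (∀ x ∈ Ω, LevelSet.conormal Ψ F x ⬝ᵥ LevelSet.fieldW Ψ F x = 1) ∧
      ∀ r : ℝ,
        -- `ρ` annihilates the tangent spaces of the level set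
        (∀ (Δ : Set (LevelSet.Vec n)) (f : LevelSet.Vec n → LevelSet.Vec (n + 1)),
          LevelSet.IsParam (LevelSet.level F r Ω) Δ f → ∀ x ∈ Δ, ∀ i : Fin n,
            LevelSet.conormal Ψ F (f x) ⬝ᵥ LevelSet.pd i f x = 0) ∧
        -- the equiaffine normal of the level set is `W`
        (∀ ξ : LevelSet.Vec (n + 1) → LevelSet.Vec (n + 1),
          LevelSet.IsEquiaffineNormal Ψ (LevelSet.level F r Ω) (LevelSet.coorient Ψ F) ξ ↔
            EqOn ξ (LevelSet.fieldW Ψ F) (LevelSet.level F r Ω)) ∧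
        -- the two formulas for the equiaffine mean curvature
        ∀ p ∈ LevelSet.level F r Ω, ∀ H : ℝ,
          (LevelSet.IsEquiaffineMeanCurvatureAt Ψ (LevelSet.level F r Ω)
              (LevelSet.coorient Ψ F) p H ↔
            n * H =
              LevelSet.divergence (fun y => LevelSet.kDual Ψ F y *ᵥ LevelSet.muForm Ψ F y) p
              + (n + 2) * |LevelSet.opU Ψ F p| ^ (1 / ((n : ℝ) + 2)) * (LevelSet.opU Ψ F p)⁻¹
                * (LevelSet.hessDet Ψ F p
                    - LevelSet.fieldN Ψ F p ⬝ᵥ LevelSet.muForm Ψ F p)) ∧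
          (LevelSet.IsEquiaffineMeanCurvatureAt Ψ (LevelSet.level F r Ω)
              (LevelSet.coorient Ψ F) p H ↔
            n * H =
              LevelSet.divergence (fun y => LevelSet.kDual Ψ F y *ᵥ LevelSet.muForm Ψ F y) p
              + (-1) ^ (n + 1) * (n + 2) * Real.sign (LevelSet.opU Ψ F p)
                * LevelSet.detRel Ψ (LevelSet.gradConormal Ψ F p))) ∧
    -- the case where `U(F)` is a nonzero constant on a connected open set
    (∀ (Ω : Set (LevelSet.Vec (n + 1))) (κ : ℝ), IsOpen Ω → IsConnected Ω → Ω ⊆ D → κ ≠ 0 →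
      (∀ x ∈ Ω, LevelSet.opU Ψ F x = κ) →
      (∀ x ∈ Ω, LevelSet.fieldW Ψ F x =
        -((Real.sign κ * |κ| ^ (-((n : ℝ) + 1) / ((n : ℝ) + 2))) • LevelSet.fieldN Ψ F x)) ∧
      (∀ r : ℝ,
        (∀ ξ : LevelSet.Vec (n + 1) → LevelSet.Vec (n + 1),
          LevelSet.IsEquiaffineNormal Ψ (LevelSet.level F r Ω) (LevelSet.coorient Ψ F) ξ ↔
            EqOn ξ
              (fun x => -((Real.sign κ * |κ| ^ (-((n : ℝ) + 1) / ((n : ℝ) + 2))) •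
                LevelSet.fieldN Ψ F x))
              (LevelSet.level F r Ω)) ∧
        ∀ p ∈ LevelSet.level F r Ω, ∀ H : ℝ,
          LevelSet.IsEquiaffineMeanCurvatureAt Ψ (LevelSet.level F r Ω)
              (LevelSet.coorient Ψ F) p H ↔
            n * H = (n + 2) * Real.sign κ * |κ| ^ (-((n : ℝ) + 1) / ((n : ℝ) + 2))
              * LevelSet.hessDet Ψ F p) ∧
      -- the flow of the equiaffine normal, starting from a parametrized piece of a level set
      ∀ (t₀ : ℝ) (Δ : Set (LevelSet.Vec n)) (φ₀ : LevelSet.Vec n → LevelSet.Vec (n + 1)),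
        LevelSet.IsParam (LevelSet.level F t₀ Ω) Δ φ₀ →
        ∀ (ψ φ : ℝ → LevelSet.Vec n → LevelSet.Vec (n + 1)) (𝒟ψ 𝒟φ : Set (ℝ × LevelSet.Vec n)),
          ψ = (fun t x => LevelSet.maximalFlow (LevelSet.fieldW Ψ F) Ω t (φ₀ x)) →
          𝒟ψ = {q | q.2 ∈ Δ ∧ (q.1, φ₀ q.2) ∈ LevelSet.flowDomain (LevelSet.fieldW Ψ F) Ω} →
          φ = (fun t x => ψ (-(|κ| ^ (-1 / ((n : ℝ) + 2)) * t)) x) →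
          𝒟φ = {q | (-(|κ| ^ (-1 / ((n : ℝ) + 2)) * q.1), q.2) ∈ 𝒟ψ} →
          -- `ψ` solves the affine normal flow
          (LevelSet.IsAffineNormalFlow Ψ 𝒟ψ ψ ∧
            (∀ x ∈ Δ, (0, x) ∈ 𝒟ψ ∧ ψ 0 x = φ₀ x) ∧
            ∀ t x, (t, x) ∈ 𝒟ψ →
              HasDerivAt (fun s => ψ s x) (LevelSet.fieldW Ψ F (ψ t x)) t ∧
              F (ψ t x) = t₀ - |κ| ^ (1 / ((n : ℝ) + 2)) * t) ∧
          -- its reparametrization `φ` in time moves the level sets of `F` at unit speed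
          (∀ t x, (t, x) ∈ 𝒟φ →
            HasDerivAt (fun s => φ s x)
              (-(|κ| ^ (-1 / ((n : ℝ) + 2)) • LevelSet.fieldW Ψ F (φ t x))) t ∧
            F (φ t x) = t + t₀) ∧
          (∀ t, LevelSet.IsParam (LevelSet.level F (t + t₀) Ω) {x | (t, x) ∈ 𝒟φ} (φ t))) := by
  have hsmooth : ∀ Ω : Set (LevelSet.Vec (n + 1)), Ω ⊆ D →
      ∀ y ∈ Ω, ContDiffAt ℝ ∞ F y := fun Ω hΩD y hy =>
    (hF y (hΩD hy)).contDiffAt (hD.mem_nhds (hΩD hy))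
  refine ⟨?_, ?_⟩
  · rintro Ω ⟨x₀, -, rfl⟩
    have hreg : IsOpen {x ∈ D | LevelSet.opU Ψ F x ≠ 0} := by
      have hc : ContinuousOn (LevelSet.opU Ψ F) D := fun y hy =>
        (LevelSet.smooth_opU
          ((hF y hy).contDiffAt (hD.mem_nhds hy))).continuousAt.continuousWithinAt
      exact hc.isOpen_inter_preimage hD isOpen_ne
    have hsub := connectedComponentIn_subset {x ∈ D | LevelSet.opU Ψ F x ≠ 0} x₀
    have hΩ : IsOpen (connectedComponentIn {x ∈ D | LevelSet.opU Ψ F x ≠ 0} x₀) :=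
      hreg.connectedComponentIn
    generalize connectedComponentIn {x ∈ D | LevelSet.opU Ψ F x ≠ 0} x₀ = Ω at hsub hΩ
    have hFΩ := hsmooth Ω fun y hy => (hsub hy).1
    have hU : ∀ y ∈ Ω, LevelSet.opU Ψ F y ≠ 0 := fun y hy => (hsub hy).2
    refine ⟨fun x hx => LevelSet.conormal_dotProduct_fieldW_of_mem hΨ hFΩ hU hx, fun r =>
      ⟨fun Δ f hf x hx i => LevelSet.conormal_dotProduct_pd hFΩ hf hx i,
        LevelSet.isEquiaffineNormal_iff hΨ hΩ hFΩ hU, fun p hp H => ⟨?_, ?_⟩⟩⟩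
    · exact LevelSet.isEquiaffineMeanCurvatureAt_iff hn hΨ hΩ hFΩ hU hp H
    · rw [LevelSet.detRel_gradConormal hΨ (hFΩ p hp.1) (hU p hp.1)]
      exact LevelSet.isEquiaffineMeanCurvatureAt_iff hn hΨ hΩ hFΩ hU hp H
  · intro Ω κ hΩ _ hΩD hκ hκU
    have hFΩ := hsmooth Ω hΩD
    have hU : ∀ y ∈ Ω, LevelSet.opU Ψ F y ≠ 0 := fun y hy => by rwa [hκU y hy]
    have hW := fun x (hx : x ∈ Ω) => LevelSet.fieldW_of_const (Ψ := Ψ) (F := F) hΩ hκ hκU hx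
    have hX : ∀ y ∈ Ω, ContDiffAt ℝ ∞ (LevelSet.fieldW Ψ F) y := fun y hy =>
      LevelSet.smooth_fieldW hΨ (hFΩ y hy) (hU y hy)
    refine ⟨hW, fun r => ⟨fun ξ => ?_, fun p hp H =>
      LevelSet.isEquiaffineMeanCurvatureAt_iff_of_const hn hΨ hΩ hFΩ hκ hκU hp H⟩, ?_⟩
    · rw [LevelSet.isEquiaffineNormal_iff hΨ hΩ hFΩ hU]
      have hEq : EqOn (LevelSet.fieldW Ψ F) (fun x =>
          -((Real.sign κ * |κ| ^ (-((n : ℝ) + 1) / ((n : ℝ) + 2))) • LevelSet.fieldN Ψ F x))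
          (LevelSet.level F r Ω) := fun x hx => hW x hx.1
      exact ⟨fun h => h.trans hEq, fun h => h.trans hEq.symm⟩
    · rintro t₀ Δ φ₀ hφ _ _ _ _ rfl rfl rfl rfl
      have hsc : |κ| ^ (1 / ((n : ℝ) + 2)) ≠ 0 :=
        (Real.rpow_pos_of_pos (abs_pos.2 hκ) _).ne'
      -- The rescaling factor is minus the reciprocal of the rate at which F decreases, so in the
      -- new time F increases at unit speed.
      have hlevel : ∀ t, t₀ - |κ| ^ (1 / ((n : ℝ) + 2)) *
          -(|κ| ^ (-1 / ((n : ℝ) + 2)) * t) = t + t₀ := by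
        intro t
        rw [LevelSet.rpow_neg_one_div]
        field_simp
        ring
      have hval : ∀ t x, x ∈ Δ → (t, φ₀ x) ∈ LevelSet.flowDomain (LevelSet.fieldW Ψ F) Ω →
          F (LevelSet.maximalFlow (LevelSet.fieldW Ψ F) Ω t (φ₀ x)) =
            t₀ - |κ| ^ (1 / ((n : ℝ) + 2)) * t := by
        intro t x hx ht
        rw [LevelSet.apply_maximalFlow hΨ hFΩ hκ hκU ht, (hφ.mapsTo hx).2]
      refine ⟨⟨LevelSet.isAffineNormalFlow_maximalFlow hΨ hΩ hFΩ hκ hκU hφ, fun x hx => ?_,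
        fun t x ht => ⟨(LevelSet.flow_hasDerivAt hX ht.2).1, hval t x ht.1 ht.2⟩⟩,
        fun t x ht => ⟨?_, ?_⟩, fun t => ?_⟩
      · have h0 := LevelSet.flow_zero hΩ hX (hφ.mapsTo hx).1
        exact ⟨⟨hx, h0.1⟩, h0.2⟩
      · have h1 := (LevelSet.flow_hasDerivAt hX ht.2).1
        have h2 : HasDerivAt (fun s : ℝ => -(|κ| ^ (-1 / ((n : ℝ) + 2)) * s))
            (-|κ| ^ (-1 / ((n : ℝ) + 2))) t := by
          simpa using ((hasDerivAt_id t).const_mul (|κ| ^ (-1 / ((n : ℝ) + 2)))).fun_neg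
        have h3 := HasDerivAt.scomp t h1 h2
        rw [neg_smul] at h3
        exact h3
      · rw [← hlevel]
        exact hval _ x ht.1 ht.2
      · rw [← hlevel]
        exact LevelSet.isParam_maximalFlow hΨ hΩ hFΩ hκ hκU hφ _
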